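/- Consider oriented site percolation on the triangular lattice (the OTSP model) with parameter $p\in[0,1]$: let $(U_x)_{x\in\mathbb Z^2}$ be i.i.d. uniform on $[0,1]$; a site $x$ is open if $U_x<p$ and closed otherwise. From an open site $x$ there are directed edges to $x+(-1,0)$, $x+(0,1)$ and $x+(-1,1)$; from a closed site there are none. Let $\mathbf C_o=\mathbf C_o(p)$ be the set of sites reachable from the origin along directed edges (including the origin itself), and let $p_c=\inf\{p\in[0,1]:\mathbb P(|\mathbf C_o(p)|=\infty)>0\}$. For $n\ge 0$ let $w_n=\sup\{y:(-n,y)\in\mathbf C_o\}$ and $v_n=\inf\{y:(-n,y)\in\mathbf C_o\}$. Then $p_c<1$, and for each $p\in(p_c,1)$ there is exactly one real number $\rho_p$ (the boundary slope) such that, almost surely on the event $\{|\mathbf C_o(p)|=\infty\}$, $\frac{w_n}{-n}\to\rho_p$ and $\frac{v_n}{-n}\to 1/\rho_p$ as $n\to\infty$. The function $p\mapsto\rho_p$ is continuous and strictly decreasing on $(p_c,1)$, and $\rho_p\uparrow-1$ as $p\downarrow p_c$. -/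

import Mathlib

open MeasureTheory Filter Topology Set

namespace OTSP

/-- An environment on `ℤ²`: every site `x` carries the set `G x` of steps allowed from `x`. -/
abbrev Env : Type := ℤ × ℤ → Set (ℤ × ℤ)

/-- `x → y`: there are `n ≥ 0` and `x = x₀, …, xₙ = y` with `xᵢ₊₁ - xᵢ ∈ G xᵢ` for `i < n`. -/
def Connects (G : Env) : ℤ × ℤ → ℤ × ℤ → Prop :=
  Relation.ReflTransGen fun a b => b - a ∈ G a

/-- The forward cluster of `x`. -/
def cluster (G : Env) (x : ℤ × ℤ) : Set (ℤ × ℤ) := {y | Connects G x y}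

/-- The three steps of an open site: left, up, and diagonally up-left. -/
def steps : Set (ℤ × ℤ) := {(-1, 0), (0, 1), (-1, 1)}

/-- A realisation of the uniform random variables `U x`, one for each site. -/
abbrev Sample : Type := ℤ × ℤ → unitInterval

/-- The joint law of i.i.d. uniform random variables on `[0, 1]` indexed by the sites. -/
noncomputable def law : Measure Sample :=
  Measure.infinitePi fun _ : ℤ × ℤ => (volume : Measure unitInterval)

/-- The environment with parameter `p` (coupled for all `p`): a site is open iff `U x < p`. -/
def env (p : ℝ) (U : Sample) : Env := fun x => {e | (U x : ℝ) < p ∧ e ∈ steps}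

/-- The forward cluster of the origin at parameter `p`. -/
def originCluster (p : ℝ) (U : Sample) : Set (ℤ × ℤ) := cluster (env p U) (0, 0)

/-- The probability that the forward cluster of the origin is infinite. -/
noncomputable def theta (p : ℝ) : ENNReal := law {U | (originCluster p U).Infinite}

/-- The critical value. -/
noncomputable def pc : ℝ := sInf {p : ℝ | p ∈ Icc (0 : ℝ) 1 ∧ 0 < theta p}

/-- `w n = sup {y | (-n, y) ∈ C}`, in the extended reals. -/
noncomputable def upper (C : Set (ℤ × ℤ)) (n : ℕ) : EReal :=
  ⨆ y ∈ {y : ℤ | (-(n : ℤ), y) ∈ C}, ((y : ℝ) : EReal)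

/-- `v n = inf {y | (-n, y) ∈ C}`, in the extended reals. -/
noncomputable def lower (C : Set (ℤ × ℤ)) (n : ℕ) : EReal :=
  ⨅ y ∈ {y : ℤ | (-(n : ℤ), y) ∈ C}, ((y : ℝ) : EReal)

/-- `r` is the boundary slope at parameter `p`: almost surely on the event that the cluster of the
origin is infinite, its upper and lower boundaries have asymptotic slopes `r` and `1 / r`. -/
def IsBoundarySlope (p r : ℝ) : Prop :=
  ∀ᵐ U ∂law, (originCluster p U).Infinite →
    Tendsto (fun n : ℕ => upper (originCluster p U) n / ((-(n : ℝ) : ℝ) : EReal))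
      atTop (𝓝 (r : EReal)) ∧
    Tendsto (fun n : ℕ => lower (originCluster p U) n / ((-(n : ℝ) : ℝ) : EReal))
      atTop (𝓝 ((1 / r : ℝ) : EReal))

end OTSP

/-
All parameters are coupled through the uniform variables. After a reflection, paths go right, up and
diagonally, and the upper edge is the height of the highest entry into a column from the half-line
below the origin. Restarting the edge from a full half-line every `m` columns can only raise it and
gives i.i.d. increments, so by the law of large numbers its slope is at most the speed, the infimum
over `n` of the mean height of column `n` divided by `n`. For the lower bound, a law of large
numbers again shows that thin tubes whose slope is the speed are crossed with probability close to
one, and if the speed exceeds one, a multi-scale argument chains crossed tubes to crossed tubes of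
larger scales at an arbitrarily small loss of slope. This argument starts from an open condition on
one finite tube, so it also works at slightly smaller parameters.

By symmetry in the diagonal, the lower edge of an infinite cluster has the inverse slope. If the
speed is below one, the two edges meet and the cluster is finite; if it is above one, planarity
makes the paths near the two edges cross and an infinite cluster exists. When the parameter grows by
`ε`, the site at the edge opens with probability `ε` in each column, which raises the edge by at
least one on average, so the speed is strictly increasing. Continuity from the right and the limit
at the critical value follow from the right-continuity of the finite means, continuity from the left
from the openness of the starting condition.
-/

namespace OTSP

open ProbabilityTheory

/-! ### Integer-valued random variables -/

section

variable {Ω : Type*} {mΩ : MeasurableSpace Ω} {μ : Measure Ω}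

lemma measurable_comp_index {β : Type*} [MeasurableSpace β] {Z : Ω → ℤ} (hZ : Measurable Z)
    {f : ℤ → Ω → β} (hf : ∀ z, Measurable (f z)) : Measurable fun ω => f (Z ω) ω :=
  (measurable_from_prod_countable_right (f := fun q : ℤ × Ω => f q.1 q.2) hf).comp
    (hZ.prodMk measurable_id)

lemma measurable_intCast_sub {f g : Ω → ℤ} (hf : Measurable f) (hg : Measurable g) :
    Measurable fun ω => ((f ω - g ω : ℤ) : ℝ) :=
  (measurable_of_countable (Int.cast : ℤ → ℝ)).comp (hf.sub hg)

lemma sSup_int_eq_iff (E : Set ℤ) (y : ℤ) :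
    sSup E = y ↔ IsGreatest E y ∨ (¬ ∃ w, IsGreatest E w) ∧ y = 0 := by
  by_cases h : ∃ w, IsGreatest E w
  · obtain ⟨w, hw⟩ := h
    have hex : ∃ w, IsGreatest E w := ⟨w, hw⟩
    simp only [hex, not_true_eq_false, false_and, or_false, hw.csSup_eq]
    exact ⟨fun h => h ▸ hw, hw.unique⟩
  · have hzero : sSup E = 0 := by
      rcases E.eq_empty_or_nonempty with rfl | hne
      · exact Int.csSup_empty
      · exact Int.csSup_of_not_bddAbove fun hb =>
          h ⟨_, Int.csSup_mem hne hb, fun z hz => le_csSup hb hz⟩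
    have hy : ¬ IsGreatest E y := fun hy => h ⟨y, hy⟩
    simp only [hzero, h, hy, not_false_eq_true, true_and, false_or, eq_comm]

lemma measurable_sSup_int {E : Ω → Set ℤ} (hE : ∀ y, Measurable fun ω => y ∈ E ω) :
    Measurable fun ω => sSup (E ω) := by
  have hgreatest (w : ℤ) : Measurable fun ω => IsGreatest (E ω) w :=
    (hE w).and (Measurable.forall fun z => (hE z).imp measurable_const)
  refine measurable_to_countable' fun y => ?_
  have hpre : (fun ω => sSup (E ω)) ⁻¹' {y} =
      {ω | IsGreatest (E ω) y ∨ (¬ ∃ w, IsGreatest (E ω) w) ∧ y = 0} := by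
    ext ω
    exact sSup_int_eq_iff _ _
  rw [hpre, measurableSet_setOfPred]
  exact (hgreatest y).or ((Measurable.exists hgreatest).not.and measurable_const)

lemma ofReal_intCast_eq_toNat (z : ℤ) : ENNReal.ofReal (z : ℝ) = (z.toNat : ENNReal) := by
  rcases le_total 0 z with hz | hz
  · lift z to ℕ using hz
    simp
  · rw [ENNReal.ofReal_of_nonpos (by exact_mod_cast hz), Int.toNat_of_nonpos hz, Nat.cast_zero]

lemma enorm_intCast_eq_add (z : ℤ) :
    ‖(z : ℝ)‖ₑ = (z.toNat : ENNReal) + ((-z).toNat : ENNReal) := by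
  rw [Real.enorm_eq_ofReal_abs, ← Int.cast_abs, ofReal_intCast_eq_toNat, ← Nat.cast_add]
  congr 1
  rcases abs_cases z with hz | hz <;> omega

lemma integrable_intCast {f : Ω → ℤ} (hf : Measurable f)
    (hpos : ∫⁻ ω, ((f ω).toNat : ENNReal) ∂μ < ⊤)
    (hneg : ∫⁻ ω, ((-f ω).toNat : ENNReal) ∂μ < ⊤) : Integrable (fun ω => (f ω : ℝ)) μ := by
  refine ⟨((measurable_of_countable (Int.cast : ℤ → ℝ)).comp hf).aestronglyMeasurable, ?_⟩
  simp only [HasFiniteIntegral, enorm_intCast_eq_add]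
  rw [lintegral_add_left (f := fun ω => ((f ω).toNat : ENNReal))
    ((measurable_of_countable fun z : ℤ => (z.toNat : ENNReal)).comp hf)]
  exact ENNReal.add_lt_top.2 ⟨hpos, hneg⟩

lemma integral_intCast_le_toReal_lintegral {f : Ω → ℤ}
    (hf : Integrable (fun ω => (f ω : ℝ)) μ) :
    ∫ ω, (f ω : ℝ) ∂μ ≤ (∫⁻ ω, ((f ω).toNat : ENNReal) ∂μ).toReal := by
  rw [integral_eq_lintegral_pos_part_sub_lintegral_neg_part hf]
  simp only [ofReal_intCast_eq_toNat]
  exact sub_le_self _ ENNReal.toReal_nonneg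

lemma lintegral_natCast_le_of_geometric_tail {N : Ω → ℕ} (hN : Measurable N) {c r : ENNReal}
    (h : ∀ j : ℕ, μ {ω | j < N ω} ≤ c * r ^ j) :
    ∫⁻ ω, (N ω : ENNReal) ∂μ ≤ c * (1 - r)⁻¹ := by
  have hsum (ω : Ω) : (N ω : ENNReal) = ∑' j : ℕ, {ω | j < N ω}.indicator 1 ω := by
    rw [tsum_eq_sum (s := Finset.range (N ω)) fun j hj => by simpa [Set.indicator] using hj,
      Finset.sum_congr rfl (g := fun _ => 1) fun j hj => by simpa [Set.indicator] using hj]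
    simp
  have hmeas (j : ℕ) : MeasurableSet {ω | j < N ω} := measurableSet_lt measurable_const hN
  calc ∫⁻ ω, (N ω : ENNReal) ∂μ
      = ∑' j : ℕ, μ {ω | j < N ω} := by
        simp_rw [hsum]
        rw [lintegral_tsum fun j => (measurable_one.indicator (hmeas j)).aemeasurable]
        simp_rw [lintegral_indicator_one (hmeas _)]
    _ ≤ ∑' j : ℕ, c * r ^ j := ENNReal.tsum_le_tsum h
    _ = c * (1 - r)⁻¹ := by rw [ENNReal.tsum_mul_left, ENNReal.tsum_geometric]

lemma measure_inter_mem_index_of_indep {m₁ m₂ : MeasurableSpace Ω} (hind : Indep m₁ m₂ μ)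
    (hm₁ : m₁ ≤ mΩ) (hm₂ : m₂ ≤ mΩ) {Z : Ω → ℤ} (hZ : Measurable[m₁] Z) {B : Set Ω}
    (hB : MeasurableSet[m₁] B) {D : ℤ → Set Ω} (hD : ∀ z, MeasurableSet[m₂] (D z)) {d : ENNReal}
    (hd : ∀ z, μ (D z) = d) : μ (B ∩ {ω | ω ∈ D (Z ω)}) = μ B * d := by
  have hlevel (z : ℤ) : MeasurableSet[m₁] (B ∩ Z ⁻¹' {z}) :=
    hB.inter (hZ (measurableSet_singleton z))
  have hdisj : Pairwise (Function.onFun Disjoint fun z => B ∩ Z ⁻¹' {z}) :=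
    fun z z' hz => Set.disjoint_left.2 fun ω h h' => hz (h.2.symm.trans h'.2)
  have hsplit : B ∩ {ω | ω ∈ D (Z ω)} = ⋃ z, (B ∩ Z ⁻¹' {z}) ∩ D z := by
    ext ω; simp
  have hB_eq : B = ⋃ z, B ∩ Z ⁻¹' {z} := by
    ext ω; simp
  calc μ (B ∩ {ω | ω ∈ D (Z ω)})
      = ∑' z, μ ((B ∩ Z ⁻¹' {z}) ∩ D z) := by
        rw [hsplit, measure_iUnion
          (fun z z' hz => (hdisj hz).mono inter_subset_left inter_subset_left)
          fun z => (hm₁ _ (hlevel z)).inter (hm₂ _ (hD z))]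
    _ = ∑' z, μ (B ∩ Z ⁻¹' {z}) * d :=
        tsum_congr fun z => by rw [(Indep_iff _ _ _).1 hind _ _ (hlevel z) (hD z), hd]
    _ = μ B * d := by
        rw [ENNReal.tsum_mul_right, ← measure_iUnion hdisj fun z => hm₁ _ (hlevel z), ← hB_eq]

end

/-! ### Sequences -/

lemma eq_zero_of_le_pow {x r : ENNReal} (hr : r < 1) (h : ∀ k : ℕ, x ≤ r ^ k) : x = 0 :=
  le_antisymm (ge_of_tendsto' (ENNReal.tendsto_pow_atTop_nhds_zero_of_lt_one hr) h) zero_le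

lemma exists_le_le_succ_of_forall_le {L : ℕ → ℕ} (hL : ∀ k, k ≤ L k) {k n : ℕ} (hkn : L k ≤ n) :
    ∃ j, k ≤ j ∧ L j ≤ n ∧ n ≤ L (j + 1) := by
  by_contra! hc
  have hbdd : ∀ i, L (k + i) ≤ n := by
    intro i
    induction i with
    | zero => exact hkn
    | succ i ih => exact (hc (k + i) (by omega) ih).le
  have := hbdd (n + 1)
  have := hL (k + (n + 1))
  omega

lemma tendsto_div_of_linear_bounds {W : ℕ → ℝ} {a : ℝ}
    (hup : ∀ b > a, ∃ K : ℝ, ∀ n : ℕ, W n ≤ b * n + K)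
    (hlo : ∀ b < a, ∃ K : ℝ, ∀ n : ℕ, b * n - K ≤ W n) :
    Tendsto (fun n : ℕ => W n / n) atTop (𝓝 a) := by
  refine tendsto_order.2 ⟨fun b hb => ?_, fun b hb => ?_⟩
  · obtain ⟨c, hbc, hca⟩ := exists_between hb
    obtain ⟨K, hK⟩ := hlo c hca
    filter_upwards [(tendsto_const_div_atTop_nhds_zero_nat K).eventually_lt_const (sub_pos.2 hbc),
      eventually_gt_atTop 0] with n hn hn0
    have hn0 : (0 : ℝ) < n := Nat.cast_pos.2 hn0
    rw [div_lt_iff₀ hn0] at hn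
    rw [lt_div_iff₀ hn0]
    linarith [hK n]
  · obtain ⟨c, hac, hcb⟩ := exists_between hb
    obtain ⟨K, hK⟩ := hup c hac
    filter_upwards [(tendsto_const_div_atTop_nhds_zero_nat K).eventually_lt_const (sub_pos.2 hcb),
      eventually_gt_atTop 0] with n hn hn0
    have hn0 : (0 : ℝ) < n := Nat.cast_pos.2 hn0
    rw [div_lt_iff₀ hn0] at hn
    rw [div_lt_iff₀ hn0]
    linarith [hK n]

lemma tendsto_ereal_div_neg_of_linear_bounds {W : ℕ → EReal} {a : ℝ}
    (hup : ∀ b > a, ∃ K : ℝ, ∀ n : ℕ, W n ≤ ((b * n + K : ℝ) : EReal))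
    (hlo : ∀ b < a, ∃ K : ℝ, ∀ n : ℕ, ((b * n - K : ℝ) : EReal) ≤ W n) :
    Tendsto (fun n : ℕ => W n / ((-(n : ℝ) : ℝ) : EReal)) atTop (𝓝 ((-a : ℝ) : EReal)) := by
  have hW : ∃ w : ℕ → ℝ, W = fun n => (w n : EReal) := by
    obtain ⟨K, hK⟩ := hup (a + 1) (lt_add_one a)
    obtain ⟨K', hK'⟩ := hlo (a - 1) (sub_one_lt a)
    exact ⟨fun n => (W n).toReal, funext fun n => (EReal.coe_toReal
      ((hK n).trans_lt (EReal.coe_lt_top _)).ne ((EReal.bot_lt_coe _).trans_le (hK' n)).ne').symm⟩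
  obtain ⟨w, rfl⟩ := hW
  simp only [EReal.coe_le_coe_iff] at hup hlo
  refine (EReal.tendsto_coe.2 (tendsto_div_of_linear_bounds hup hlo).neg).congr fun n => ?_
  rw [← EReal.coe_div, div_neg]

/-! ### Directed paths in a set of open sites -/

section

variable {O O' R : Set (ℤ × ℤ)} {x y u v : ℤ × ℤ}

/-- A directed edge out of an open site, for the set `O` of open sites: a step right, up or
diagonally up-right. This is the model of the statement reflected in the vertical axis, so that
paths advance through the columns in increasing order. -/
def Step (O : Set (ℤ × ℤ)) (x y : ℤ × ℤ) : Prop :=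
  x ∈ O ∧ (y = (x.1 + 1, x.2) ∨ y = (x.1, x.2 + 1) ∨ y = (x.1 + 1, x.2 + 1))

/-- The existence of a directed path from one site to another; its last site need not be open. -/
def Reach (O : Set (ℤ × ℤ)) : ℤ × ℤ → ℤ × ℤ → Prop := Relation.ReflTransGen (Step O)

lemma Step.mono (hO : O ⊆ O') (h : Step O x y) : Step O' x y := ⟨hO h.1, h.2⟩

lemma Step.reach (h : Step O x y) : Reach O x y := Relation.ReflTransGen.single h

lemma Step.fst_le (h : Step O x y) : x.1 ≤ y.1 := by
  rcases h.2 with rfl | rfl | rfl <;> simp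

lemma Step.fst_le_add_one (h : Step O x y) : y.1 ≤ x.1 + 1 := by
  rcases h.2 with rfl | rfl | rfl <;> simp

lemma Step.snd_le (h : Step O x y) : x.2 ≤ y.2 := by
  rcases h.2 with rfl | rfl | rfl <;> simp

lemma Reach.refl (x : ℤ × ℤ) : Reach O x x := Relation.ReflTransGen.refl

lemma Reach.trans (hxy : Reach O x y) (hyu : Reach O y u) : Reach O x u :=
  Relation.ReflTransGen.trans hxy hyu

lemma Reach.mono (hO : O ⊆ O') (h : Reach O x y) : Reach O' x y :=
  Relation.ReflTransGen.mono (fun _ _ => Step.mono hO) _ _ h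

lemma Reach.fst_le (h : Reach O x y) : x.1 ≤ y.1 := by
  induction h with
  | refl => exact le_rfl
  | tail _ hstep ih => exact ih.trans hstep.fst_le

lemma Reach.snd_le (h : Reach O x y) : x.2 ≤ y.2 := by
  induction h with
  | refl => exact le_rfl
  | tail _ hstep ih => exact ih.trans hstep.snd_le

lemma Reach.eq_or_mem (h : Reach O x y) : x = y ∨ x ∈ O := by
  rcases Relation.ReflTransGen.cases_head h with h | ⟨_, hstep, -⟩
  · exact .inl h
  · exact .inr hstep.1

lemma Reach.exists_fst_eq (h : Reach O x y) {c : ℤ} (hxc : x.1 ≤ c) (hcy : c ≤ y.1) :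
    ∃ q : ℤ × ℤ, q.1 = c ∧ Reach O x q ∧ Reach O q y := by
  induction h with
  | refl => exact ⟨x, by omega, .refl _, .refl _⟩
  | @tail y y' hxy hstep ih =>
    by_cases hc : c ≤ y.1
    · obtain ⟨q, hq, hxq, hqy⟩ := ih hc
      exact ⟨q, hq, hxq, hqy.trans hstep.reach⟩
    · have := hstep.fst_le_add_one
      exact ⟨y', by omega, hxy.trans hstep.reach, .refl _⟩

lemma Reach.inter (h : Reach O x y) (hR : ∀ q, Reach O x q → Reach O q y → q ∈ R) :
    Reach (O ∩ R) x y := by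
  induction h with
  | refl => exact .refl _
  | @tail y y' hxy hstep ih =>
    have hxy' : Reach (O ∩ R) x y := ih fun q hxq hqy => hR q hxq (hqy.trans hstep.reach)
    exact hxy'.trans (Step.reach ⟨⟨hstep.1, hR y hxy hstep.reach⟩, hstep.2⟩)

lemma Reach.exists_common (hxy : Reach O x y) (huv : Reach O u v) (hxu : x.1 = u.1)
    (hyv : y.1 = v.1) (hxu' : x.2 ≤ u.2) (hvy' : v.2 ≤ y.2) :
    ∃ q, Reach O x q ∧ Reach O q y ∧ Reach O u q ∧ Reach O q v := by
  -- Follow the lower path step by step and keep the upper one in the same column: as long as they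
  -- have not met, the lower path cannot get strictly above the upper one.
  induction hxy using Relation.ReflTransGen.head_induction_on generalizing u with
  | refl =>
    obtain rfl : u = y := Prod.ext hxu.symm (le_antisymm (huv.snd_le.trans hvy') hxu')
    exact ⟨u, .refl _, .refl _, .refl _, huv⟩
  | @head x x' hstep hx'y ih =>
    by_cases hne : x = u
    · subst hne
      exact ⟨x, .refl _, hstep.reach.trans hx'y, .refl _, huv⟩
    have hlt : x.2 < u.2 := lt_of_le_of_ne hxu' fun h => hne (Prod.ext hxu h)
    have hx'_le : x'.1 ≤ y.1 := Reach.fst_le hx'y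
    obtain ⟨u', huu', hu'v, hfst, hsnd⟩ :
        ∃ u', Reach O u u' ∧ Reach O u' v ∧ x'.1 = u'.1 ∧ x'.2 ≤ u'.2 := by
      have hcases : (x'.1 = x.1 + 1 ∧ x'.2 ≤ x.2 + 1) ∨ (x'.1 = x.1 ∧ x'.2 = x.2 + 1) := by
        rcases hstep.2 with rfl | rfl | rfl <;> simp
      rcases hcases with ⟨hfst, hsnd⟩ | ⟨hfst, hsnd⟩
      · obtain ⟨w, hw, huw, hwv⟩ := huv.exists_fst_eq (c := x'.1) (by omega) (by omega)
        exact ⟨w, huw, hwv, hw.symm, by have := huw.snd_le; omega⟩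
      · exact ⟨u, .refl _, huv, by omega, by omega⟩
    obtain ⟨q, hx'q, hqy, hu'q, hqv⟩ := ih hu'v hfst hsnd
    exact ⟨q, hstep.reach.trans hx'q, hqy, huu'.trans hu'q, hqv⟩

lemma Reach.cross_left (hxy : Reach O x y) (huv : Reach O u v) (hxu : x.1 = u.1)
    (hyv : y.1 = v.1) (hxu' : x.2 ≤ u.2) (hvy' : v.2 ≤ y.2) : Reach O x v := by
  obtain ⟨q, hxq, -, -, hqv⟩ := hxy.exists_common huv hxu hyv hxu' hvy'
  exact hxq.trans hqv

lemma Reach.cross_right (hxy : Reach O x y) (huv : Reach O u v) (hxu : x.1 = u.1)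
    (hyv : y.1 = v.1) (hxu' : x.2 ≤ u.2) (hvy' : v.2 ≤ y.2) : Reach O u y := by
  obtain ⟨q, -, hqy, huq, -⟩ := hxy.exists_common huv hxu hyv hxu' hvy'
  exact huq.trans hqy

/-- The reflection of a set of sites in the diagonal, which exchanges the two edges of a cluster. -/
def transpose (O : Set (ℤ × ℤ)) : Set (ℤ × ℤ) := Prod.swap ⁻¹' O

lemma mem_transpose : x ∈ transpose O ↔ x.swap ∈ O := Iff.rfl

lemma Reach.transpose (h : Reach O x y) : Reach (transpose O) x.swap y.swap := by
  refine Relation.ReflTransGen.lift Prod.swap ?_ _ _ h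
  rintro a _ ⟨ha, rfl | rfl | rfl⟩ <;> exact ⟨ha, by simp⟩

lemma reach_transpose : Reach (OTSP.transpose O) x y ↔ Reach O x.swap y.swap :=
  ⟨fun h => h.transpose, fun h => h.transpose⟩

lemma Reach.of_translate (z : ℤ × ℤ) (h : Reach ((fun w => w + z) ⁻¹' O) x y) :
    Reach O (x + z) (y + z) := by
  refine Relation.ReflTransGen.lift (· + z) ?_ _ _ h
  rintro a _ ⟨ha, rfl | rfl | rfl⟩ <;>
    exact ⟨ha, by simp [Prod.ext_iff, add_right_comm]⟩

lemma reach_translate (z : ℤ × ℤ) :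
    Reach ((fun w => w + z) ⁻¹' O) x y ↔ Reach O (x + z) (y + z) := by
  refine ⟨Reach.of_translate z, fun h => ?_⟩
  have hO : O = (fun w => w + (-z)) ⁻¹' ((fun w => w + z) ⁻¹' O) := by
    ext w; simp
  rw [hO] at h
  simpa using h.of_translate (-z)

/-! ### Entry heights, column by column -/

variable {a b : ℤ} {E E' : Set ℤ} {n m : ℕ}

/-- The heights at which paths entering column `a` at a height in `E` enter column `a + 1`: such a
path climbs an open vertical run and leaves its last site horizontally or diagonally. -/
def nextEntries (O : Set (ℤ × ℤ)) (a : ℤ) (E : Set ℤ) : Set ℤ :=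
  {y | ∃ e ∈ E, ∃ j, e ≤ j ∧ (∀ i, e ≤ i → i ≤ j → (a, i) ∈ O) ∧ (y = j ∨ y = j + 1)}

/-- The heights at which paths entering column `a` at a height in `E` enter column `a + n`. Sites
reached by vertical steps inside the last column are not counted, so that the entries depend on the
columns `a, …, a + n - 1` only. -/
def entries (O : Set (ℤ × ℤ)) (a : ℤ) (E : Set ℤ) : ℕ → Set ℤ
  | 0 => E
  | n + 1 => nextEntries O (a + n) (entries O a E n)

lemma nextEntries_mono (hO : ∀ i, (a, i) ∈ O → (a, i) ∈ O') (hE : E ⊆ E') :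
    nextEntries O a E ⊆ nextEntries O' a E' := by
  rintro y ⟨e, he, j, hej, hrun, hy⟩
  exact ⟨e, hE he, j, hej, fun i hei hij => hO _ (hrun i hei hij), hy⟩

lemma nextEntries_union :
    nextEntries O a (E ∪ E') = nextEntries O a E ∪ nextEntries O a E' := by
  ext y
  simp only [nextEntries, mem_union, mem_ofPred_eq, or_and_right, exists_or]

lemma entries_mono_of_columns (hE : E ⊆ E')
    (hO : ∀ x : ℤ × ℤ, a ≤ x.1 → x.1 < a + n → x ∈ O → x ∈ O') :
    entries O a E n ⊆ entries O' a E' n := by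
  induction n with
  | zero => exact hE
  | succ n ih =>
    refine nextEntries_mono (fun i => hO _ (by simp) (by push_cast; simp)) (ih fun x hax hxn => ?_)
    exact hO x hax (by push_cast; omega)

lemma entries_mono (hO : O ⊆ O') (hE : E ⊆ E') : entries O a E n ⊆ entries O' a E' n :=
  entries_mono_of_columns hE fun _ _ _ h => hO h

lemma entries_add : entries O a E (m + n) = entries O (a + m) (entries O a E m) n := by
  induction n with
  | zero => rfl
  | succ n ih =>
    rw [← add_assoc]
    simp only [entries]
    rw [ih, Nat.cast_add, add_assoc]

lemma entries_union : entries O a (E ∪ E') n = entries O a E n ∪ entries O a E' n := by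
  induction n with
  | zero => rfl
  | succ n ih => simp only [entries, ih, nextEntries_union]

lemma mem_entries_of_row {i : ℤ} (hi : i ∈ E) (hrow : ∀ k : ℕ, k < n → (a + k, i) ∈ O) :
    i ∈ entries O a E n := by
  induction n with
  | zero => exact hi
  | succ n ih =>
    refine ⟨i, ih fun k hk => hrow k (by omega), i, le_rfl, fun j hij hji => ?_, .inl rfl⟩
    obtain rfl : j = i := by omega
    exact hrow n (by omega)

lemma reach_of_vertical_run {c e j : ℤ} (hej : e ≤ j)
    (hrun : ∀ i, e ≤ i → i < j → (c, i) ∈ O) : Reach O (c, e) (c, j) := by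
  induction j, hej using Int.leInduction with
  | base => exact .refl _
  | succ j hej ih =>
    have hstep : Step O (c, j) (c, j + 1) := ⟨hrun j hej (by omega), by simp⟩
    exact (ih fun i hei hij => hrun i hei (by omega)).trans hstep.reach

lemma exists_last_of_mem_entries_succ {z : ℤ} (h : z ∈ entries O a E (n + 1)) :
    ∃ e ∈ E, ∃ j, Reach O (a, e) (a + n, j) ∧ (a + n, j) ∈ O ∧ (z = j ∨ z = j + 1) := by
  induction n generalizing z with
  | zero =>
    obtain ⟨e, he, j, hej, hrun, hz⟩ := h
    refine ⟨e, he, j, ?_, hrun j hej le_rfl, hz⟩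
    simpa using reach_of_vertical_run hej fun i hei hij => hrun i hei hij.le
  | succ n ih =>
    obtain ⟨e, he, j, hej, hrun, hz⟩ := h
    obtain ⟨e₀, he₀, i, hreach, hi, hei⟩ := ih he
    have hstep : Step O (a + n, i) (a + (n + 1 : ℕ), e) :=
      ⟨hi, by rcases hei with rfl | rfl <;> simp [add_assoc]⟩
    exact ⟨e₀, he₀, j, (hreach.trans hstep.reach).trans
      (reach_of_vertical_run hej fun i hei hij => hrun i hei hij.le), hrun j hej le_rfl, hz⟩

lemma exists_reach_of_mem_entries {z : ℤ} (h : z ∈ entries O a E n) :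
    ∃ e ∈ E, Reach O (a, e) (a + n, z) := by
  cases n with
  | zero => exact ⟨z, h, by simpa using Reach.refl _⟩
  | succ n =>
    obtain ⟨e, he, j, hreach, hj, hz⟩ := exists_last_of_mem_entries_succ h
    have hstep : Step O (a + n, j) (a + (n + 1 : ℕ), z) :=
      ⟨hj, by rcases hz with rfl | rfl <;> simp [add_assoc]⟩
    exact ⟨e, he, hreach.trans hstep.reach⟩

lemma Reach.exists_mem_entries {e z c : ℤ} (he : e ∈ E) (h : Reach O (a, e) (c, z))
    (hc : c = a + n) :
    ∃ z' ∈ entries O a E n, z' ≤ z ∧ ∀ i, z' ≤ i → i < z → (c, i) ∈ O := by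
  suffices ∀ w, Reach O (a, e) w → ∀ n : ℕ, w.1 = a + n →
      ∃ z' ∈ entries O a E n, z' ≤ w.2 ∧ ∀ i, z' ≤ i → i < w.2 → (w.1, i) ∈ O from this _ h n hc
  intro w hw
  induction hw with
  | refl =>
    intro n hn
    obtain rfl : n = 0 := by simpa using hn
    exact ⟨e, he, le_rfl, fun i hei hie => absurd hie hei.not_gt⟩
  | @tail w w' hw hstep ih =>
    intro n hn
    obtain ⟨k, hk⟩ : ∃ k : ℕ, w.1 = a + k :=
      ⟨(w.1 - a).toNat, by have : a ≤ w.1 := Reach.fst_le hw; omega⟩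
    obtain ⟨z', hz', hz'w, hrun⟩ := ih k hk
    have hrun' : ∀ i, z' ≤ i → i ≤ w.2 → (a + k, i) ∈ O := by
      intro i hz'i hiw
      rw [← hk]
      rcases hiw.lt_or_eq with hiw | rfl
      · exact hrun i hz'i hiw
      · exact hstep.1
    have hnext : ∀ j, j = w.2 ∨ j = w.2 + 1 → j ∈ entries O a E (k + 1) :=
      fun j hj => ⟨z', hz', w.2, hz'w, hrun', hj⟩
    rcases hstep.2 with rfl | rfl | rfl
    · obtain rfl : n = k + 1 := by dsimp only at hn; omega
      exact ⟨w.2, hnext _ (.inl rfl), le_rfl, fun i hwi hiw => absurd hiw hwi.not_gt⟩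
    · obtain rfl : n = k := by dsimp only at hn; omega
      exact ⟨z', hz', hz'w.trans (by simp),
        fun i hz'i hiw => hk ▸ hrun' i hz'i (Int.lt_add_one_iff.1 hiw)⟩
    · obtain rfl : n = k + 1 := by dsimp only at hn; omega
      exact ⟨w.2 + 1, hnext _ (.inr rfl), le_rfl, fun i hwi hiw => absurd hiw hwi.not_gt⟩

lemma Reach.mem_entries_or {e z c : ℤ} (he : e ∈ E) (h : Reach O (a, e) (c, z))
    (hc : c = a + n) : z ∈ entries O a E n ∨ z ∈ entries O a E (n + 1) := by
  obtain ⟨z', hz', hz'z, hrun⟩ := h.exists_mem_entries he hc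
  rcases hz'z.eq_or_lt with rfl | hlt
  · exact .inl hz'
  · refine .inr ⟨z', hz', z - 1, by omega, fun i hz'i hiz => ?_, .inr (by omega)⟩
    rw [← hc]
    exact hrun i hz'i (by omega)

lemma entries_translate (z : ℤ × ℤ) :
    entries ((fun w => w + z) ⁻¹' O) a E n =
      (fun i => i + z.2) ⁻¹' entries O (a + z.1) ((fun i => i - z.2) ⁻¹' E) n := by
  have hsite (n : ℕ) (i : ℤ) : ((a + n, i) : ℤ × ℤ) + z = (a + z.1 + n, i + z.2) := by
    ext <;> simp only [Prod.fst_add, Prod.snd_add]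
    ring
  induction n with
  | zero => ext i; simp [entries]
  | succ n ih =>
    simp only [entries, ih]
    ext y
    constructor
    · rintro ⟨e, he, j, hej, hrun, hy⟩
      refine ⟨e + z.2, he, j + z.2, by omega, fun i hei hij => ?_, by dsimp only; omega⟩
      have := hrun (i - z.2) (by omega) (by omega)
      rwa [mem_preimage, hsite, sub_add_cancel] at this
    · rintro ⟨e, he, j, hej, hrun, hy⟩
      dsimp only at hy
      refine ⟨e - z.2, by simpa using he, j - z.2, by omega, fun i hei hij => ?_, by omega⟩
      rw [mem_preimage, hsite]
      exact hrun (i + z.2) (by omega) (by omega)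

/-! ### The upper edge -/

/-- The configurations in which half-lines have a well-defined upper edge: every column has closed
sites arbitrarily high, so that the edge is finite, and every strip of columns has completely open
rows arbitrarily low, so that half-lines survive. -/
structure HasEdge (O : Set (ℤ × ℤ)) : Prop where
  closed : ∀ a b : ℤ, ∃ i, b ≤ i ∧ (a, i) ∉ O
  row : ∀ (a b : ℤ) (n : ℕ), ∃ i ≤ b, ∀ k : ℕ, k < n → (a + k, i) ∈ O

/-- The upper edge: the height of the highest entry into column `a + n` from the half-line of
heights at most `b` in column `a`. It is `0` by convention if there is no highest entry. -/
noncomputable def edge (O : Set (ℤ × ℤ)) (a b : ℤ) (n : ℕ) : ℤ := sSup (entries O a (Iic b) n)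

@[simp] lemma edge_zero : edge O a b 0 = b := csSup_Iic

namespace HasEdge

lemma bddAbove_entries (hO : HasEdge O) (hE : BddAbove E) (n : ℕ) :
    BddAbove (entries O a E n) := by
  induction n with
  | zero => exact hE
  | succ n ih =>
    obtain ⟨B, hB⟩ := ih
    obtain ⟨i, hBi, hclosed⟩ := hO.closed (a + n) B
    refine ⟨i, ?_⟩
    rintro y ⟨e, he, j, -, hrun, hy⟩
    have heB : e ≤ B := hB he
    by_contra hlt
    exact hclosed (hrun i (by omega) (by omega))

lemma entries_nonempty (hO : HasEdge O) (a b : ℤ) (n : ℕ) :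
    (entries O a (Iic b) n).Nonempty := by
  obtain ⟨i, hib, hrow⟩ := hO.row a b n
  exact ⟨i, mem_entries_of_row hib hrow⟩

lemma isGreatest_edge (hO : HasEdge O) (a b : ℤ) (n : ℕ) :
    IsGreatest (entries O a (Iic b) n) (edge O a b n) :=
  ⟨Int.csSup_mem (hO.entries_nonempty a b n) (hO.bddAbove_entries bddAbove_Iic n),
    fun _ h => le_csSup (hO.bddAbove_entries bddAbove_Iic n) h⟩

lemma le_edge (hO : HasEdge O) {z : ℤ} (h : z ∈ entries O a (Iic b) n) : z ≤ edge O a b n :=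
  (hO.isGreatest_edge a b n).2 h

lemma edge_mem (hO : HasEdge O) : edge O a b n ∈ entries O a (Iic b) n :=
  (hO.isGreatest_edge a b n).1

lemma edge_mono (hO : HasEdge O) (hO' : HasEdge O') (h : O ⊆ O') {b' : ℤ} (hb : b ≤ b') :
    edge O a b n ≤ edge O' a b' n :=
  hO'.le_edge (entries_mono h (Iic_subset_Iic.2 hb) hO.edge_mem)

lemma edge_add_le (hO : HasEdge O) :
    edge O a b (m + n) ≤ edge O (a + m) (edge O a b m) n := by
  have hmem := hO.edge_mem (a := a) (b := b) (n := m + n)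
  rw [entries_add] at hmem
  exact hO.le_edge (entries_mono subset_rfl (fun z hz => hO.le_edge hz) hmem)

lemma reach_le (hO : HasEdge O) {e z c : ℤ} (he : e ≤ b) (h : Reach O (a, e) (c, z))
    (hc : c = a + n) : z ≤ max (edge O a b n) (edge O a b (n + 1)) := by
  rcases h.mem_entries_or (E := Iic b) he hc with h | h
  · exact le_max_of_le_left (hO.le_edge h)
  · exact le_max_of_le_right (hO.le_edge h)

lemma translate (hO : HasEdge O) (z : ℤ × ℤ) : HasEdge ((fun w => w + z) ⁻¹' O) where
  closed a b := by
    obtain ⟨i, hi, hclosed⟩ := hO.closed (a + z.1) (b + z.2)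
    exact ⟨i - z.2, by omega, by simpa [Prod.add_def] using hclosed⟩
  row a b n := by
    obtain ⟨i, hi, hrow⟩ := hO.row (a + z.1) (b + z.2) n
    refine ⟨i - z.2, by omega, fun k hk => ?_⟩
    have hsite : ((a + k, i - z.2) : ℤ × ℤ) + z = (a + z.1 + k, i) := by
      ext <;> simp only [Prod.fst_add, Prod.snd_add] <;> ring
    rw [mem_preimage, hsite]
    exact hrow k hk

lemma edge_translate (hO : HasEdge O) (z : ℤ × ℤ) :
    edge ((fun w => w + z) ⁻¹' O) a b n = edge O (a + z.1) (b + z.2) n - z.2 := by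
  have hIic : (fun i => i - z.2) ⁻¹' Iic b = Iic (b + z.2) := by
    ext i; simp
  refine (hO.translate z).isGreatest_edge a b n |>.unique ⟨?_, fun y hy => ?_⟩
  · rw [entries_translate, hIic]
    simpa using hO.edge_mem
  · rw [entries_translate, hIic] at hy
    have : y + z.2 ≤ edge O (a + z.1) (b + z.2) n := hO.le_edge hy
    omega

end HasEdge

end

/-! ### The product measure -/

instance : IsProbabilityMeasure law := by unfold law; infer_instance

/-- The set of open sites at parameter `p`. -/
def openSites (p : ℝ) (U : Sample) : Set (ℤ × ℤ) := {x | (U x : ℝ) < p}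

lemma openSites_mono {p p' : ℝ} (h : p ≤ p') (U : Sample) : openSites p U ⊆ openSites p' U :=
  fun _ hx => lt_of_lt_of_le hx h

/-- The permutation of the coordinates of a sample induced by a permutation of the sites; it turns
the symmetries of the lattice into symmetries of the law. -/
def reindex (e : ℤ × ℤ ≃ ℤ × ℤ) : Sample ≃ᵐ Sample :=
  MeasurableEquiv.piCongrLeft (fun _ => unitInterval) e.symm

lemma reindex_apply (e : ℤ × ℤ ≃ ℤ × ℤ) (U : Sample) (x : ℤ × ℤ) :
    reindex e U x = U (e x) := by
  have := Equiv.piCongrLeft_apply_apply (fun _ : ℤ × ℤ => unitInterval) e.symm U (e x)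
  rwa [e.symm_apply_apply] at this

lemma openSites_reindex (e : ℤ × ℤ ≃ ℤ × ℤ) (p : ℝ) (U : Sample) :
    openSites p (reindex e U) = e ⁻¹' openSites p U := by
  ext x; simp [openSites, reindex_apply]

lemma measurePreserving_reindex (e : ℤ × ℤ ≃ ℤ × ℤ) : MeasurePreserving (reindex e) law law := by
  refine ⟨(reindex e).measurable, ?_⟩
  have := Measure.infinitePi_map_piCongrLeft
    (μ := fun _ : ℤ × ℤ => (volume : Measure unitInterval)) e.symm
  simpa [reindex, law] using this

lemma ae_reindex (e : ℤ × ℤ ≃ ℤ × ℤ) {P : Sample → Prop} (h : ∀ᵐ U ∂law, P U) :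
    ∀ᵐ U ∂law, P (reindex e U) :=
  (measurePreserving_reindex e).quasiMeasurePreserving.ae h

lemma law_reindex (e : ℤ × ℤ ≃ ℤ × ℤ) (S : Set Sample) : law (reindex e ⁻¹' S) = law S :=
  (measurePreserving_reindex e).measure_preimage_equiv S

/-- The σ-algebra of the events that depend only on the sites of `S`. -/
abbrev sigmaSites (S : Set (ℤ × ℤ)) : MeasurableSpace Sample :=
  ⨆ x ∈ S, MeasurableSpace.comap (fun U : Sample => U x) inferInstance

lemma sigmaSites_le (S : Set (ℤ × ℤ)) : sigmaSites S ≤ (inferInstance : MeasurableSpace Sample) :=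
  iSup₂_le fun x _ => (measurable_pi_apply x).comap_le

lemma sigmaSites_mono {S T : Set (ℤ × ℤ)} (h : S ⊆ T) : sigmaSites S ≤ sigmaSites T :=
  biSup_mono h

lemma indep_sigmaSites {S T : Set (ℤ × ℤ)} (h : Disjoint S T) :
    Indep (sigmaSites S) (sigmaSites T) law :=
  indep_iSup_of_disjoint (fun x => (measurable_pi_apply x).comap_le)
    (iIndepFun_infinitePi (X := fun _ => id) fun _ => measurable_id) h

lemma measurable_mem_openSites_sigmaSites {S : Set (ℤ × ℤ)} {x : ℤ × ℤ} (hx : x ∈ S) (p : ℝ) :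
    Measurable[sigmaSites S] (fun U => x ∈ openSites p U) := by
  have hcoord : Measurable[sigmaSites S] (fun U : Sample => U x) :=
    (comap_measurable _).mono (le_iSup₂ (f := fun x (_ : x ∈ S) =>
      MeasurableSpace.comap (fun U : Sample => U x) inferInstance) x hx) le_rfl
  have hlt : Measurable fun u : unitInterval => (u : ℝ) < p :=
    measurableSet_setOfPred.1 (measurableSet_lt measurable_subtype_coe measurable_const)
  exact hlt.comp hcoord

lemma measurable_mem_openSites (x : ℤ × ℤ) (p : ℝ) : Measurable (fun U => x ∈ openSites p U) :=
  (measurable_mem_openSites_sigmaSites (mem_univ x) p).mono (sigmaSites_le _) le_rfl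

lemma measurableSet_sigmaSites {S : Set (ℤ × ℤ)} {P : Sample → Prop}
    (hP : Measurable[sigmaSites S] P) : MeasurableSet[sigmaSites S] {U | P U} :=
  (@measurableSet_setOfPred _ (sigmaSites S) P).2 hP

lemma law_mem_openSites (x : ℤ × ℤ) {p : ℝ} (hp0 : 0 ≤ p) (hp1 : p ≤ 1) :
    law {U | x ∈ openSites p U} = ENNReal.ofReal p := by
  have h := (measurePreserving_eval_infinitePi
    (fun _ : ℤ × ℤ => (volume : Measure unitInterval)) x).measure_preimage
    (s := Iio ⟨p, hp0, hp1⟩) measurableSet_Iio.nullMeasurableSet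
  rwa [unitInterval.volume_Iio] at h

lemma law_eq_zero (x : ℤ × ℤ) (p : ℝ) : law {U | (U x : ℝ) = p} = 0 := by
  by_cases hp : p ∈ unitInterval
  · have h := (measurePreserving_eval_infinitePi
      (fun _ : ℤ × ℤ => (volume : Measure unitInterval)) x).measure_preimage
      (s := {⟨p, hp⟩}) (measurableSet_singleton _).nullMeasurableSet
    rw [measure_singleton] at h
    rw [← h]
    congr 1
    ext U
    simp [Subtype.ext_iff]
  · convert measure_empty (μ := law)
    ext U
    simp only [mem_ofPred_eq, mem_empty_iff_false, iff_false]
    rintro rfl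
    exact hp (U x).2

/-! ### Measurability of the upper edge -/

section

variable {Ω : Type*} {mΩ : MeasurableSpace Ω} {O : Ω → Set (ℤ × ℤ)} {E : Ω → Set ℤ}
  {a b : ℤ} {n : ℕ}

lemma measurable_mem_entries (hE : ∀ y, Measurable fun ω => y ∈ E ω)
    (hO : ∀ x : ℤ × ℤ, a ≤ x.1 → x.1 < a + n → Measurable fun ω => x ∈ O ω) (y : ℤ) :
    Measurable fun ω => y ∈ entries (O ω) a (E ω) n := by
  induction n generalizing y with
  | zero => exact hE y
  | succ n ih =>
    have hentries := ih fun x hax hxn => hO x hax (by push_cast; omega)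
    have hlast (i : ℤ) : Measurable fun ω => (a + n, i) ∈ O ω :=
      hO _ (by simp) (by push_cast; simp)
    simp only [entries, nextEntries, mem_ofPred_eq]
    refine Measurable.exists fun e => (hentries e).and (Measurable.exists fun j => ?_)
    refine measurable_const.and (Measurable.and ?_ measurable_const)
    exact Measurable.forall fun i => measurable_const.imp (measurable_const.imp (hlast i))

lemma measurable_edge (hO : ∀ x : ℤ × ℤ, a ≤ x.1 → x.1 < a + n → Measurable fun ω => x ∈ O ω) :
    Measurable fun ω => edge (O ω) a b n :=
  measurable_sSup_int (measurable_mem_entries (fun _ => measurable_const) hO)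

end

/-- The sites of the columns `a, …, c - 1`. -/
def strip (a c : ℤ) : Set (ℤ × ℤ) := {x | a ≤ x.1 ∧ x.1 < c}

lemma disjoint_strip (a b c : ℤ) : Disjoint (strip a b) (strip b c) :=
  Set.disjoint_left.2 fun _ h h' => absurd h.2 (not_lt.2 h'.1)

lemma strip_subset {a c a' c' : ℤ} (ha : a' ≤ a) (hc : c ≤ c') : strip a c ⊆ strip a' c' :=
  fun _ hx => ⟨ha.trans hx.1, hx.2.trans_le hc⟩

lemma measurable_edge_sigmaSites (p : ℝ) {a b : ℤ} {n : ℕ} {S : Set (ℤ × ℤ)}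
    (hS : strip a (a + n) ⊆ S) : Measurable[sigmaSites S] fun U => edge (openSites p U) a b n :=
  measurable_edge fun _ hax hxn => measurable_mem_openSites_sigmaSites (hS ⟨hax, hxn⟩) p

lemma measurable_edge_openSites (p : ℝ) (a b : ℤ) (n : ℕ) :
    Measurable fun U => edge (openSites p U) a b n :=
  measurable_edge fun _ _ _ => measurable_mem_openSites _ p

lemma measurable_edge_openSites_real (p : ℝ) (a b : ℤ) (n : ℕ) :
    Measurable fun U => (edge (openSites p U) a b n : ℝ) :=
  (measurable_of_countable (Int.cast : ℤ → ℝ)).comp (measurable_edge_openSites p a b n)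

/-! ### Closed sites and open rows -/

lemma law_forall_lt_mem {S : ℕ → Set (ℤ × ℤ)} (hS : Pairwise (Function.onFun Disjoint S))
    {D : ℕ → Set Sample} (hD : ∀ i, MeasurableSet[sigmaSites (S i)] (D i)) {d : ENNReal}
    (hd : ∀ i, law (D i) = d) (k : ℕ) : law {U | ∀ i < k, U ∈ D i} = d ^ k := by
  have hmeas (k : ℕ) : MeasurableSet[sigmaSites (⋃ i < k, S i)] {U | ∀ i < k, U ∈ D i} := by
    have hInter : {U | ∀ i < k, U ∈ D i} = ⋂ i, ⋂ (_ : i < k), D i := by ext U; simp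
    rw [hInter]
    exact MeasurableSet.iInter fun i => MeasurableSet.iInter fun hi =>
      sigmaSites_mono (subset_iUnion₂ (s := fun i (_ : i < k) => S i) i hi) _ (hD i)
  induction k with
  | zero => simp
  | succ k ih =>
    have hsucc : {U | ∀ i < k + 1, U ∈ D i} = {U | ∀ i < k, U ∈ D i} ∩ D k := by
      ext U
      simp only [Nat.lt_succ_iff_lt_or_eq, or_imp, forall_and, forall_eq, mem_ofPred_eq,
        mem_inter_iff]
    have hdisj : Disjoint (⋃ i < k, S i) (S k) := by
      simp only [disjoint_iUnion_left]
      exact fun i hi => hS hi.ne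
    rw [hsucc, (Indep_iff _ _ _).1 (indep_sigmaSites hdisj) _ _ (hmeas k) (hD k), ih, hd, pow_succ]

section

variable {p : ℝ}

lemma law_forall_lt_mem_openSites (hp0 : 0 ≤ p) (hp1 : p ≤ 1) {f : ℕ → ℤ × ℤ}
    (hf : Function.Injective f) (k : ℕ) :
    law {U | ∀ i < k, f i ∈ openSites p U} = ENNReal.ofReal p ^ k :=
  law_forall_lt_mem (S := fun i => {f i}) (D := fun i => {U | f i ∈ openSites p U})
    (fun _ _ hij => disjoint_singleton.2 (hf.ne hij))
    (fun _ => measurableSet_sigmaSites (measurable_mem_openSites_sigmaSites (mem_singleton _) p))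
    (fun _ => law_mem_openSites _ hp0 hp1) k

lemma law_column_open (hp0 : 0 ≤ p) (hp1 : p ≤ 1) (a b : ℤ) (k : ℕ) :
    law {U | ∀ i < k, (a, b + (i : ℤ)) ∈ openSites p U} = ENNReal.ofReal p ^ k :=
  law_forall_lt_mem_openSites hp0 hp1 (fun i j hij => by simpa using hij) k

lemma law_row_open (hp0 : 0 ≤ p) (hp1 : p ≤ 1) (a b : ℤ) (k : ℕ) :
    law {U | ∀ i < k, (a + (i : ℤ), b) ∈ openSites p U} = ENNReal.ofReal p ^ k :=
  law_forall_lt_mem_openSites hp0 hp1 (fun i j hij => by simpa using hij) k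

lemma law_rows_not_open (hp0 : 0 ≤ p) (hp1 : p ≤ 1) (a b : ℤ) (n k : ℕ) :
    law {U | ∀ j < k, ¬ ∀ i < n, (a + (i : ℤ), b - (j : ℤ)) ∈ openSites p U} =
      (1 - ENNReal.ofReal p ^ n) ^ k := by
  have hmeas (j : ℕ) : MeasurableSet[sigmaSites {x | x.2 = b - (j : ℤ)}]
      {U | ∀ i < n, (a + (i : ℤ), b - (j : ℤ)) ∈ openSites p U} :=
    measurableSet_sigmaSites (@Measurable.forall _ _ (sigmaSites _) _ _ fun i =>
      @Measurable.forall _ _ (sigmaSites _) _ _ fun _ =>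
        measurable_mem_openSites_sigmaSites (by rfl) p)
  refine law_forall_lt_mem (S := fun j => {x | x.2 = b - (j : ℤ)})
    (D := fun j => {U | ∀ i < n, (a + (i : ℤ), b - (j : ℤ)) ∈ openSites p U}ᶜ)
    (fun i j hij => ?_) (fun j => (hmeas j).compl) (fun j => ?_) k
  · refine Set.disjoint_left.2 fun x (hi : _ = _) (hj : _ = _) => hij ?_
    omega
  · rw [prob_compl_eq_one_sub (sigmaSites_le _ _ (hmeas j)), law_row_open hp0 hp1]

lemma one_sub_ofReal_pow_lt_one (hp0 : 0 < p) (n : ℕ) : 1 - ENNReal.ofReal p ^ n < 1 :=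
  ENNReal.sub_lt_self ENNReal.one_ne_top one_ne_zero
    (pow_ne_zero _ (ENNReal.ofReal_pos.2 hp0).ne')

lemma ae_hasEdge (hp0 : 0 < p) (hp1 : p < 1) : ∀ᵐ U ∂law, HasEdge (openSites p U) := by
  have hclosed : ∀ᵐ U ∂law, ∀ a b : ℤ, ∃ i, b ≤ i ∧ (a, i) ∉ openSites p U := by
    refine ae_all_iff.2 fun a => ae_all_iff.2 fun b => ?_
    refine eq_zero_of_le_pow (r := ENNReal.ofReal p) (by simpa) fun k => ?_
    rw [← law_column_open hp0.le hp1.le a b]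
    refine measure_mono fun U hU i _ => ?_
    by_contra hi
    exact hU ⟨b + i, by omega, hi⟩
  have hrow : ∀ᵐ U ∂law, ∀ (a b : ℤ) (n : ℕ),
      ∃ i ≤ b, ∀ k : ℕ, k < n → (a + k, i) ∈ openSites p U := by
    refine ae_all_iff.2 fun a => ae_all_iff.2 fun b => ae_all_iff.2 fun n => ?_
    refine eq_zero_of_le_pow (one_sub_ofReal_pow_lt_one hp0 n) fun k => ?_
    rw [← law_rows_not_open hp0.le hp1.le a b]
    exact measure_mono fun U hU j _ hj => hU ⟨b - j, by omega, hj⟩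
  filter_upwards [hclosed, hrow] with U hc hr using ⟨hc, hr⟩

/-! ### Integrability of the upper edge -/

lemma lintegral_edge_one_le (hp0 : 0 < p) (hp1 : p < 1) :
    ∫⁻ U, ((edge (openSites p U) 0 0 1).toNat : ENNReal) ∂law ≤
      ENNReal.ofReal p * (1 - ENNReal.ofReal p)⁻¹ := by
  refine lintegral_natCast_le_of_geometric_tail
    ((measurable_of_countable Int.toNat).comp (measurable_edge_openSites p 0 0 1)) fun j => ?_
  -- Above height `0` the path climbs an open run, so a height above `j` needs `j + 1` open sites.
  rw [mul_comm, ← pow_succ, ← law_column_open hp0.le hp1.le 0 0]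
  refine measure_mono_ae ?_
  filter_upwards [ae_hasEdge hp0 hp1] with U hU hj i hi
  obtain ⟨e, he, k, -, hrun, hy⟩ := hU.edge_mem (a := 0) (b := 0) (n := 1)
  have he : e ≤ 0 := he
  have hj : j < (edge (openSites p U) 0 0 1).toNat := hj
  simpa using hrun i (by omega) (by omega)

lemma lintegral_neg_edge_lt_top (hp0 : 0 < p) (hp1 : p < 1) (n : ℕ) :
    ∫⁻ U, ((-edge (openSites p U) 0 0 n).toNat : ENNReal) ∂law < ⊤ := by
  refine (lintegral_natCast_le_of_geometric_tail (c := 1) (r := 1 - ENNReal.ofReal p ^ n)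
    ((measurable_of_countable fun z : ℤ => (-z).toNat).comp
      (measurable_edge_openSites p 0 0 n)) fun j => ?_).trans_lt ?_
  · rw [one_mul, ← law_rows_not_open hp0.le hp1.le 0 0]
    refine measure_mono_ae ?_
    filter_upwards [ae_hasEdge hp0 hp1] with U hU hj i hi hrow
    have hj : j < (-edge (openSites p U) 0 0 n).toNat := hj
    have hle := hU.le_edge (mem_entries_of_row (E := Iic 0) (a := 0) (i := 0 - i) (by simp) hrow)
    omega
  · rw [one_mul, ENNReal.inv_lt_top, tsub_pos_iff_lt]
    exact one_sub_ofReal_pow_lt_one hp0 n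

lemma integrable_edge_one (hp0 : 0 < p) (hp1 : p < 1) :
    Integrable (fun U => (edge (openSites p U) 0 0 1 : ℝ)) law := by
  refine integrable_intCast (measurable_edge_openSites p 0 0 1) ?_
    (lintegral_neg_edge_lt_top hp0 hp1 1)
  refine (lintegral_edge_one_le hp0 hp1).trans_lt (ENNReal.mul_lt_top ENNReal.ofReal_lt_top ?_)
  rw [ENNReal.inv_lt_top, tsub_pos_iff_lt]
  simpa using hp1

end

/-! ### The law of large numbers for the restarted edge -/

section

variable {p : ℝ}

/-- The expected height of the upper edge in column `n`. -/
noncomputable def meanEdge (p : ℝ) (n : ℕ) : ℝ := ∫ U, (edge (openSites p U) 0 0 n : ℝ) ∂law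

lemma meanEdge_one_le (hp0 : 0 < p) (hp1 : p < 1) : meanEdge p 1 ≤ p / (1 - p) := by
  have hq : 0 < 1 - p := sub_pos.2 hp1
  refine (integral_intCast_le_toReal_lintegral (integrable_edge_one hp0 hp1)).trans ?_
  refine ENNReal.toReal_le_of_le_ofReal (by positivity) ?_
  refine (lintegral_edge_one_le hp0 hp1).trans_eq ?_
  rw [div_eq_mul_inv, ENNReal.ofReal_mul hp0.le, ENNReal.ofReal_inv_of_pos hq,
    ENNReal.ofReal_sub _ hp0.le, ENNReal.ofReal_one]

lemma law_edge_sub_mem (hp0 : 0 < p) (hp1 : p < 1) (a z : ℤ) (n : ℕ) (T : Set ℝ) :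
    law {U | ((edge (openSites p U) a z n - z : ℤ) : ℝ) ∈ T} =
      law {U | (edge (openSites p U) 0 0 n : ℝ) ∈ T} := by
  rw [← law_reindex (Equiv.addRight ((a, z) : ℤ × ℤ)) {U | (edge (openSites p U) 0 0 n : ℝ) ∈ T}]
  refine measure_congr ?_
  filter_upwards [ae_hasEdge hp0 hp1] with U hU
  have htranslate : edge (openSites p (reindex (Equiv.addRight ((a, z) : ℤ × ℤ)) U)) 0 0 n =
      edge (openSites p U) a z n - z := by
    rw [openSites_reindex]
    simpa using hU.edge_translate (a := 0) (b := 0) (n := n) (a, z)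
  refine propext (iff_of_eq ?_)
  change (_ ∈ T) = (((edge (openSites p (reindex (Equiv.addRight ((a, z) : ℤ × ℤ)) U)) 0 0 n : ℤ) :
    ℝ) ∈ T)
  rw [htranslate]

/-- The upper edge, restarted from a full half-line every `m` columns. It dominates the upper edge
and has i.i.d. increments. -/
noncomputable def blockEdge (O : Set (ℤ × ℤ)) (m : ℕ) (a b : ℤ) : ℕ → ℤ
  | 0 => b
  | j + 1 => edge O (a + m * j) (blockEdge O m a b j) m

lemma HasEdge.edge_le_blockEdge {O : Set (ℤ × ℤ)} (hO : HasEdge O) (m : ℕ) (a b : ℤ) (j : ℕ) :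
    edge O a b (m * j) ≤ blockEdge O m a b j := by
  induction j with
  | zero => simp [blockEdge]
  | succ j ih =>
    rw [mul_add, mul_one]
    refine hO.edge_add_le.trans ?_
    simp only [blockEdge, Nat.cast_mul]
    exact hO.edge_mono hO subset_rfl ih

lemma HasEdge.edge_add_mul_le_blockEdge {O : Set (ℤ × ℤ)} (hO : HasEdge O) (a b : ℤ)
    (i m j : ℕ) : edge O a b (i + m * j) ≤ blockEdge O m (a + i) (edge O a b i) j :=
  hO.edge_add_le.trans (hO.edge_le_blockEdge m _ _ j)

lemma measurable_blockEdge_sigmaSites (p : ℝ) (m : ℕ) (a b : ℤ) (j : ℕ) :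
    Measurable[sigmaSites (strip a (a + m * j))] fun U => blockEdge (openSites p U) m a b j := by
  induction j with
  | zero => exact measurable_const
  | succ j ih =>
    have hend : a + m * (j + 1 : ℕ) = a + m * j + m := by push_cast; ring
    rw [hend]
    refine measurable_comp_index (f := fun z U => edge (openSites p U) (a + m * j) z m)
      (ih.mono (sigmaSites_mono (strip_subset le_rfl (by simp))) le_rfl) fun z => ?_
    refine measurable_edge_sigmaSites p (strip_subset ?_ le_rfl)
    exact le_add_of_nonneg_right (by positivity)

/-- The increments of the restarted upper edge. -/
noncomputable def blockIncr (p : ℝ) (m : ℕ) (a b : ℤ) (j : ℕ) (U : Sample) : ℝ :=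
  ((blockEdge (openSites p U) m a b (j + 1) - blockEdge (openSites p U) m a b j : ℤ) : ℝ)

lemma measurable_blockIncr_sigmaSites (p : ℝ) (m : ℕ) (a b : ℤ) {j k : ℕ} (hjk : j < k) :
    Measurable[sigmaSites (strip a (a + m * k))] (blockIncr p m a b j) := by
  have hblock (i : ℕ) (hi : i ≤ k) :
      Measurable[sigmaSites (strip a (a + m * k))] fun U => blockEdge (openSites p U) m a b i :=
    (measurable_blockEdge_sigmaSites p m a b i).mono
      (sigmaSites_mono (strip_subset le_rfl (by gcongr))) le_rfl
  exact measurable_intCast_sub (hblock _ hjk) (hblock _ hjk.le)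

lemma law_inter_blockIncr_mem (hp0 : 0 < p) (hp1 : p < 1) (m : ℕ) (a b : ℤ) (j : ℕ)
    {B : Set Sample} (hB : MeasurableSet[sigmaSites (strip a (a + m * j))] B) {T : Set ℝ}
    (hT : MeasurableSet T) :
    law (B ∩ blockIncr p m a b j ⁻¹' T) =
      law B * law {U | (edge (openSites p U) 0 0 m : ℝ) ∈ T} :=
  measure_inter_mem_index_of_indep
    (indep_sigmaSites (disjoint_strip a (a + m * j) (a + m * j + m)))
    (sigmaSites_le _) (sigmaSites_le _) (measurable_blockEdge_sigmaSites p m a b j) hB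
    (D := fun z => {U | ((edge (openSites p U) (a + m * j) z m - z : ℤ) : ℝ) ∈ T})
    (fun _ => measurable_intCast_sub (measurable_edge_sigmaSites p subset_rfl)
      measurable_const hT)
    fun z => law_edge_sub_mem hp0 hp1 _ z m T

lemma law_blockIncr_mem (hp0 : 0 < p) (hp1 : p < 1) (m : ℕ) (a b : ℤ) (j : ℕ) {T : Set ℝ}
    (hT : MeasurableSet T) :
    law (blockIncr p m a b j ⁻¹' T) = law {U | (edge (openSites p U) 0 0 m : ℝ) ∈ T} := by
  simpa using law_inter_blockIncr_mem hp0 hp1 m a b j (B := univ)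
    (@MeasurableSet.univ _ (sigmaSites _)) hT

lemma identDistrib_blockIncr (hp0 : 0 < p) (hp1 : p < 1) (m : ℕ) (a b : ℤ) (j : ℕ) :
    IdentDistrib (blockIncr p m a b j) (fun U => (edge (openSites p U) 0 0 m : ℝ)) law law := by
  have hincr : Measurable (blockIncr p m a b j) :=
    (measurable_blockIncr_sigmaSites p m a b j.lt_succ_self).mono (sigmaSites_le _) le_rfl
  have hedge := measurable_edge_openSites_real p 0 0 m
  refine ⟨hincr.aemeasurable, hedge.aemeasurable, Measure.ext fun T hT => ?_⟩
  rw [Measure.map_apply hincr hT, Measure.map_apply hedge hT, law_blockIncr_mem hp0 hp1 m a b j hT]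
  rfl

lemma indepFun_blockIncr (hp0 : 0 < p) (hp1 : p < 1) (m : ℕ) (a b : ℤ) {i j : ℕ}
    (hij : i < j) : IndepFun (blockIncr p m a b i) (blockIncr p m a b j) law := by
  rw [indepFun_iff_measure_inter_preimage_eq_mul]
  intro S T hS hT
  rw [law_inter_blockIncr_mem hp0 hp1 m a b j (measurable_blockIncr_sigmaSites p m a b hij hS) hT,
    law_blockIncr_mem hp0 hp1 m a b j hT]

lemma sum_blockIncr (p : ℝ) (m : ℕ) (a b : ℤ) (j : ℕ) (U : Sample) :
    ∑ i ∈ Finset.range j, blockIncr p m a b i U = (blockEdge (openSites p U) m a b j : ℝ) - b := by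
  simp only [blockIncr, Int.cast_sub]
  rw [Finset.sum_range_sub (fun i => (blockEdge (openSites p U) m a b i : ℝ))]
  rfl

lemma integrable_edge (hp0 : 0 < p) (hp1 : p < 1) (n : ℕ) :
    Integrable (fun U => (edge (openSites p U) 0 0 n : ℝ)) law := by
  refine integrable_intCast (measurable_edge_openSites p 0 0 n) ?_
    (lintegral_neg_edge_lt_top hp0 hp1 n)
  have hsum : Integrable (fun U => ∑ i ∈ Finset.range n, blockIncr p 1 0 0 i U) law :=
    integrable_finsetSum _ fun i _ =>
      (identDistrib_blockIncr hp0 hp1 1 0 0 i).integrable_iff.2 (integrable_edge_one hp0 hp1)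
  refine lt_of_le_of_lt (lintegral_mono_ae ?_) hsum.2
  filter_upwards [ae_hasEdge hp0 hp1] with U hU
  have hle : edge (openSites p U) 0 0 n ≤ blockEdge (openSites p U) 1 0 0 n := by
    simpa using hU.edge_le_blockEdge 1 0 0 n
  rw [sum_blockIncr, Int.cast_zero, sub_zero, enorm_intCast_eq_add]
  exact le_add_right (Nat.cast_le.2 (Int.toNat_le_toNat hle))

lemma integrable_blockIncr (hp0 : 0 < p) (hp1 : p < 1) (m : ℕ) (a b : ℤ) (j : ℕ) :
    Integrable (blockIncr p m a b j) law :=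
  (identDistrib_blockIncr hp0 hp1 m a b j).integrable_iff.2 (integrable_edge hp0 hp1 m)

lemma integral_blockIncr (hp0 : 0 < p) (hp1 : p < 1) (m : ℕ) (a b : ℤ) (j : ℕ) :
    ∫ U, blockIncr p m a b j U ∂law = meanEdge p m :=
  (identDistrib_blockIncr hp0 hp1 m a b j).integral_eq

lemma ae_tendsto_blockEdge_div (hp0 : 0 < p) (hp1 : p < 1) (m : ℕ) (a b : ℤ) :
    ∀ᵐ U ∂law, Tendsto (fun j : ℕ => ((blockEdge (openSites p U) m a b j : ℝ) - b) / j) atTop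
      (𝓝 (meanEdge p m)) := by
  have hindep : Pairwise (Function.onFun (fun f g => IndepFun f g law) (blockIncr p m a b)) := by
    intro i j hij
    rcases lt_or_gt_of_ne hij with hlt | hlt
    · exact indepFun_blockIncr hp0 hp1 m a b hlt
    · exact (indepFun_blockIncr hp0 hp1 m a b hlt).symm
  have hslln := strong_law_ae_real (blockIncr p m a b) (integrable_blockIncr hp0 hp1 m a b 0)
    hindep fun i =>
      (identDistrib_blockIncr hp0 hp1 m a b i).trans (identDistrib_blockIncr hp0 hp1 m a b 0).symm
  filter_upwards [hslln] with U hU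
  simpa only [sum_blockIncr, integral_blockIncr hp0 hp1] using hU

/-- Paths starting in column `x` at height at most `y` rise at slope at most `r`, up to `K`. -/
def EdgeUpperBound (O : Set (ℤ × ℤ)) (r : ℝ) (K : ℕ) (x y : ℤ) : Prop :=
  ∀ n : ℕ, (edge O x y n : ℝ) ≤ y + r * n + K

lemma HasEdge.reach_le_of_edgeUpperBound {O : Set (ℤ × ℤ)} (hO : HasEdge O) {r : ℝ} (hr : 0 ≤ r)
    {K : ℕ} {x y : ℤ} (hbound : EdgeUpperBound O r K x y) {e z c : ℤ} (he : e ≤ y)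
    (hreach : Reach O (x, e) (c, z)) : (z : ℝ) ≤ y + r * (c - x + 1) + K := by
  obtain ⟨n, rfl⟩ := Int.le.dest hreach.fst_le
  have hmax : (z : ℝ) ≤ max (edge O x y n : ℝ) (edge O x y (n + 1)) := by
    exact_mod_cast hO.reach_le he hreach rfl
  have hn := hbound n
  have hsucc := hbound (n + 1)
  push_cast at hsucc ⊢
  refine hmax.trans (max_le ?_ ?_) <;> linarith

lemma ae_edgeUpperBound (hp0 : 0 < p) (hp1 : p < 1) {m : ℕ} (hm : 0 < m) {r : ℝ} (hr0 : 0 ≤ r)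
    (hr : meanEdge p m < r * m) :
    ∀ᵐ U ∂law, ∃ K, EdgeUpperBound (openSites p U) r K 0 0 := by
  have hslln : ∀ᵐ U ∂law, ∀ a b : ℤ, Tendsto
      (fun j : ℕ => ((blockEdge (openSites p U) m a b j : ℝ) - b) / j) atTop (𝓝 (meanEdge p m)) :=
    ae_all_iff.2 fun a => ae_all_iff.2 fun b => ae_tendsto_blockEdge_div hp0 hp1 m a b
  filter_upwards [ae_hasEdge hp0 hp1, hslln] with U hU hlim
  have hresidue (i : ℕ) :
      ∃ K : ℝ, ∀ j : ℕ, (edge (openSites p U) 0 0 (i + m * j) : ℝ) ≤ r * m * j + K := by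
    set b := edge (openSites p U) 0 0 i
    have heventually : ∀ᶠ j : ℕ in atTop,
        (blockEdge (openSites p U) m (0 + i) b j : ℝ) - b - r * m * j ≤ 0 := by
      filter_upwards [(hlim (0 + i) b).eventually (gt_mem_nhds hr), eventually_gt_atTop 0]
        with j hj hj0
      rw [div_lt_iff₀ (by exact_mod_cast hj0)] at hj
      linarith
    obtain ⟨K, hK⟩ := (isBoundedUnder_of_eventually_le heventually).bddAbove_range
    refine ⟨K + b, fun j => ?_⟩
    have hKj := hK (mem_range_self j)
    have hle : (edge (openSites p U) 0 0 (i + m * j) : ℝ) ≤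
        (blockEdge (openSites p U) m (0 + i) b j : ℝ) :=
      Int.cast_le.2 (hU.edge_add_mul_le_blockEdge 0 0 i m j)
    linarith
  choose K hK using hresidue
  obtain ⟨C, hC⟩ := ((Finset.range m).image K).exists_le
  obtain ⟨B, hB⟩ := exists_nat_ge C
  refine ⟨B, fun n => ?_⟩
  have hbound := hK (n % m) (n / m)
  rw [Nat.mod_add_div] at hbound
  have hKB : K (n % m) ≤ B :=
    (hC _ (Finset.mem_image_of_mem K (Finset.mem_range.2 (Nat.mod_lt n hm)))).trans hB
  have hdiv : (m : ℝ) * (n / m : ℕ) ≤ n := by exact_mod_cast Nat.mul_div_le n m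
  have := mul_le_mul_of_nonneg_left hdiv hr0
  rw [Int.cast_zero, zero_add]
  linarith

end

/-! ### Strict monotonicity of the mean edge height -/

section

variable {O O' P : Set (ℤ × ℤ)} {a t : ℤ} {A : Set ℤ} {n : ℕ}

lemma HasEdge.of_subset_of_subset (hO : HasEdge O) (hO' : HasEdge O') (hOP : O ⊆ P)
    (hPO' : P ⊆ O') : HasEdge P where
  closed a b := by
    obtain ⟨i, hi, hclosed⟩ := hO'.closed a b
    exact ⟨i, hi, fun hP => hclosed (hPO' hP)⟩
  row a b n := by
    obtain ⟨i, hi, hrow⟩ := hO.row a b n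
    exact ⟨i, hi, fun k hk => hOP (hrow k hk)⟩

lemma entries_succ_eq_entries_nextEntries :
    entries O a A (n + 1) = entries O (a + 1) (nextEntries O a A) n := by
  rw [add_comm n 1, entries_add]
  simp [entries]

lemma nextEntries_subset_Iic (hA : A ⊆ Iic t) (ht : (a, t) ∉ O) :
    nextEntries O a A ⊆ Iic t := by
  rintro y ⟨e, he, j, -, hrun, hy⟩
  have hjt : j < t := not_le.1 fun htj => ht (hrun t (hA he) htj)
  rw [mem_Iic]
  omega

lemma add_one_mem_nextEntries (htA : t ∈ A) (ht : (a, t) ∈ O) : t + 1 ∈ nextEntries O a A := by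
  refine ⟨t, htA, t, le_rfl, fun i hti hit => ?_, .inr rfl⟩
  rwa [le_antisymm hit hti]

lemma HasEdge.edge_add_one_le_or_mem (hO : HasEdge O) :
    edge O a (t + 1) n ≤ edge O a t n ∨ edge O a (t + 1) n ∈ entries O a {t + 1} n := by
  have hIic : Iic (t + 1) = Iic t ∪ {t + 1} := by
    ext i
    simp only [mem_Iic, mem_union, mem_singleton_iff]
    omega
  have hmem := hO.edge_mem (a := a) (b := t + 1) (n := n)
  rw [hIic, entries_union] at hmem
  exact hmem.imp_left hO.le_edge

end

section

variable {p p' : ℝ} {U : Sample}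

/-- The upper edge at column `k + n` with parameter `p'` in the first `k` columns and `p` in the
others. It interpolates between the upper edges at `p` and at `p'`. -/
noncomputable def hybridEdge (p p' : ℝ) (k n : ℕ) (U : Sample) : ℤ :=
  sSup (entries (openSites p U) k (entries (openSites p' U) 0 (Iic 0) k) n)

lemma hybridEdge_zero_left (p p' : ℝ) (n : ℕ) (U : Sample) :
    hybridEdge p p' 0 n U = edge (openSites p U) 0 0 n := rfl

lemma measurable_hybridEdge (p p' : ℝ) (k n : ℕ) : Measurable (hybridEdge p p' k n) := by
  refine measurable_sSup_int (measurable_mem_entries ?_ fun _ _ _ => measurable_mem_openSites _ _)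
  exact measurable_mem_entries (fun _ => measurable_const) fun _ _ _ => measurable_mem_openSites _ _

lemma isGreatest_hybridEdge (hpp' : p ≤ p') (hU : HasEdge (openSites p U))
    (hU' : HasEdge (openSites p' U)) (k n : ℕ) :
    IsGreatest (entries (openSites p U) k (entries (openSites p' U) 0 (Iic 0) k) n)
      (hybridEdge p p' k n U) := by
  have hbdd := hU.bddAbove_entries (a := k)
    (hU'.bddAbove_entries (a := 0) (bddAbove_Iic (a := 0)) k) n
  refine ⟨Int.csSup_mem ?_ hbdd, fun _ h => le_csSup hbdd h⟩
  have hne := hU.entries_nonempty 0 0 (k + n)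
  rw [entries_add, zero_add] at hne
  exact hne.mono (entries_mono subset_rfl (entries_mono (openSites_mono hpp' U) subset_rfl))

lemma edge_le_hybridEdge (hpp' : p ≤ p') (hU : HasEdge (openSites p U))
    (hU' : HasEdge (openSites p' U)) (k n : ℕ) :
    edge (openSites p U) 0 0 (k + n) ≤ hybridEdge p p' k n U := by
  have hmem := hU.edge_mem (a := 0) (b := 0) (n := k + n)
  rw [entries_add, zero_add] at hmem
  exact (isGreatest_hybridEdge hpp' hU hU' k n).2
    (entries_mono subset_rfl (entries_mono (openSites_mono hpp' U) subset_rfl) hmem)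

lemma hybridEdge_le_edge (hpp' : p ≤ p') (hU : HasEdge (openSites p U))
    (hU' : HasEdge (openSites p' U)) (k n : ℕ) :
    hybridEdge p p' k n U ≤ edge (openSites p' U) 0 0 (k + n) := by
  refine hU'.le_edge ?_
  rw [entries_add, zero_add]
  exact entries_mono (openSites_mono hpp' U) subset_rfl (isGreatest_hybridEdge hpp' hU hU' k n).1

lemma integrable_hybridEdge (hp0 : 0 < p) (hpp' : p ≤ p') (hp'1 : p' < 1) (k n : ℕ) :
    Integrable (fun U => (hybridEdge p p' k n U : ℝ)) law := by
  have hp1 : p < 1 := hpp'.trans_lt hp'1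
  have hp'0 : 0 < p' := hp0.trans_le hpp'
  refine Integrable.mono'
    ((integrable_edge hp0 hp1 (k + n)).abs.add (integrable_edge hp'0 hp'1 (k + n)).abs)
    ((measurable_of_countable _).comp (measurable_hybridEdge p p' k n)).aestronglyMeasurable ?_
  filter_upwards [ae_hasEdge hp0 hp1, ae_hasEdge hp'0 hp'1] with U hU hU'
  exact (abs_le_max_abs_abs (Int.cast_le.2 (edge_le_hybridEdge hpp' hU hU' k n))
    (Int.cast_le.2 (hybridEdge_le_edge hpp' hU hU' k n))).trans
    (max_le_add_of_nonneg (abs_nonneg _) (abs_nonneg _))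

/-- The event that the site `x` is open for the parameter `p'` but closed for `p`. -/
def openedBetween (p p' : ℝ) (x : ℤ × ℤ) : Set Sample :=
  {U | x ∈ openSites p' U} \ {U | x ∈ openSites p U}

lemma measurableSet_openedBetween_sigmaSites (p p' : ℝ) {x : ℤ × ℤ} {S : Set (ℤ × ℤ)} (hx : x ∈ S) :
    MeasurableSet[sigmaSites S] (openedBetween p p' x) :=
  (measurableSet_sigmaSites (measurable_mem_openSites_sigmaSites hx p')).diff
    (measurableSet_sigmaSites (measurable_mem_openSites_sigmaSites hx p))

lemma law_openedBetween (hp0 : 0 ≤ p) (hpp' : p ≤ p') (hp'1 : p' ≤ 1) (x : ℤ × ℤ) :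
    law (openedBetween p p' x) = ENNReal.ofReal (p' - p) := by
  have hsub : {U : Sample | x ∈ openSites p U} ⊆ {U | x ∈ openSites p' U} :=
    fun U h => openSites_mono hpp' U h
  rw [openedBetween, measure_sdiff hsub
      (measurableSet_setOfPred.2 (measurable_mem_openSites x p)).nullMeasurableSet
      (measure_ne_top _ _), law_mem_openSites x (hp0.trans hpp') hp'1,
    law_mem_openSites x hp0 (hpp'.trans hp'1), ENNReal.ofReal_sub _ hp0]

/-- The rise of the upper edge after `n` further columns when the half-line below it is raised
from height `z` to `z + 1` in column `a`. -/
noncomputable def edgeRise (p : ℝ) (a z : ℤ) (n : ℕ) (U : Sample) : ℝ :=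
  ((edge (openSites p U) a (z + 1) n - edge (openSites p U) a z n : ℤ) : ℝ)

/-- The gain at column `k + 1 + n` from opening the site `(k, z)` at the upper edge. -/
noncomputable def gain (p p' : ℝ) (k n : ℕ) (z : ℤ) (U : Sample) : ℝ :=
  (openedBetween p p' (k, z)).indicator 1 U * edgeRise p (k + 1) z n U

lemma gain_le (hpp' : p ≤ p') (hU : HasEdge (openSites p U)) (hU' : HasEdge (openSites p' U))
    (k n : ℕ) :
    gain p p' k n (edge (openSites p' U) 0 0 k) U ≤
      hybridEdge p p' (k + 1) n U - hybridEdge p p' k (n + 1) U := by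
  set A := entries (openSites p' U) 0 (Iic 0) k
  set t := edge (openSites p' U) 0 0 k
  have hnew : IsGreatest (entries (openSites p U) (k + 1) (nextEntries (openSites p' U) k A) n)
      (hybridEdge p p' (k + 1) n U) := by
    simpa only [entries, zero_add, Nat.cast_add, Nat.cast_one] using
      isGreatest_hybridEdge hpp' hU hU' (k + 1) n
  have hold : IsGreatest (entries (openSites p U) (k + 1) (nextEntries (openSites p U) k A) n)
      (hybridEdge p p' k (n + 1) U) := by
    rw [← entries_succ_eq_entries_nextEntries]
    exact isGreatest_hybridEdge hpp' hU hU' k (n + 1)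
  have hmono : hybridEdge p p' k (n + 1) U ≤ hybridEdge p p' (k + 1) n U :=
    hnew.2 (entries_mono subset_rfl
      (nextEntries_mono (fun _ h => openSites_mono hpp' U h) subset_rfl) hold.1)
  by_cases hopened : U ∈ openedBetween p p' (k, t)
  swap
  · rw [gain, indicator_of_notMem hopened, zero_mul, sub_nonneg]
    exact Int.cast_le.2 hmono
  have hold_le : hybridEdge p p' k (n + 1) U ≤ edge (openSites p U) (k + 1) t n :=
    hU.le_edge (entries_mono subset_rfl
      (nextEntries_subset_Iic (fun _ h => hU'.le_edge h) hopened.2) hold.1)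
  have hle : edge (openSites p U) (k + 1) (t + 1) n - edge (openSites p U) (k + 1) t n ≤
      hybridEdge p p' (k + 1) n U - hybridEdge p p' k (n + 1) U := by
    rcases hU.edge_add_one_le_or_mem (a := k + 1) (t := t) (n := n) with hstay | hrise
    · omega
    · have ht : t + 1 ∈ nextEntries (openSites p' U) k A :=
        add_one_mem_nextEntries hU'.edge_mem hopened.1
      have := hnew.2 (entries_mono subset_rfl (singleton_subset_iff.2 ht) hrise)
      omega
  rw [gain, indicator_of_mem hopened, Pi.one_apply, one_mul, edgeRise]
  exact_mod_cast hle

lemma measurable_edgeRise_sigmaSites (p : ℝ) (a z : ℤ) {n : ℕ} {S : Set (ℤ × ℤ)}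
    (hS : strip a (a + n) ⊆ S) : Measurable[sigmaSites S] (edgeRise p a z n) :=
  measurable_intCast_sub (measurable_edge_sigmaSites p hS) (measurable_edge_sigmaSites p hS)

lemma measurable_gain_sigmaSites (p p' : ℝ) (k n : ℕ) (z : ℤ) :
    Measurable[sigmaSites (strip k (k + 1 + n))] (gain p p' k n z) := by
  have hsite : ((k, z) : ℤ × ℤ) ∈ strip k (k + 1 + n) := ⟨le_rfl, by dsimp only; omega⟩
  exact (measurable_const.indicator (measurableSet_openedBetween_sigmaSites p p' hsite)).mul
    (measurable_edgeRise_sigmaSites p _ z (strip_subset (by omega) le_rfl))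

lemma law_gain_mem (p' : ℝ) (hp0 : 0 < p) (hp1 : p < 1) (k n : ℕ) (z : ℤ) (T : Set ℝ) :
    law {U | gain p p' k n z U ∈ T} = law {U | gain p p' k n 0 U ∈ T} := by
  rw [← law_reindex (Equiv.addRight ((0, z) : ℤ × ℤ)) {U | gain p p' k n 0 U ∈ T}]
  refine measure_congr ?_
  filter_upwards [ae_hasEdge hp0 hp1] with U hU
  have hedge (y : ℤ) : edge (openSites p (reindex (Equiv.addRight ((0, z) : ℤ × ℤ)) U))
      (k + 1) y n = edge (openSites p U) (k + 1) (y + z) n - z := by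
    rw [openSites_reindex]
    simpa using hU.edge_translate (a := k + 1) (b := y) (n := n) (0, z)
  have hopened : reindex (Equiv.addRight ((0, z) : ℤ × ℤ)) U ∈ openedBetween p p' (k, 0) ↔
      U ∈ openedBetween p p' (k, z) := by
    simp [openedBetween, openSites_reindex]
  have hgain : gain p p' k n 0 (reindex (Equiv.addRight ((0, z) : ℤ × ℤ)) U) =
      gain p p' k n z U := by
    by_cases hU : U ∈ openedBetween p p' (k, z)
    · simp [gain, edgeRise, hedge, hU, hopened, add_comm 1 z]
    · simp [gain, hU, hopened]
  refine propext (iff_of_eq ?_)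
  change (_ ∈ T) = (gain p p' k n 0 (reindex (Equiv.addRight ((0, z) : ℤ × ℤ)) U) ∈ T)
  rw [hgain]

lemma identDistrib_edge_sub (hp0 : 0 < p) (hp1 : p < 1) (a z : ℤ) (n : ℕ) :
    IdentDistrib (fun U => ((edge (openSites p U) a z n - z : ℤ) : ℝ))
      (fun U => (edge (openSites p U) 0 0 n : ℝ)) law law := by
  have hshift : Measurable (fun U => ((edge (openSites p U) a z n - z : ℤ) : ℝ)) :=
    measurable_intCast_sub (measurable_edge_openSites p a z n) measurable_const
  have hedge := measurable_edge_openSites_real p 0 0 n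
  refine ⟨hshift.aemeasurable, hedge.aemeasurable, Measure.ext fun T hT => ?_⟩
  rw [Measure.map_apply hshift hT, Measure.map_apply hedge hT]
  exact law_edge_sub_mem hp0 hp1 a z n T

lemma integrable_edge_openSites (hp0 : 0 < p) (hp1 : p < 1) (a z : ℤ) (n : ℕ) :
    Integrable (fun U => (edge (openSites p U) a z n : ℝ)) law := by
  have hsub := (identDistrib_edge_sub hp0 hp1 a z n).integrable_iff.2 (integrable_edge hp0 hp1 n)
  exact (hsub.add (integrable_const (z : ℝ))).congr (ae_of_all _ fun U => by simp)

lemma integral_edge_openSites (hp0 : 0 < p) (hp1 : p < 1) (a z : ℤ) (n : ℕ) :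
    ∫ U, (edge (openSites p U) a z n : ℝ) ∂law = meanEdge p n + z := by
  rw [meanEdge, ← (identDistrib_edge_sub hp0 hp1 a z n).integral_eq]
  simp only [Int.cast_sub]
  rw [integral_sub (integrable_edge_openSites hp0 hp1 a z n) (integrable_const _)]
  simp

lemma integrable_edgeRise (hp0 : 0 < p) (hp1 : p < 1) (a z : ℤ) (n : ℕ) :
    Integrable (edgeRise p a z n) law := by
  exact ((integrable_edge_openSites hp0 hp1 a (z + 1) n).sub
    (integrable_edge_openSites hp0 hp1 a z n)).congr (ae_of_all _ fun U => by simp [edgeRise])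

lemma integral_edgeRise (hp0 : 0 < p) (hp1 : p < 1) (a z : ℤ) (n : ℕ) :
    ∫ U, edgeRise p a z n U ∂law = 1 := by
  simp only [edgeRise, Int.cast_sub]
  rw [integral_sub (integrable_edge_openSites hp0 hp1 _ _ n)
    (integrable_edge_openSites hp0 hp1 _ _ n), integral_edge_openSites hp0 hp1,
    integral_edge_openSites hp0 hp1]
  simp

lemma indepFun_indicator_edgeRise (p p' : ℝ) (k n : ℕ) (z : ℤ) :
    IndepFun ((openedBetween p p' (k, z)).indicator (1 : Sample → ℝ)) (edgeRise p (k + 1) z n)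
      law := by
  have hsite : ((k, z) : ℤ × ℤ) ∈ strip k (k + 1) := ⟨le_rfl, by dsimp only; omega⟩
  have hopened : Measurable[sigmaSites (strip k (k + 1))]
      ((openedBetween p p' (k, z)).indicator (1 : Sample → ℝ)) :=
    measurable_const.indicator (measurableSet_openedBetween_sigmaSites p p' hsite)
  exact indep_of_indep_of_le_left (indep_of_indep_of_le_right
    (indep_sigmaSites (disjoint_strip k (k + 1) (k + 1 + n)))
    (measurable_edgeRise_sigmaSites p _ z subset_rfl).comap_le) hopened.comap_le

lemma measurableSet_openedBetween (p p' : ℝ) (x : ℤ × ℤ) :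
    MeasurableSet (openedBetween p p' x) :=
  sigmaSites_le univ _ (measurableSet_openedBetween_sigmaSites p p' (mem_univ x))

lemma integrable_gain (hp0 : 0 < p) (hp1 : p < 1) (p' : ℝ) (k n : ℕ) (z : ℤ) :
    Integrable (gain p p' k n z) law :=
  (indepFun_indicator_edgeRise p p' k n z).integrable_mul
    ((integrable_const (1 : ℝ)).indicator (measurableSet_openedBetween p p' _))
    (integrable_edgeRise hp0 hp1 _ _ n)

lemma integral_gain (hp0 : 0 < p) (hpp' : p ≤ p') (hp'1 : p' < 1) (k n : ℕ) (z : ℤ) :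
    ∫ U, gain p p' k n z U ∂law = p' - p := by
  have hp1 : p < 1 := hpp'.trans_lt hp'1
  have hopened := measurableSet_openedBetween p p' (k, z)
  refine ((indepFun_indicator_edgeRise p p' k n z).integral_mul_eq_mul_integral
    (measurable_one.indicator hopened).aestronglyMeasurable
    (integrable_edgeRise hp0 hp1 _ _ n).aestronglyMeasurable).trans ?_
  rw [integral_indicator_one hopened, integral_edgeRise hp0 hp1, mul_one, measureReal_def,
    law_openedBetween hp0.le hpp' hp'1.le, ENNReal.toReal_ofReal (sub_nonneg.2 hpp')]

-- The height of the edge at `p'` in column `k` depends on the columns before `k` only, and the law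
-- of the gain at height `z` does not depend on `z`.
lemma identDistrib_gain_edge (p' : ℝ) (hp0 : 0 < p) (hp1 : p < 1) (k n : ℕ) :
    IdentDistrib (fun U => gain p p' k n (edge (openSites p' U) 0 0 k) U) (gain p p' k n 0)
      law law := by
  have hgain (z : ℤ) : Measurable (gain p p' k n z) :=
    (measurable_gain_sigmaSites p p' k n z).mono (sigmaSites_le _) le_rfl
  have hgainEdge : Measurable (fun U => gain p p' k n (edge (openSites p' U) 0 0 k) U) :=
    measurable_comp_index (measurable_edge_openSites p' 0 0 k) hgain
  refine ⟨hgainEdge.aemeasurable, (hgain 0).aemeasurable, Measure.ext fun T hT => ?_⟩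
  rw [Measure.map_apply hgainEdge hT, Measure.map_apply (hgain 0) hT]
  have hindex := measure_inter_mem_index_of_indep
    (indep_sigmaSites (disjoint_strip 0 k (k + 1 + n))) (sigmaSites_le _) (sigmaSites_le _)
    (measurable_edge_sigmaSites p' (a := 0) (b := 0) (n := k) (by simp))
    (@MeasurableSet.univ _ (sigmaSites _)) (D := fun z => {U | gain p p' k n z U ∈ T})
    (fun z => measurable_gain_sigmaSites p p' k n z hT) fun z => law_gain_mem p' hp0 hp1 k n z T
  rw [univ_inter, measure_univ, one_mul] at hindex
  exact hindex

lemma meanEdge_add_mul_le_integral_hybridEdge (hp0 : 0 < p) (hpp' : p ≤ p') (hp'1 : p' < 1)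
    (k n : ℕ) :
    meanEdge p (k + n) + (p' - p) * k ≤ ∫ U, (hybridEdge p p' k n U : ℝ) ∂law := by
  have hp1 : p < 1 := hpp'.trans_lt hp'1
  induction k generalizing n with
  | zero => simp [hybridEdge_zero_left, meanEdge]
  | succ k ih =>
    have hident := identDistrib_gain_edge p' hp0 hp1 k n
    have hgain : p' - p ≤ ∫ U, (hybridEdge p p' (k + 1) n U : ℝ) ∂law -
        ∫ U, (hybridEdge p p' k (n + 1) U : ℝ) ∂law := by
      rw [← integral_gain hp0 hpp' hp'1 k n 0, ← hident.integral_eq,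
        ← integral_sub (integrable_hybridEdge hp0 hpp' hp'1 _ _)
          (integrable_hybridEdge hp0 hpp' hp'1 _ _)]
      refine integral_mono_ae (hident.integrable_iff.2 (integrable_gain hp0 hp1 p' k n 0))
        ((integrable_hybridEdge hp0 hpp' hp'1 _ _).sub
          (integrable_hybridEdge hp0 hpp' hp'1 _ _)) ?_
      filter_upwards [ae_hasEdge hp0 hp1, ae_hasEdge (hp0.trans_le hpp') hp'1] with U hU hU'
      exact gain_le hpp' hU hU' k n
    have := ih (n + 1)
    rw [show k + 1 + n = k + (n + 1) by ring]
    push_cast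
    linarith

lemma meanEdge_add_mul_le (hp0 : 0 < p) (hpp' : p ≤ p') (hp'1 : p' < 1) (n : ℕ) :
    meanEdge p n + (p' - p) * n ≤ meanEdge p' n :=
  meanEdge_add_mul_le_integral_hybridEdge hp0 hpp' hp'1 n 0

end

/-! ### Right-continuity of the mean edge height -/

section

variable {O O' : Set (ℤ × ℤ)} {a b c y : ℤ} {n : ℕ}

lemma mem_entries_Icc_of_row (hcb : c ≤ b) (hrow : ∀ k : ℕ, k < n → (a + k, c) ∈ O)
    (hy : y ∈ entries O a (Iic b) n) (hcy : c ≤ y) : y ∈ entries O a (Icc c b) n := by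
  induction n generalizing y with
  | zero => exact ⟨hcy, hy⟩
  | succ n ih =>
    obtain ⟨e, he, j, hej, hrun, hy⟩ := hy
    have hrow' : ∀ k : ℕ, k < n → (a + k, c) ∈ O := fun k hk => hrow k (by omega)
    have hc : c ∈ entries O a (Icc c b) n := mem_entries_of_row ⟨le_rfl, hcb⟩ hrow'
    by_cases hce : c ≤ e
    · exact ⟨e, ih hrow' he hce, j, hej, hrun, hy⟩
    by_cases hcj : c ≤ j
    · exact ⟨c, hc, j, hcj, fun i hci hij => hrun i (by omega) hij, hy⟩
    · obtain rfl : y = c := by omega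
      refine ⟨y, hc, y, le_rfl, fun i hyi hiy => ?_, .inl rfl⟩
      obtain rfl : i = y := by omega
      exact hrow n (by omega)

lemma mem_entries_of_box {E : Set ℤ} (hE : ∀ e ∈ E, c ≤ e) (hy : y ∈ entries O a E n)
    (hbox : ∀ x ∈ O, a ≤ x.1 → x.1 < a + n → c ≤ x.2 → x.2 ≤ y → x ∈ O') :
    y ∈ entries O' a E n := by
  suffices c ≤ y ∧ y ∈ entries O' a E n from this.2
  induction n generalizing y with
  | zero => exact ⟨hE y hy, hy⟩
  | succ n ih =>
    obtain ⟨e, he, j, hej, hrun, hy⟩ := hy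
    obtain ⟨hce, he'⟩ := ih he fun x hx hax hxn hcx hxe =>
      hbox x hx hax (by push_cast; omega) hcx (by omega)
    refine ⟨by omega, e, he', j, hej, fun i hei hij => ?_, hy⟩
    exact hbox _ (hrun i hei hij) (by simp) (by push_cast; simp) (hce.trans hei)
      (by dsimp only; omega)

-- An open row at height `c` makes everything below it irrelevant for the edge, which is therefore
-- a function of the sites of a finite box.
lemma HasEdge.edge_eq_of_box (hO : HasEdge O) (hO' : HasEdge O') (hOO' : O ⊆ O') (hcb : c ≤ b)
    (hrow : ∀ k : ℕ, k < n → (a + k, c) ∈ O) {d : ℤ} (hd : edge O' a b n ≤ d)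
    (hbox : ∀ x ∈ Ico a (a + n) ×ˢ Icc c d, x ∈ O' → x ∈ O) :
    edge O' a b n = edge O a b n := by
  have hrow' : ∀ k : ℕ, k < n → (a + k, c) ∈ O' := fun k hk => hOO' (hrow k hk)
  have hc_le : c ≤ edge O' a b n := hO'.le_edge (mem_entries_of_row hcb hrow')
  have hmem : edge O' a b n ∈ entries O a (Icc c b) n :=
    mem_entries_of_box (fun _ he => he.1) (mem_entries_Icc_of_row hcb hrow' hO'.edge_mem hc_le)
      fun x hx hax hxn hcx hxy => hbox x ⟨⟨hax, hxn⟩, hcx, hxy.trans hd⟩ hx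
  exact le_antisymm (hO.le_edge (entries_mono subset_rfl Icc_subset_Iic_self hmem))
    (hO.edge_mono hO' hOO' le_rfl)

end

section

variable {p : ℝ}

lemma ae_ne (p : ℝ) : ∀ᵐ U ∂law, ∀ x, (U x : ℝ) ≠ p :=
  ae_all_iff.2 fun x => measure_mono_null (fun _ hU => not_not.1 hU) (law_eq_zero x p)

lemma eventually_mem_openSites_imp {U : Sample} {x : ℤ × ℤ} (hx : (U x : ℝ) ≠ p) :
    ∀ᶠ p' in 𝓝[>] p, x ∈ openSites p' U → x ∈ openSites p U := by
  rcases hx.lt_or_gt with hlt | hgt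
  · exact Eventually.of_forall fun _ _ => hlt
  · filter_upwards [mem_nhdsWithin_of_mem_nhds (Iio_mem_nhds hgt)] with p' hp' hx'
    exact absurd (mem_ofPred.1 hx') (lt_asymm hp')

lemma eventually_edge_openSites_eq {p₁ : ℝ} (hpp₁ : p < p₁) {U : Sample}
    (hU : HasEdge (openSites p U)) (hU₁ : HasEdge (openSites p₁ U)) (hne : ∀ x, (U x : ℝ) ≠ p)
    (a b : ℤ) (n : ℕ) :
    ∀ᶠ p' in 𝓝[>] p, edge (openSites p' U) a b n = edge (openSites p U) a b n := by
  obtain ⟨c, hcb, hrow⟩ := hU.row a b n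
  have hbox : ∀ᶠ p' in 𝓝[>] p, ∀ x ∈ Ico a (a + n) ×ˢ Icc c (edge (openSites p₁ U) a b n),
      x ∈ openSites p' U → x ∈ openSites p U :=
    (eventually_all_finite ((finite_Ico _ _).prod (finite_Icc _ _))).2
      fun x _ => eventually_mem_openSites_imp (hne x)
  filter_upwards [hbox, Ioo_mem_nhdsGT hpp₁] with p' hbox' hp'
  have hsub := openSites_mono hp'.1.le U
  have hsub₁ := openSites_mono hp'.2.le U
  have hU' := hU.of_subset_of_subset hU₁ hsub hsub₁
  exact hU.edge_eq_of_box hU' hsub hcb hrow (hU'.edge_mono hU₁ hsub₁ le_rfl) hbox'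

lemma tendsto_meanEdge_nhdsGT (hp0 : 0 < p) (hp1 : p < 1) (n : ℕ) :
    Tendsto (fun p' => meanEdge p' n) (𝓝[>] p) (𝓝 (meanEdge p n)) := by
  obtain ⟨p₁, hpp₁, hp₁1⟩ := exists_between hp1
  have hp₁0 : 0 < p₁ := hp0.trans hpp₁
  refine tendsto_integral_filter_of_dominated_convergence
    (fun U => |(edge (openSites p U) 0 0 n : ℝ)| + |(edge (openSites p₁ U) 0 0 n : ℝ)|)
    (Eventually.of_forall fun p' =>
      (measurable_edge_openSites_real p' 0 0 n).aestronglyMeasurable) ?_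
    ((integrable_edge hp0 hp1 n).abs.add (integrable_edge hp₁0 hp₁1 n).abs) ?_
  · filter_upwards [Ioo_mem_nhdsGT hpp₁] with p' hp'
    filter_upwards [ae_hasEdge hp0 hp1, ae_hasEdge hp₁0 hp₁1] with U hU hU₁
    have hsub := openSites_mono hp'.1.le U
    have hsub₁ := openSites_mono hp'.2.le U
    have hU' := hU.of_subset_of_subset hU₁ hsub hsub₁
    exact (abs_le_max_abs_abs (Int.cast_le.2 (hU.edge_mono hU' hsub le_rfl))
      (Int.cast_le.2 (hU'.edge_mono hU₁ hsub₁ le_rfl))).trans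
      (max_le_add_of_nonneg (abs_nonneg _) (abs_nonneg _))
  · filter_upwards [ae_hasEdge hp0 hp1, ae_hasEdge hp₁0 hp₁1, ae_ne p] with U hU hU₁ hne
    refine tendsto_const_nhds.congr' ?_
    filter_upwards [eventually_edge_openSites_eq hpp₁ hU hU₁ hne 0 0 n] with p' hp'
    rw [hp']

end

/-! ### Crossings of tubes -/

/-- The sites of the columns `a, …, a + L` at vertical distance at most `h` from the line of slope
`s` through `(a, b)`. -/
def tube (a b : ℤ) (L h : ℕ) (s : ℝ) : Set (ℤ × ℤ) :=
  {x | a ≤ x.1 ∧ x.1 ≤ a + L ∧ |(x.2 : ℝ) - b - s * (x.1 - a)| ≤ h}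

/-- There is an open path through the tube, from its first to its last column. -/
def Crossed (O : Set (ℤ × ℤ)) (a b : ℤ) (L h : ℕ) (s : ℝ) : Prop :=
  ∃ x y : ℤ × ℤ, x.1 = a ∧ y.1 = a + L ∧ x ∈ tube a b L h s ∧ y ∈ tube a b L h s ∧
    Reach (O ∩ tube a b L h s) x y

/-- The sites to the right of column `a` at vertical distance at most `W` from the line of slope
`σ` through `(a, b)`. A chain of tubes stays in such a region. -/
def lane (a b : ℤ) (W : ℕ) (σ : ℝ) : Set (ℤ × ℤ) :=
  {x | a ≤ x.1 ∧ |(x.2 : ℝ) - b - σ * (x.1 - a)| ≤ W}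

/-- Compatibility of the dimensions `L`, `h` of a tube and its slope `s` with the factor `Q` by
which the overlap `Q * h` of successive tubes exceeds their width. -/
structure Admissible (Q L h : ℕ) (s : ℝ) : Prop where
  one_lt : 1 < s
  cross : 7 + 2 * s ≤ (s - 1 / s) * Q
  wide : (s + 3) ^ 2 ≤ Q
  pos : 1 ≤ h
  long : 2 * (Q * h) ≤ L

/-- The horizontal distance of successive tubes of a chain. -/
def strideX (Q L h : ℕ) : ℤ := L - Q * h

/-- The vertical distance of successive tubes of a chain. It is chosen such that the next tube
starts below the current one. -/
noncomputable def strideY (Q L h : ℕ) (s : ℝ) : ℤ := ⌊s * (strideX Q L h : ℝ)⌋ - 2 * h - 1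

/-- The average slope of a chain of tubes of slope `s`, slightly smaller than `s`. -/
noncomputable def laneSlope (Q L h : ℕ) (s : ℝ) : ℝ := strideY Q L h s / strideX Q L h

/-- The height above a tube at which the tube connecting it to the next one starts. -/
noncomputable def linkY (Q L h : ℕ) (s : ℝ) : ℤ := ⌈s * ((strideX Q L h : ℝ) + 2 * h)⌉ + h

/-- The tube of slope `1 / s` connecting the tube at `(x, y)` to the next one. It starts above the
current tube and ends below the next one, so that a path through it crosses both. -/
def linkTube (Q L h : ℕ) (s : ℝ) (x y : ℤ) : Set (ℤ × ℤ) :=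
  transpose (tube (y + linkY Q L h s) (x + strideX Q L h + h) L h s)

/-- All tubes and connecting tubes of a chain of `m + 1` tubes are crossed. -/
def ChainCrossed (O : Set (ℤ × ℤ)) (Q L h : ℕ) (s : ℝ) (m : ℕ) (a b : ℤ) : Prop :=
  (∀ i < m + 1, Crossed O (a + i * strideX Q L h) (b + i * strideY Q L h s) L h s) ∧
  ∀ i < m, Crossed (transpose O) (b + i * strideY Q L h s + linkY Q L h s)
    (a + i * strideX Q L h + strideX Q L h + h) L h s

section

variable {O R : Set (ℤ × ℤ)} {a b x y : ℤ} {L h : ℕ} {s : ℝ} {f g z : ℤ × ℤ}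

lemma mem_tube : z ∈ tube a b L h s ↔ a ≤ z.1 ∧ z.1 ≤ a + L ∧
    (b : ℝ) + s * (z.1 - a) - h ≤ z.2 ∧ (z.2 : ℝ) ≤ b + s * (z.1 - a) + h := by
  simp only [tube, mem_ofPred_eq, abs_le]
  constructor <;> rintro ⟨hleft, hright, hlow, hupp⟩ <;>
    exact ⟨hleft, hright, by linarith, by linarith⟩

lemma Reach.mem_of_inter (hfg : Reach (O ∩ R) f g) (hg : g ∈ R) : f ∈ R := by
  rcases hfg.eq_or_mem with rfl | hf
  · exact hg
  · exact hf.2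

lemma Reach.exists_fst_eq_mem (hfg : Reach (O ∩ R) f g) (hg : g ∈ R) {c : ℤ} (hfc : f.1 ≤ c)
    (hcg : c ≤ g.1) : ∃ q ∈ R, q.1 = c ∧ Reach (O ∩ R) f q ∧ Reach (O ∩ R) q g := by
  obtain ⟨q, hq, hfq, hqg⟩ := hfg.exists_fst_eq hfc hcg
  exact ⟨q, hqg.mem_of_inter hg, hq, hfq, hqg⟩

variable {Q : ℕ}

lemma strideX_cast : (strideX Q L h : ℝ) = L - Q * h := by
  simp [strideX]

lemma strideY_le : (strideY Q L h s : ℝ) + 2 * h + 1 ≤ s * strideX Q L h := by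
  have := Int.floor_le (s * (strideX Q L h : ℝ))
  push_cast [strideY]
  linarith

lemma le_strideY : s * strideX Q L h ≤ strideY Q L h s + 2 * h + 2 := by
  have := Int.lt_floor_add_one (s * (strideX Q L h : ℝ))
  push_cast [strideY]
  linarith

lemma le_linkY : s * strideX Q L h + 2 * (s * h) + h ≤ linkY Q L h s := by
  have := Int.le_ceil (s * ((strideX Q L h : ℝ) + 2 * h))
  push_cast [linkY]
  linarith

lemma linkY_le : (linkY Q L h s : ℝ) ≤ s * strideX Q L h + 2 * (s * h) + h + 1 := by
  have := Int.ceil_lt_add_one (s * ((strideX Q L h : ℝ) + 2 * h))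
  push_cast [linkY]
  linarith

namespace Admissible

lemma sixteen_le (hA : Admissible Q L h s) : 16 ≤ Q := by
  have := hA.wide
  have := hA.one_lt
  have : (16 : ℝ) ≤ Q := by nlinarith
  exact_mod_cast this

lemma two_mul_le_overlap (hA : Admissible Q L h s) : 2 * h ≤ Q * h :=
  Nat.mul_le_mul_right _ (by have := hA.sixteen_le; omega)

lemma mul_le_length (hA : Admissible Q L h s) : 32 * h ≤ L :=
  calc 32 * h = 2 * (16 * h) := by ring
    _ ≤ 2 * (Q * h) := by gcongr; exact hA.sixteen_le
    _ ≤ L := hA.long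

lemma length_le_mul (hA : Admissible Q L h s) : 16 * L ≤ Q * L :=
  Nat.mul_le_mul_right _ hA.sixteen_le

lemma length_le_strideX (hA : Admissible Q L h s) : (L : ℤ) ≤ 2 * strideX Q L h := by
  have : 2 * ((Q : ℤ) * h) ≤ L := by exact_mod_cast hA.long
  unfold strideX
  linarith

lemma strideX_pos (hA : Admissible Q L h s) : 0 < strideX Q L h := by
  have := hA.length_le_strideX
  have := hA.mul_le_length
  have := hA.pos
  omega

lemma natCast_mul_sub (hA : Admissible Q L h s) (n : ℕ) :
    ((n * (L - Q * h) : ℕ) : ℤ) = n * strideX Q L h := by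
  have : Q * h ≤ L := by have := hA.long; omega
  push_cast [Nat.cast_sub this, strideX]
  ring

lemma overlap_gain (hA : Admissible Q L h s) :
    7 * (h : ℝ) + 2 * (s * h) ≤ s * (Q * h) - Q * h / s := by
  have := mul_le_mul_of_nonneg_right hA.cross (Nat.cast_nonneg (α := ℝ) h)
  calc 7 * (h : ℝ) + 2 * (s * h) = (7 + 2 * s) * h := by ring
    _ ≤ (s - 1 / s) * Q * h := this
    _ = s * (Q * h) - Q * h / s := by ring

/- The overlap of the tubes at `(x, y)` and `(x + strideX, y + strideY)` extends from column
`x + strideX + 2 * h` to column `x + L`. At its left end the connecting tube lies above both tubes,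
at its right end it lies below both. -/

lemma tube_le_link (hz : z ∈ tube x y L h s) (hzx : z.1 = x + strideX Q L h + 2 * h) :
    z.2 ≤ y + linkY Q L h s := by
  have hupp := (mem_tube.1 hz).2.2.2
  have := le_linkY (Q := Q) (L := L) (h := h) (s := s)
  rw [hzx] at hupp
  push_cast at hupp
  have : (z.2 : ℝ) ≤ y + linkY Q L h s := by linarith
  exact_mod_cast this

lemma next_le_tube (hf : f ∈ tube (x + strideX Q L h) (y + strideY Q L h s) L h s)
    (hfx : f.1 = x + strideX Q L h + 2 * h) (hg : g ∈ tube x y L h s) (hgf : g.1 = f.1) :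
    f.2 ≤ g.2 := by
  have hupp := (mem_tube.1 hf).2.2.2
  have hlow := (mem_tube.1 hg).2.2.1
  have := strideY_le (Q := Q) (L := L) (h := h) (s := s)
  rw [hfx] at hupp
  rw [hgf, hfx] at hlow
  push_cast at hupp hlow
  have : (f.2 : ℝ) ≤ g.2 := by linarith
  exact_mod_cast this

lemma link_le_tube (hA : Admissible Q L h s) (hz : z ∈ tube x y L h s) (hzx : z.1 = x + L) :
    (y : ℝ) + linkY Q L h s + Q * h / s ≤ z.2 := by
  have hlow := (mem_tube.1 hz).2.2.1
  have hh : (1 : ℝ) ≤ h := by exact_mod_cast hA.pos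
  have := linkY_le (Q := Q) (L := L) (h := h) (s := s)
  have := hA.overlap_gain
  rw [strideX_cast] at *
  rw [hzx] at hlow
  push_cast at hlow
  linarith

lemma link_le_next (hA : Admissible Q L h s)
    (hz : z ∈ tube (x + strideX Q L h) (y + strideY Q L h s) L h s) (hzx : z.1 = x + L) :
    (y : ℝ) + linkY Q L h s + Q * h / s ≤ z.2 := by
  have hlow := (mem_tube.1 hz).2.2.1
  have hh : (1 : ℝ) ≤ h := by exact_mod_cast hA.pos
  have := linkY_le (Q := Q) (L := L) (h := h) (s := s)
  have := le_strideY (Q := Q) (L := L) (h := h) (s := s)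
  have := hA.overlap_gain
  rw [hzx] at hlow
  push_cast at hlow
  rw [strideX_cast] at *
  linarith

lemma exists_reach_linkTube (hA : Admissible Q L h s)
    (hlink : Crossed (transpose O) (y + linkY Q L h s) (x + strideX Q L h + h) L h s) :
    ∃ e e' : ℤ × ℤ, e.1 = x + strideX Q L h + 2 * h ∧ y + linkY Q L h s ≤ e.2 ∧
      e'.1 = x + L ∧ (e'.2 : ℝ) ≤ y + linkY Q L h s + Q * h / s ∧
      Reach (O ∩ linkTube Q L h s x y) e e' := by
  have hs := hA.one_lt
  obtain ⟨u, v, hu, hv, hu_mem, hv_mem, huv⟩ := hlink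
  have huv' : Reach (O ∩ linkTube Q L h s x y) u.swap v.swap := huv.transpose
  have hu_le : u.swap.1 ≤ x + strideX Q L h + 2 * h := by
    have hupp := (mem_tube.1 hu_mem).2.2.2
    rw [hu] at hupp
    push_cast at hupp
    have : (u.2 : ℝ) ≤ x + strideX Q L h + 2 * h := by linarith
    exact_mod_cast this
  have hle_v : x + L ≤ v.swap.1 := by
    have hlow := (mem_tube.1 hv_mem).2.2.1
    have hA_pos : (0 : ℝ) ≤ strideX Q L h := by exact_mod_cast hA.strideX_pos.le
    have : (L : ℝ) ≤ s * L := le_mul_of_one_le_left (by positivity) hs.le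
    rw [hv] at hlow
    push_cast at hlow
    have : (x : ℝ) + L ≤ v.2 := by linarith
    exact_mod_cast this
  have hoverlap := hA.two_mul_le_overlap
  have hAL : strideX Q L h = L - Q * h := rfl
  obtain ⟨e, he_mem, he, -, hev⟩ := huv'.exists_fst_eq_mem hv_mem hu_le (by zify at *; omega)
  obtain ⟨e', he'_mem, he', hee', -⟩ :=
    hev.exists_fst_eq_mem (c := x + L) hv_mem (by zify at *; omega) hle_v
  refine ⟨e, e', he, (mem_tube.1 he_mem).1, he', ?_, hee'⟩
  have hlow := (mem_tube.1 he'_mem).2.2.1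
  rw [Prod.fst_swap, Prod.snd_swap, he'] at hlow
  push_cast [strideX_cast] at hlow
  rw [← sub_le_iff_le_add', le_div_iff₀ (by linarith)]
  linarith

/-- The path through the connecting tube crosses the paths through both tubes, so that following it
leads from the first to the second. -/
lemma exists_reach_next (hA : Admissible Q L h s) (hg : g ∈ tube x y L h s)
    (hfg : Reach (O ∩ tube x y L h s) f g) (hfx : f.1 ≤ x + strideX Q L h + 2 * h)
    (hgx : g.1 = x + L)
    (hlink : Crossed (transpose O) (y + linkY Q L h s) (x + strideX Q L h + h) L h s)
    (hnext : Crossed O (x + strideX Q L h) (y + strideY Q L h s) L h s) :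
    ∃ f' g' : ℤ × ℤ, g' ∈ tube (x + strideX Q L h) (y + strideY Q L h s) L h s ∧
      f'.1 = x + L ∧ g'.1 = x + strideX Q L h + L ∧
      Reach (O ∩ tube (x + strideX Q L h) (y + strideY Q L h s) L h s) f' g' ∧
      Reach (O ∩ (tube x y L h s ∪ linkTube Q L h s x y ∪
        tube (x + strideX Q L h) (y + strideY Q L h s) L h s)) f f' := by
  have hoverlap : (2 : ℤ) * h ≤ Q * h := by exact_mod_cast hA.two_mul_le_overlap
  have hAL : strideX Q L h = L - Q * h := rfl
  have hA_pos := hA.strideX_pos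
  obtain ⟨e, e', he, hle_e, he', he'_le, hee'⟩ := hA.exists_reach_linkTube hlink
  obtain ⟨g₀, hg₀_mem, hg₀, hfg₀, hg₀g⟩ := hfg.exists_fst_eq_mem hg hfx (by omega)
  obtain ⟨u, g', hu, hg', -, hg'_mem, hug'⟩ := hnext
  obtain ⟨f₀, hf₀_mem, hf₀, -, hf₀g'⟩ :=
    hug'.exists_fst_eq_mem (c := x + strideX Q L h + 2 * h) hg'_mem (by omega) (by omega)
  obtain ⟨f', hf'_mem, hf', hf₀f', hf'g'⟩ :=
    hf₀g'.exists_fst_eq_mem (c := x + L) hg'_mem (by omega) (by omega)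
  have he'_le_g : e'.2 ≤ g.2 := by exact_mod_cast he'_le.trans (hA.link_le_tube hg hgx)
  have he'_le_f' : e'.2 ≤ f'.2 := by exact_mod_cast he'_le.trans (hA.link_le_next hf'_mem hf')
  refine ⟨f', g', hg'_mem, hf', hg', hf'g', ?_⟩
  set D := tube x y L h s ∪ linkTube Q L h s x y ∪
    tube (x + strideX Q L h) (y + strideY Q L h s) L h s
  have htube : O ∩ tube x y L h s ⊆ O ∩ D :=
    inter_subset_inter_right _ (subset_union_left.trans subset_union_left)
  have hlinkTube : O ∩ linkTube Q L h s x y ⊆ O ∩ D :=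
    inter_subset_inter_right _ (subset_union_right.trans subset_union_left)
  have hg₀e' : Reach (O ∩ D) g₀ e' :=
    (hg₀g.mono htube).cross_left (hee'.mono hlinkTube) (hg₀.trans he.symm) (hgx.trans he'.symm)
      ((tube_le_link hg₀_mem hg₀).trans hle_e) he'_le_g
  have hg₀f' : Reach (O ∩ D) g₀ f' :=
    (hf₀f'.mono (inter_subset_inter_right _ subset_union_right)).cross_right hg₀e'
      (hf₀.trans hg₀.symm) (hf'.trans he'.symm)
      (next_le_tube hf₀_mem hf₀ hg₀_mem (hg₀.trans hf₀.symm)) he'_le_f'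
  exact (hfg₀.mono htube).trans hg₀f'

lemma laneSlope_mul_strideX (hA : Admissible Q L h s) :
    laneSlope Q L h s * strideX Q L h = strideY Q L h s :=
  div_mul_cancel₀ _ (by exact_mod_cast hA.strideX_pos.ne')

lemma laneSlope_le (hA : Admissible Q L h s) : laneSlope Q L h s ≤ s := by
  rw [laneSlope, div_le_iff₀ (by exact_mod_cast hA.strideX_pos)]
  have := strideY_le (Q := Q) (L := L) (h := h) (s := s)
  linarith [Nat.cast_nonneg (α := ℝ) h]

lemma sub_laneSlope_mul_le (hA : Admissible Q L h s) :
    (s - laneSlope Q L h s) * strideX Q L h ≤ 4 * h := by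
  have hh : (1 : ℝ) ≤ h := by exact_mod_cast hA.pos
  rw [sub_mul, hA.laneSlope_mul_strideX]
  linarith [le_strideY (Q := Q) (L := L) (h := h) (s := s)]

lemma laneSlope_nonneg (hA : Admissible Q L h s) : 0 ≤ laneSlope Q L h s := by
  have hA_pos : (0 : ℝ) < strideX Q L h := by exact_mod_cast hA.strideX_pos
  refine div_nonneg ?_ hA_pos.le
  have : (4 : ℝ) * h ≤ strideX Q L h := by
    have := hA.length_le_strideX
    have := hA.mul_le_length
    have : 4 * (h : ℤ) ≤ strideX Q L h := by omega
    exact_mod_cast this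
  have : (strideX Q L h : ℝ) ≤ s * strideX Q L h :=
    le_mul_of_one_le_left hA_pos.le hA.one_lt.le
  have hh : (1 : ℝ) ≤ h := by exact_mod_cast hA.pos
  linarith [le_strideY (Q := Q) (L := L) (h := h) (s := s)]

lemma tube_subset_lane (hA : Admissible Q L h s) (a b : ℤ) (i : ℕ) :
    tube (a + i * strideX Q L h) (b + i * strideY Q L h s) L h s ⊆
      lane a b (Q * L) (laneSlope Q L h s) := by
  intro z hz
  obtain ⟨hleft, hright, habs⟩ := hz
  have hA_pos := hA.strideX_pos
  refine ⟨le_trans (le_add_of_nonneg_right (by positivity)) hleft, ?_⟩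
  set σ := laneSlope Q L h s
  have hσ : σ * strideX Q L h = strideY Q L h s := hA.laneSlope_mul_strideX
  set c : ℝ := z.1 - (a + i * strideX Q L h) with hc
  have hc_nonneg : 0 ≤ c := sub_nonneg.2 (by exact_mod_cast hleft)
  have hc_le : c ≤ 2 * strideX Q L h := by
    have hright' : (z.1 : ℝ) ≤ a + i * strideX Q L h + L := by exact_mod_cast hright
    have hL_le : (L : ℝ) ≤ 2 * strideX Q L h := by exact_mod_cast hA.length_le_strideX
    linarith
  have hslope : 0 ≤ s - σ := sub_nonneg.2 hA.laneSlope_le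
  have hdev : (s - σ) * c ≤ 8 * h := by
    linarith [mul_le_mul_of_nonneg_left hc_le hslope, hA.sub_laneSlope_mul_le]
  have hsplit : (z.2 : ℝ) - b - σ * (z.1 - a) =
      ((z.2 : ℝ) - (b + i * strideY Q L h s) - s * c) + (s - σ) * c := by
    rw [hc, ← hσ]; ring
  have hwide : 9 * (h : ℝ) ≤ (Q * L : ℕ) := by
    have := hA.mul_le_length
    have := hA.length_le_mul
    have : 9 * h ≤ Q * L := by omega
    exact_mod_cast this
  push_cast at habs
  rw [hsplit]
  calc _ ≤ |(z.2 : ℝ) - (b + i * strideY Q L h s) - s * c| + |(s - σ) * c| := abs_add_le _ _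
    _ ≤ h + 8 * h := add_le_add habs (by rwa [abs_of_nonneg (mul_nonneg hslope hc_nonneg)])
    _ ≤ (Q * L : ℕ) := by linarith

lemma linkY_sub_strideY_mem_Icc (hA : Admissible Q L h s) :
    (linkY Q L h s : ℝ) - strideY Q L h s ∈ Icc 0 (6 * h + 2 * (s * h)) := by
  have hh : (1 : ℝ) ≤ h := by exact_mod_cast hA.pos
  have hsh : 0 ≤ s * h := mul_nonneg (by linarith [hA.one_lt]) (Nat.cast_nonneg _)
  have := le_linkY (Q := Q) (L := L) (h := h) (s := s)
  have := linkY_le (Q := Q) (L := L) (h := h) (s := s)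
  have := strideY_le (Q := Q) (L := L) (h := h) (s := s)
  have := le_strideY (Q := Q) (L := L) (h := h) (s := s)
  constructor <;> linarith

lemma lane_wide (hA : Admissible Q L h s) :
    6 * h + 2 * (s * h) + L ≤ (Q * L : ℕ) ∧ s * (2 * h + s * L) ≤ (Q * L : ℕ) := by
  have hs : 0 ≤ s := by linarith [hA.one_lt]
  have hhL : 32 * (h : ℝ) ≤ L := by exact_mod_cast hA.mul_le_length
  have hL : (0 : ℝ) ≤ L := Nat.cast_nonneg L
  have hsL : 0 ≤ s * L := mul_nonneg hs hL
  have hssL : 0 ≤ s * (s * L) := mul_nonneg hs hsL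
  have hsh := mul_le_mul_of_nonneg_left hhL hs
  have hQL := mul_le_mul_of_nonneg_right hA.wide hL
  push_cast
  constructor <;> linarith

lemma linkTube_subset_lane (hA : Admissible Q L h s) (a b : ℤ) (i : ℕ) :
    linkTube Q L h s (a + i * strideX Q L h) (b + i * strideY Q L h s) ⊆
      lane a b (Q * L) (laneSlope Q L h s) := by
  intro z hz
  obtain ⟨hbot, htop, hlow, hupp⟩ := mem_tube.1 (mem_transpose.1 hz)
  simp only [Prod.fst_swap, Prod.snd_swap] at hbot htop hlow hupp
  have hs := hA.one_lt
  have hA_pos : (0 : ℝ) < strideX Q L h := by exact_mod_cast hA.strideX_pos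
  have hσ := hA.laneSlope_mul_strideX
  set σ := laneSlope Q L h s
  set r : ℝ := z.2 - (b + i * strideY Q L h s + linkY Q L h s) with hr
  set c : ℝ := z.1 - (a + i * strideX Q L h + strideX Q L h) with hc
  have hr_nonneg : 0 ≤ r := sub_nonneg.2 (by exact_mod_cast hbot)
  have hr_le : r ≤ L := by
    have : (z.2 : ℝ) ≤ b + i * strideY Q L h s + linkY Q L h s + L := by exact_mod_cast htop
    linarith
  have hsr_le : s * r ≤ s * L := mul_le_mul_of_nonneg_left hr_le (by linarith)
  have hsr_nonneg : 0 ≤ s * r := mul_nonneg (by linarith) hr_nonneg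
  push_cast at hlow hupp
  have hc_nonneg : 0 ≤ c := by linarith
  have hσc_nonneg : 0 ≤ σ * c := mul_nonneg hA.laneSlope_nonneg hc_nonneg
  have hσc_le : σ * c ≤ s * (2 * h + s * L) :=
    mul_le_mul hA.laneSlope_le (by linarith) hc_nonneg (by linarith)
  obtain ⟨hlink_nonneg, hlink_le⟩ := hA.linkY_sub_strideY_mem_Icc
  obtain ⟨hwide, hwide'⟩ := hA.lane_wide
  refine ⟨?_, ?_⟩
  · have : 0 ≤ (i : ℝ) * strideX Q L h := by positivity
    have : (a : ℝ) ≤ z.1 := by linarith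
    exact_mod_cast this
  · have hsplit : (z.2 : ℝ) - b - σ * (z.1 - a) =
        (linkY Q L h s - strideY Q L h s) + r - σ * c := by
      rw [hc, hr, ← hσ]; ring
    rw [hsplit, abs_le]
    constructor <;> linarith

lemma exists_reach_last_tube (hA : Admissible Q L h s) {m : ℕ}
    (hO : ChainCrossed O Q L h s m a b) :
    ∃ x f g : ℤ × ℤ, x.1 = a ∧ x ∈ tube a b L h s ∧
      f.1 ≤ a + m * strideX Q L h + strideX Q L h + 2 * h ∧ g.1 = a + m * strideX Q L h + L ∧
      g ∈ tube (a + m * strideX Q L h) (b + m * strideY Q L h s) L h s ∧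
      Reach (O ∩ tube (a + m * strideX Q L h) (b + m * strideY Q L h s) L h s) f g ∧
      Reach (O ∩ lane a b (Q * L) (laneSlope Q L h s)) x f := by
  have hA_pos := hA.strideX_pos
  induction m with
  | zero =>
    obtain ⟨x, y, hx, hy, hx_mem, hy_mem, hxy⟩ := hO.1 0 (by omega)
    simp only [Nat.cast_zero, zero_mul, add_zero] at hx hy hx_mem hy_mem hxy ⊢
    exact ⟨x, x, y, hx, hx_mem, by omega, hy, hy_mem, hxy, .refl _⟩
  | succ m ih =>
    obtain ⟨x, f, g, hx, hx_mem, hf, hg, hg_mem, hfg, hxf⟩ :=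
      ih ⟨fun i hi => hO.1 i (by omega), fun i hi => hO.2 i (by omega)⟩
    have hX : a + ((m + 1 : ℕ) : ℤ) * strideX Q L h =
      a + m * strideX Q L h + strideX Q L h := by push_cast; ring
    have hY : b + ((m + 1 : ℕ) : ℤ) * strideY Q L h s =
      b + m * strideY Q L h s + strideY Q L h s := by push_cast; ring
    have hnext := hO.1 (m + 1) (by omega)
    have hnext_lane := hA.tube_subset_lane a b (m + 1)
    rw [hX, hY] at hnext hnext_lane ⊢
    obtain ⟨f', g', hg'_mem, hf', hg', hf'g', hff'⟩ :=
      hA.exists_reach_next hg_mem hfg hf hg (hO.2 m (by omega)) hnext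
    have hAL := hA.length_le_strideX
    refine ⟨x, f', g', hx, hx_mem, by omega, hg', hg'_mem, hf'g', hxf.trans (hff'.mono ?_)⟩
    exact inter_subset_inter_right _ (union_subset (union_subset (hA.tube_subset_lane a b m)
      (hA.linkTube_subset_lane a b m)) hnext_lane)

lemma exists_reach_lane (hA : Admissible Q L h s) {m n : ℕ} (hO : ChainCrossed O Q L h s m a b)
    (hn : n ≤ (m + 1) * (L - Q * h)) :
    ∃ x q : ℤ × ℤ, x.1 = a ∧ x ∈ tube a b L h s ∧ q.1 = a + n ∧
      q ∈ lane a b (Q * L) (laneSlope Q L h s) ∧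
      Reach (O ∩ lane a b (Q * L) (laneSlope Q L h s)) x q := by
  obtain ⟨x, f, g, hx, hx_mem, -, hg, hg_mem, hfg, hxf⟩ := hA.exists_reach_last_tube hO
  have hlast := hA.tube_subset_lane a b m
  have hxg := hxf.trans (hfg.mono (inter_subset_inter_right _ hlast))
  have hn' : (n : ℤ) ≤ m * strideX Q L h + L := by
    have hcast := hA.natCast_mul_sub (m + 1)
    have hAL : strideX Q L h ≤ L := sub_le_self _ (by positivity)
    push_cast [add_one_mul] at hcast
    zify at hn
    linarith
  obtain ⟨q, hq_mem, hq, hxq, -⟩ :=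
    hxg.exists_fst_eq_mem (c := a + n) (hlast hg_mem) (by omega) (by omega)
  exact ⟨x, q, hx, hx_mem, hq, hq_mem, hxq⟩

end Admissible

end

/-! ### Crossing probabilities -/

section

variable {O O' : Set (ℤ × ℤ)} {a b : ℤ} {L h : ℕ} {s : ℝ}

lemma Reach.exists_finset {x y : ℤ × ℤ} (hxy : Reach O x y) :
    ∃ F : Finset (ℤ × ℤ), (F : Set (ℤ × ℤ)) ⊆ O ∧ Reach (F : Set (ℤ × ℤ)) x y := by
  induction hxy with
  | refl => exact ⟨∅, by simp, .refl _⟩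
  | @tail y _ _ hstep ih =>
    obtain ⟨F, hFO, hF⟩ := ih
    have hsub : (F : Set (ℤ × ℤ)) ⊆ (insert y F : Finset (ℤ × ℤ)) := by simp
    refine ⟨insert y F, ?_, (hF.mono hsub).trans (Step.reach ⟨by simp, hstep.2⟩)⟩
    rw [Finset.coe_insert]
    exact insert_subset hstep.1 hFO

lemma Crossed.mono (hO : O ∩ tube a b L h s ⊆ O') (hc : Crossed O a b L h s) :
    Crossed O' a b L h s := by
  obtain ⟨x, y, hx, hy, hx_mem, hy_mem, hxy⟩ := hc
  exact ⟨x, y, hx, hy, hx_mem, hy_mem, hxy.mono fun z hz => ⟨hO hz, hz.2⟩⟩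

lemma crossed_iff_exists_finset : Crossed O a b L h s ↔
    ∃ F : Finset (ℤ × ℤ), ((F : Set (ℤ × ℤ)) ⊆ tube a b L h s ∧
      Crossed (F : Set (ℤ × ℤ)) a b L h s) ∧ ∀ z ∈ F, z ∈ O := by
  constructor
  · rintro ⟨x, y, hx, hy, hx_mem, hy_mem, hxy⟩
    obtain ⟨F, hF, hF_reach⟩ := hxy.exists_finset
    refine ⟨F, ⟨fun z hz => (hF hz).2, x, y, hx, hy, hx_mem, hy_mem, ?_⟩, fun z hz => (hF hz).1⟩
    exact hF_reach.mono fun z hz => ⟨hz, (hF hz).2⟩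
  · rintro ⟨F, ⟨-, hF⟩, hFO⟩
    exact hF.mono fun z hz => hFO z hz.1

lemma measurable_crossed {Ω : Type*} {mΩ : MeasurableSpace Ω} {O : Ω → Set (ℤ × ℤ)}
    (hO : ∀ x ∈ tube a b L h s, Measurable fun ω => x ∈ O ω) :
    Measurable fun ω => Crossed (O ω) a b L h s := by
  rw [funext fun ω => propext (crossed_iff_exists_finset (O := O ω))]
  refine Measurable.exists fun F => ?_
  by_cases hF : (F : Set (ℤ × ℤ)) ⊆ tube a b L h s ∧ Crossed (F : Set (ℤ × ℤ)) a b L h s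
  · simp only [hF, and_self, true_and]
    exact Measurable.forall fun z => Measurable.forall fun hz => hO z (hF.1 hz)
  · simp only [hF, false_and]
    exact measurable_const

lemma crossed_translate (a b : ℤ) :
    Crossed ((fun w => w + (a, b)) ⁻¹' O) 0 0 L h s ↔ Crossed O a b L h s := by
  have htube : tube 0 0 L h s = (fun w => w + (a, b)) ⁻¹' tube a b L h s := by
    ext w
    simp only [mem_preimage, mem_tube, Prod.fst_add, Prod.snd_add]
    push_cast
    refine and_congr (by omega) (and_congr (by omega) (and_congr ?_ ?_)) <;>
    constructor <;> intro h <;> linarith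
  rw [Crossed, htube, ← preimage_inter]
  constructor
  · rintro ⟨x, y, hx, hy, hx_mem, hy_mem, hxy⟩
    exact ⟨x + (a, b), y + (a, b), by simp [hx], by simp [hy, add_comm], hx_mem, hy_mem,
      hxy.of_translate (a, b)⟩
  · rintro ⟨x, y, hx, hy, hx_mem, hy_mem, hxy⟩
    refine ⟨x - (a, b), y - (a, b), by simp [hx], by simp [hy], ?_, ?_, ?_⟩
    · simpa using hx_mem
    · simpa using hy_mem
    · exact (reach_translate (a, b)).2 (by simpa using hxy)

/-- The probability that a tube is not crossed. -/
noncomputable def failProb (p : ℝ) (L h : ℕ) (s : ℝ) : ENNReal :=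
  law {U | ¬ Crossed (openSites p U) 0 0 L h s}

lemma law_not_crossed (p : ℝ) (a b : ℤ) (L h : ℕ) (s : ℝ) :
    law {U | ¬ Crossed (openSites p U) a b L h s} = failProb p L h s := by
  rw [failProb, ← law_reindex (Equiv.addRight ((a, b) : ℤ × ℤ))
    {U | ¬ Crossed (openSites p U) 0 0 L h s}]
  congr 1
  ext U
  rw [mem_preimage, mem_ofPred_eq, mem_ofPred_eq, openSites_reindex]
  exact (not_congr (crossed_translate a b)).symm

lemma law_not_crossed_transpose (p : ℝ) (a b : ℤ) (L h : ℕ) (s : ℝ) :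
    law {U | ¬ Crossed (transpose (openSites p U)) a b L h s} = failProb p L h s := by
  rw [← law_not_crossed p a b, ← law_reindex (Equiv.prodComm ℤ ℤ)
    {U | ¬ Crossed (openSites p U) a b L h s}]
  rfl

lemma failProb_anti {p p' : ℝ} (hp : p ≤ p') : failProb p' L h s ≤ failProb p L h s :=
  measure_mono fun U hU hc => hU (hc.mono fun _ hz => openSites_mono hp U hz.1)

-- Failure probabilities are left-continuous in `p`, since a crossing uses finitely many sites and
-- openness `U x < p` is an open condition.
lemma exists_lt_failProb_lt {p : ℝ} {δ : ENNReal} (hδ : failProb p L h s < δ) :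
    ∃ p' < p, failProb p' L h s < δ := by
  obtain ⟨u, hu_mono, hu_lt, hu⟩ := exists_seq_strictMono_tendsto p
  set fail : ℕ → Set Sample := fun n => {U | ¬ Crossed (openSites (u n) U) 0 0 L h s}
  have hanti : Antitone fail := fun i j hij U hU hc =>
    hU (hc.mono fun z hz => openSites_mono (hu_mono.monotone hij) U hz.1)
  have hmeas (n : ℕ) : NullMeasurableSet (fail n) law :=
    (measurableSet_setOfPred.2
      (measurable_crossed fun x _ => measurable_mem_openSites x (u n)).not).nullMeasurableSet
  have hle : law (⋂ n, fail n) ≤ failProb p L h s := by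
    refine measure_mono fun U hU hc => ?_
    obtain ⟨F, ⟨-, hF⟩, hF_open⟩ := crossed_iff_exists_finset.1 hc
    have hF_open' : ∀ᶠ n in atTop, ∀ z ∈ F, z ∈ openSites (u n) U :=
      (Filter.eventually_all_finset F).2 fun z hz => hu.eventually (lt_mem_nhds (hF_open z hz))
    obtain ⟨n, hn⟩ := hF_open'.exists
    exact mem_iInter.1 hU n (hF.mono fun z hz => hn z hz.1)
  have hlim := tendsto_measure_iInter_atTop hmeas hanti ⟨0, measure_ne_top _ _⟩
  obtain ⟨n, hn⟩ := (hlim.eventually (gt_mem_nhds (hle.trans_lt hδ))).exists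
  exact ⟨u n, hu_lt n, hn⟩

variable {Q : ℕ}

lemma law_not_chainCrossed_le (p : ℝ) (m : ℕ) (a b : ℤ) :
    law {U | ¬ ChainCrossed (openSites p U) Q L h s m a b} ≤
      (2 * m + 1 : ℕ) * failProb p L h s := by
  set tubeFail : ℕ → Set Sample := fun i => {U | ¬ Crossed (openSites p U)
    (a + i * strideX Q L h) (b + i * strideY Q L h s) L h s}
  set linkFail : ℕ → Set Sample := fun i => {U | ¬ Crossed (transpose (openSites p U))
    (b + i * strideY Q L h s + linkY Q L h s) (a + i * strideX Q L h + strideX Q L h + h) L h s}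
  have hsub : {U | ¬ ChainCrossed (openSites p U) Q L h s m a b} ⊆
      (⋃ i ∈ Finset.range (m + 1), tubeFail i) ∪ ⋃ i ∈ Finset.range m, linkFail i := by
    intro U hU
    by_contra hc
    simp only [mem_union, mem_iUnion, Finset.mem_range, not_or, not_exists] at hc
    exact hU ⟨fun i hi => not_not.1 (hc.1 i hi), fun i hi => not_not.1 (hc.2 i hi)⟩
  calc law {U | ¬ ChainCrossed (openSites p U) Q L h s m a b}
      ≤ law (⋃ i ∈ Finset.range (m + 1), tubeFail i) + law (⋃ i ∈ Finset.range m, linkFail i) :=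
        (measure_mono hsub).trans (measure_union_le _ _)
    _ ≤ ∑ i ∈ Finset.range (m + 1), law (tubeFail i) + ∑ i ∈ Finset.range m, law (linkFail i) :=
        add_le_add (measure_biUnion_finset_le _ _) (measure_biUnion_finset_le _ _)
    _ = (2 * m + 1 : ℕ) * failProb p L h s := by
        simp only [tubeFail, linkFail, law_not_crossed, law_not_crossed_transpose,
          Finset.sum_const, Finset.card_range, nsmul_eq_mul]
        push_cast
        ring

lemma disjoint_lane (W : ℕ) (σ : ℝ) :
    Disjoint (lane 0 (W + 1 : ℤ) W σ) (lane 0 (-(W + 1 : ℤ)) W σ) := by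
  refine Set.disjoint_left.2 fun z hz hz' => ?_
  have hlow := (abs_le.1 hz.2).1
  have hupp := (abs_le.1 hz'.2).2
  push_cast at hlow hupp
  linarith

namespace Admissible

lemma measurable_chainCrossed (hA : Admissible Q L h s) {Ω : Type*} {_ : MeasurableSpace Ω}
    {O : Ω → Set (ℤ × ℤ)} (m : ℕ)
    (hO : ∀ x ∈ lane a b (Q * L) (laneSlope Q L h s), Measurable fun ω => x ∈ O ω) :
    Measurable fun ω => ChainCrossed (O ω) Q L h s m a b :=
  .and (.forall fun i => .forall fun _ => measurable_crossed fun x hx =>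
      hO x (hA.tube_subset_lane a b i hx))
    (.forall fun i => .forall fun _ => measurable_crossed fun x hx =>
      hO x.swap (hA.linkTube_subset_lane a b i hx))

lemma mem_tube_of_mem_lane (hA : Admissible Q L h s) (hb : |b| ≤ Q * L + 1) {σ : ℝ} {n : ℕ}
    {z : ℤ × ℤ} (hz : z ∈ lane 0 b (Q * L) σ) (hzn : z.1 ≤ n) :
    z ∈ tube 0 0 n (3 * (Q * L)) σ := by
  refine ⟨hz.1, by simpa using hzn, ?_⟩
  have hQL : (1 : ℝ) ≤ Q * L := by
    have := hA.mul_le_length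
    have := hA.length_le_mul
    have := hA.pos
    have : 1 ≤ Q * L := by omega
    exact_mod_cast this
  have hb' : |(b : ℝ)| ≤ Q * L + 1 := by exact_mod_cast hb
  have hz_abs := hz.2
  rw [abs_le] at hb' hz_abs ⊢
  push_cast at hz_abs ⊢
  constructor <;> linarith

lemma crossed_of_chainCrossed (hA : Admissible Q L h s) {m : ℕ} (hb : |b| ≤ Q * L + 1)
    (hO : ChainCrossed O Q L h s m 0 b) :
    Crossed O 0 0 ((m + 1) * (L - Q * h)) (3 * (Q * L)) (laneSlope Q L h s) := by
  obtain ⟨x, q, hx, -, hq, hq_mem, hxq⟩ := hA.exists_reach_lane hO le_rfl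
  rw [zero_add] at hq
  have hmem : ∀ r ∈ lane 0 b (Q * L) (laneSlope Q L h s), r.1 ≤ q.1 → r ∈ tube 0 0 _ _ _ :=
    fun r hr hrq => hA.mem_tube_of_mem_lane hb hr (hrq.trans hq.le)
  refine ⟨x, q, hx, by rw [hq, zero_add], hmem x (hxq.mem_of_inter hq_mem) hxq.fst_le,
    hmem q hq_mem le_rfl, ?_⟩
  exact (hxq.inter fun r _ hrq => hmem r (hrq.mem_of_inter hq_mem) hrq.fst_le).mono
    fun z hz => ⟨hz.1.1, hz.2⟩

-- A crossing at the larger scale only fails if the chains in two disjoint lanes both fail, which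
-- are independent events.
lemma failProb_le (hA : Admissible Q L h s) (p : ℝ) (m : ℕ) :
    failProb p ((m + 1) * (L - Q * h)) (3 * (Q * L)) (laneSlope Q L h s) ≤
      ((2 * m + 1 : ℕ) * failProb p L h s) ^ 2 := by
  set W : ℤ := (Q * L : ℕ) + 1 with hW
  have hW_abs : |W| ≤ Q * L + 1 := by
    rw [abs_of_nonneg (by positivity), hW]
    push_cast
    rfl
  set success : ℤ → Set Sample := fun b => {U | ChainCrossed (openSites p U) Q L h s m 0 b}
  have hmeas (b : ℤ) :
      MeasurableSet[sigmaSites (lane 0 b (Q * L) (laneSlope Q L h s))] (success b)ᶜ :=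
    (measurableSet_sigmaSites (hA.measurable_chainCrossed m fun _ hx =>
      measurable_mem_openSites_sigmaSites hx p)).compl
  have hindep := (Indep_iff _ _ _).1 (indep_sigmaSites (disjoint_lane (Q * L) (laneSlope Q L h s)))
    _ _ (hmeas W) (hmeas (-W))
  have hsub : {U | ¬ Crossed (openSites p U) 0 0 ((m + 1) * (L - Q * h)) (3 * (Q * L))
      (laneSlope Q L h s)} ⊆ (success W)ᶜ ∩ (success (-W))ᶜ := fun U hU =>
    ⟨fun hc => hU (hA.crossed_of_chainCrossed hW_abs hc),
      fun hc => hU (hA.crossed_of_chainCrossed (by rwa [abs_neg]) hc)⟩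
  refine ((measure_mono hsub).trans hindep.le).trans ?_
  rw [sq]
  exact mul_le_mul' (law_not_chainCrossed_le p m 0 W) (law_not_chainCrossed_le p m 0 (-W))

end Admissible

end

/-! ### Multi-scale iteration -/

/-- The dimensions and the slope of the tubes at one scale. -/
structure Scale where
  /-- The number of columns of a tube, minus one. -/
  length : ℕ
  /-- Half the vertical extent of a tube. -/
  width : ℕ
  slope : ℝ

/-- The tubes of scale `k + 1` contain two disjoint chains of `M * 2 ^ k` tubes of scale `k`. -/
noncomputable def Scale.next (Q M k : ℕ) (S : Scale) : Scale where
  length := M * 2 ^ k * (S.length - Q * S.width)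
  width := 3 * (Q * S.length)
  slope := laneSlope Q S.length S.width S.slope

/-- The sequence of scales starting from a given one. -/
noncomputable def scale (Q M : ℕ) (S : Scale) : ℕ → Scale
  | 0 => S
  | k + 1 => (scale Q M S k).next Q M k

/-- The constants of the iteration, for tubes of initial slope `s₀` and limiting slope above `t`. -/
structure ScaleConst (t s₀ ε : ℝ) (Q M : ℕ) : Prop where
  one_lt : 1 < t
  cross : 7 + 2 * s₀ ≤ (t - 1 / t) * Q
  wide : (s₀ + 3) ^ 2 ≤ Q
  pos : 0 < ε
  loss : 32 * ε ≤ s₀ - t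
  long : 2 * Q * ε ≤ 1
  ratio : 12 * (Q : ℝ) ≤ ε * M
  err : 8 * (Q : ℝ) ≤ (s₀ - t) * M
  four_le : 4 ≤ M

/-- The properties of the tubes of scale `k` that are preserved by the iteration. -/
structure ScaleInv (p t s₀ ε : ℝ) (M k : ℕ) (S : Scale) : Prop where
  pos : 1 ≤ S.width
  thin : (S.width : ℝ) * 2 ^ k ≤ ε * S.length
  steep : (t + s₀) / 2 + 16 * ε / 2 ^ k ≤ S.slope
  le : S.slope ≤ s₀
  fail : failProb p S.length S.width S.slope ≤ ENNReal.ofReal (1 / (64 * M ^ 2 * 16 ^ k))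

/-- The number of links of a chain of tubes of scale `k` that is at least as long as a tube
of scale `k + 2`. -/
def linkCount (M k : ℕ) : ℕ := M * 2 ^ k * (M * 2 ^ (k + 1)) - 1

section

variable {p t s₀ ε : ℝ} {Q M k : ℕ} {S : Scale}

lemma ScaleConst.M_pos (hC : ScaleConst t s₀ ε Q M) : 0 < M :=
  four_pos.trans_le hC.four_le

lemma exists_scaleConst (ht : 1 < t) (hs : t < s₀) :
    ∃ (ε : ℝ) (Q M : ℕ), ScaleConst t s₀ ε Q M := by
  have hgap : 0 < t - 1 / t := by
    rw [sub_pos, div_lt_iff₀ (by linarith)]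
    nlinarith
  have hgap' : 0 < s₀ - t := sub_pos.2 hs
  obtain ⟨Q, hQ⟩ := exists_nat_ge (max ((7 + 2 * s₀) / (t - 1 / t)) ((s₀ + 3) ^ 2))
  obtain ⟨hQ_cross, hQ_wide⟩ := max_le_iff.1 hQ
  have hQ_pos : (0 : ℝ) < Q := by nlinarith
  obtain ⟨ε, hε, hε_le⟩ : ∃ ε, 0 < ε ∧ ε ≤ min ((s₀ - t) / 32) (1 / (2 * Q)) :=
    ⟨_, lt_min (by positivity) (by positivity), le_rfl⟩
  obtain ⟨hε_loss, hε_long⟩ := le_min_iff.1 hε_le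
  obtain ⟨M, hM⟩ := exists_nat_ge (max (12 * Q / ε) (max (8 * Q / (s₀ - t)) 4))
  obtain ⟨hM_ratio, hM⟩ := max_le_iff.1 hM
  obtain ⟨hM_err, hM_four⟩ := max_le_iff.1 hM
  rw [div_le_iff₀ hgap] at hQ_cross
  rw [le_div_iff₀ (by positivity)] at hε_loss hε_long
  rw [div_le_iff₀ hε] at hM_ratio
  rw [div_le_iff₀ hgap'] at hM_err
  exact ⟨ε, Q, M, ht, by linarith, hQ_wide, hε, by linarith, by linarith, by linarith,
    by linarith, by exact_mod_cast hM_four⟩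

lemma linkCount_add_one (hM : 0 < M) (k : ℕ) :
    linkCount M k + 1 = M * 2 ^ k * (M * 2 ^ (k + 1)) :=
  Nat.sub_add_cancel (Nat.succ_le_of_lt (by positivity))

namespace ScaleInv

lemma admissible (hC : ScaleConst t s₀ ε Q M) (hI : ScaleInv p t s₀ ε M k S) :
    Admissible Q S.length S.width S.slope := by
  have ht := hC.one_lt
  have hloss := hC.loss
  have hε := hC.pos
  have hts : t ≤ S.slope := by
    have := hI.steep
    have : 0 ≤ 16 * ε / 2 ^ k := by positivity
    linarith
  have hle := hI.le
  refine ⟨by linarith, ?_, ?_, hI.pos, ?_⟩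
  · have hmono : t - 1 / t ≤ S.slope - 1 / S.slope := by
      have := one_div_le_one_div_of_le (by linarith) hts
      linarith
    have := mul_le_mul_of_nonneg_right hmono (Nat.cast_nonneg (α := ℝ) Q)
    have := hC.cross
    linarith
  · exact (pow_le_pow_left₀ (by linarith) (by linarith) 2).trans hC.wide
  · have hthin : (S.width : ℝ) ≤ ε * S.length :=
      (le_mul_of_one_le_right (by positivity) (one_le_pow₀ (by norm_num))).trans hI.thin
    have : 2 * (Q * (S.width : ℝ)) ≤ S.length :=
      calc 2 * (Q * (S.width : ℝ)) ≤ 2 * (Q * (ε * S.length)) := by gcongr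
        _ = 2 * Q * ε * S.length := by ring
        _ ≤ S.length := mul_le_of_le_one_left (by positivity) hC.long
    exact_mod_cast this

lemma next_thin (hC : ScaleConst t s₀ ε Q M) (hI : ScaleInv p t s₀ ε M k S) :
    ((S.next Q M k).width : ℝ) * 2 ^ (k + 1) ≤ ε * (S.next Q M k).length := by
  have hA := hI.admissible hC
  have hlength : (S.length : ℝ) ≤ 2 * strideX Q S.length S.width := by
    exact_mod_cast hA.length_le_strideX
  have hcast : (((M * 2 ^ k * (S.length - Q * S.width) : ℕ) : ℤ) : ℝ) =
      ((M * 2 ^ k : ℕ) : ℝ) * strideX Q S.length S.width := by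
    rw [hA.natCast_mul_sub]
    push_cast
    rfl
  rw [Int.cast_natCast] at hcast
  have hε := hC.pos
  calc ((3 * (Q * S.length) : ℕ) : ℝ) * 2 ^ (k + 1)
      = 2 ^ k / 2 * (12 * Q * S.length) := by push_cast; ring
    _ ≤ 2 ^ k / 2 * (ε * M * (2 * strideX Q S.length S.width)) := by
        refine mul_le_mul_of_nonneg_left ?_ (by positivity)
        exact mul_le_mul hC.ratio hlength (by positivity) (by positivity)
    _ = ε * ((M * 2 ^ k * (S.length - Q * S.width) : ℕ) : ℝ) := by
        rw [hcast]
        push_cast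
        ring

lemma slope_sub_le (hC : ScaleConst t s₀ ε Q M) (hI : ScaleInv p t s₀ ε M k S) :
    S.slope - (S.next Q M k).slope ≤ 8 * ε / 2 ^ k := by
  have hA := hI.admissible hC
  have hstride : (0 : ℝ) < strideX Q S.length S.width := by exact_mod_cast hA.strideX_pos
  have hlength : (S.length : ℝ) ≤ 2 * strideX Q S.length S.width := by
    exact_mod_cast hA.length_le_strideX
  have hε := hC.pos
  rw [le_div_iff₀ (by positivity)]
  refine le_of_mul_le_mul_right ?_ hstride
  calc (S.slope - laneSlope Q S.length S.width S.slope) * 2 ^ k * strideX Q S.length S.width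
      = (S.slope - laneSlope Q S.length S.width S.slope) * strideX Q S.length S.width * 2 ^ k := by
        ring
    _ ≤ 4 * S.width * 2 ^ k := mul_le_mul_of_nonneg_right hA.sub_laneSlope_mul_le (by positivity)
    _ = 4 * (S.width * 2 ^ k) := by ring
    _ ≤ 4 * (ε * (2 * strideX Q S.length S.width)) :=
        mul_le_mul_of_nonneg_left (hI.thin.trans (by gcongr)) (by norm_num)
    _ = 8 * ε * strideX Q S.length S.width := by ring

lemma next_fail (hC : ScaleConst t s₀ ε Q M) (hI : ScaleInv p t s₀ ε M k S) :
    failProb p (S.next Q M k).length (S.next Q M k).width (S.next Q M k).slope ≤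
      ENNReal.ofReal (1 / (64 * M ^ 2 * 16 ^ (k + 1))) := by
  have hM := hC.M_pos
  obtain ⟨m, hm⟩ := Nat.exists_eq_add_one.2 (by positivity : 0 < M * 2 ^ k)
  have hchain : ((2 * m + 1 : ℕ) : ENNReal) * failProb p S.length S.width S.slope ≤
      ENNReal.ofReal (2 * (M * 2 ^ k) * (1 / (64 * M ^ 2 * 16 ^ k))) := by
    rw [ENNReal.ofReal_mul (by positivity)]
    refine mul_le_mul' ?_ hI.fail
    rw [← ENNReal.ofReal_natCast]
    refine ENNReal.ofReal_le_ofReal ?_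
    have : 2 * m + 1 ≤ 2 * (M * 2 ^ k) := by omega
    exact_mod_cast this
  have hfail := (hI.admissible hC).failProb_le p m
  rw [← hm] at hfail
  refine hfail.trans ((pow_le_pow_left' hchain 2).trans ?_)
  rw [← ENNReal.ofReal_pow (by positivity)]
  refine ENNReal.ofReal_le_ofReal ?_
  have : (0 : ℝ) < M := by exact_mod_cast hM
  have hpow : (16 : ℝ) ^ k = (2 ^ k) ^ 4 := by rw [← pow_mul, mul_comm, pow_mul]; norm_num
  have hone : (1 : ℝ) ≤ 2 ^ k := one_le_pow₀ (by norm_num)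
  rw [pow_succ (16 : ℝ), hpow]
  generalize (2 : ℝ) ^ k = w at hone
  calc (2 * (M * w) * (1 / (64 * (M : ℝ) ^ 2 * w ^ 4))) ^ 2
      = 1 / (1024 * M ^ 2 * w ^ 6) := by field_simp; norm_num
    _ ≤ 1 / (1024 * M ^ 2 * w ^ 4) := by
        refine one_div_le_one_div_of_le (by positivity) ?_
        exact mul_le_mul_of_nonneg_left (pow_le_pow_right₀ hone (by norm_num)) (by positivity)
    _ = 1 / (64 * M ^ 2 * (w ^ 4 * 16)) := by ring

lemma next (hC : ScaleConst t s₀ ε Q M) (hI : ScaleInv p t s₀ ε M k S) :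
    ScaleInv p t s₀ ε M (k + 1) (S.next Q M k) where
  pos := by
    have hA := hI.admissible hC
    have := hA.length_le_mul
    have := hA.mul_le_length
    have := hA.pos
    change 1 ≤ 3 * (Q * S.length)
    omega
  thin := hI.next_thin hC
  steep := by
    have := hI.steep
    have := hI.slope_sub_le hC
    have : 16 * ε / 2 ^ (k + 1) = 16 * ε / 2 ^ k - 8 * ε / 2 ^ k := by
      rw [pow_succ]
      field_simp
      ring
    linarith
  le := (hI.admissible hC).laneSlope_le.trans hI.le
  fail := hI.next_fail hC

lemma iterate (hC : ScaleConst t s₀ ε Q M) (hI : ScaleInv p t s₀ ε M 0 S) (k : ℕ) :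
    ScaleInv p t s₀ ε M k (scale Q M S k) := by
  induction k with
  | zero => exact hI
  | succ k ih => exact ih.next hC

lemma mul_length_le (hC : ScaleConst t s₀ ε Q M) (hI : ScaleInv p t s₀ ε M k S) :
    M * 2 ^ k * S.length ≤ 2 * (S.next Q M k).length :=
  calc M * 2 ^ k * S.length ≤ M * 2 ^ k * (2 * (S.length - Q * S.width)) := by
        have := (hI.admissible hC).long
        gcongr
        omega
    _ = 2 * (M * 2 ^ k * (S.length - Q * S.width)) := by ring

lemma le_length_scale (hC : ScaleConst t s₀ ε Q M) (hI : ScaleInv p t s₀ ε M 0 S) (k : ℕ) :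
    k ≤ (scale Q M S k).length := by
  suffices k + 1 ≤ (scale Q M S k).length by omega
  induction k with
  | zero =>
    have hA := hI.admissible hC
    have := hA.mul_le_length
    have := hA.pos
    change 1 ≤ S.length
    omega
  | succ k ih =>
    have hgrow := (hI.iterate hC k).mul_length_le hC
    have : 4 * 1 * (scale Q M S k).length ≤ M * 2 ^ k * (scale Q M S k).length := by
      gcongr
      exacts [hC.four_le, Nat.one_le_two_pow]
    change k + 1 + 1 ≤ ((scale Q M S k).next Q M k).length
    omega

lemma law_not_chainCrossed_linkCount_le (hM : 0 < M) (hI : ScaleInv p t s₀ ε M k S) (a b : ℤ) :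
    law {U | ¬ ChainCrossed (openSites p U) Q S.length S.width S.slope (linkCount M k) a b} ≤
      ENNReal.ofReal (1 / 16 * (1 / 4) ^ k) := by
  refine (law_not_chainCrossed_le p (linkCount M k) a b).trans ?_
  refine (mul_le_mul' le_rfl hI.fail).trans ?_
  rw [← ENNReal.ofReal_natCast, ← ENNReal.ofReal_mul (by positivity)]
  refine ENNReal.ofReal_le_ofReal ?_
  have hcount : ((2 * linkCount M k + 1 : ℕ) : ℝ) ≤ 2 * (M * 2 ^ k * (M * 2 ^ (k + 1))) := by
    have := linkCount_add_one hM k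
    have : 2 * linkCount M k + 1 ≤ 2 * (M * 2 ^ k * (M * 2 ^ (k + 1))) := by omega
    exact_mod_cast this
  refine (mul_le_mul_of_nonneg_right hcount (by positivity)).trans_eq ?_
  have hM' : (M : ℝ) ≠ 0 := by positivity
  have hpow : (16 : ℝ) ^ k = (2 ^ k) ^ 4 := by rw [← pow_mul, mul_comm, pow_mul]; norm_num
  have hpow' : (1 / 4 : ℝ) ^ k = 1 / (2 ^ k) ^ 2 := by
    rw [← pow_mul, mul_comm, pow_mul, one_div_pow]
    norm_num
  rw [hpow, hpow', pow_succ]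
  field_simp
  norm_num

lemma ae_eventually_chainCrossed (hC : ScaleConst t s₀ ε Q M) (hI : ScaleInv p t s₀ ε M 0 S)
    (a : ℤ) (b : ℕ → ℤ) : ∀ᵐ U ∂law, ∀ᶠ k in atTop, ChainCrossed (openSites p U) Q
      (scale Q M S k).length (scale Q M S k).width (scale Q M S k).slope
      (linkCount M k) a (b k) := by
  have hM := hC.M_pos
  have hsum : Summable fun k : ℕ => (1 / 16 : ℝ) * (1 / 4) ^ k :=
    (summable_geometric_of_lt_one (by norm_num) (by norm_num)).mul_left _
  have hfinite : ∑' k : ℕ, ENNReal.ofReal (1 / 16 * (1 / 4) ^ k) ≠ ⊤ := by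
    rw [← ENNReal.ofReal_tsum_of_nonneg (fun _ => by positivity) hsum]
    exact ENNReal.ofReal_ne_top
  filter_upwards [ae_eventually_notMem (ne_top_of_le_ne_top hfinite
    (ENNReal.tsum_le_tsum fun k =>
      (hI.iterate hC k).law_not_chainCrossed_linkCount_le hM a (b k)))] with U hU
  filter_upwards [hU] with k hk using not_not.1 hk

end ScaleInv

lemma Admissible.le_edge_of_chainCrossed {L h : ℕ} {s : ℝ} (hA : Admissible Q L h s)
    {O : Set (ℤ × ℤ)} (hO : HasEdge O) {m n : ℕ} (hn : n ≤ (m + 1) * (L - Q * h))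
    (hc : ChainCrossed O Q L h s m 0 (-(Q * L : ℕ))) :
    laneSlope Q L h s * n - 2 * (Q * L) ≤ edge O 0 0 n := by
  obtain ⟨⟨_, y⟩, ⟨_, r⟩, rfl, hx, rfl, hq, hxq⟩ := hA.exists_reach_lane hc hn
  rw [zero_add] at hxq hq
  have hy : y ≤ 0 := by
    have hupp := (mem_tube.1 hx).2.2.2
    have : h ≤ Q * L := by
      have := hA.length_le_mul
      have := hA.mul_le_length
      omega
    have : (h : ℝ) ≤ Q * L := by exact_mod_cast this
    have : (y : ℝ) ≤ 0 := by
      push_cast at hupp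
      linarith
    exact_mod_cast this
  obtain ⟨z, hz, hzr, hmem⟩ := hxq.exists_mem_entries (E := Iic 0) hy (zero_add _).symm
  have hz_lane : ((n : ℤ), z) ∈ lane 0 (-(Q * L : ℕ)) (Q * L) (laneSlope Q L h s) := by
    rcases hzr.eq_or_lt with rfl | hzr
    · exact hq
    · exact (hmem z le_rfl hzr).2
  have hlow := (abs_le.1 hz_lane.2).1
  have hz_edge : (z : ℝ) ≤ edge O 0 0 n := by
    exact_mod_cast hO.le_edge (entries_mono inter_subset_left subset_rfl hz)
  push_cast at hlow
  simp only [sub_zero] at hlow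
  linarith

/-- The upper edge started at the origin rises at slope at least `t`, up to `K`. -/
def EdgeLowerBound (O : Set (ℤ × ℤ)) (t : ℝ) (K : ℕ) : Prop :=
  ∀ n : ℕ, t * n - K ≤ edge O 0 0 n

namespace ScaleInv

lemma mul_le_edge_of_chainCrossed (hC : ScaleConst t s₀ ε Q M) (hI : ScaleInv p t s₀ ε M k S)
    {O : Set (ℤ × ℤ)} (hO : HasEdge O)
    (hc : ChainCrossed O Q S.length S.width S.slope (linkCount M k) 0 (-(Q * S.length : ℕ)))
    {n : ℕ} (hn : (S.next Q M k).length ≤ n)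
    (hn' : n ≤ ((S.next Q M k).next Q M (k + 1)).length) : t * n ≤ edge O 0 0 n := by
  have hM := hC.M_pos
  have hε := hC.pos
  have hst : 0 ≤ s₀ - t := by have := hC.loss; linarith
  have hreach : n ≤ (linkCount M k + 1) * (S.length - Q * S.width) :=
    calc n ≤ M * 2 ^ (k + 1) * ((S.next Q M k).length - Q * (S.next Q M k).width) := hn'
      _ ≤ M * 2 ^ (k + 1) * (S.next Q M k).length := Nat.mul_le_mul_left _ (Nat.sub_le _ _)
      _ = (linkCount M k + 1) * (S.length - Q * S.width) := by
        rw [linkCount_add_one hM, Scale.next]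
        ring
  have hlow := (hI.admissible hC).le_edge_of_chainCrossed hO hreach hc
  have hlength : (M : ℝ) * S.length ≤ 2 * n := by
    have := hI.mul_length_le hC
    have : M * S.length ≤ M * 2 ^ k * S.length :=
      Nat.mul_le_mul_right _ (Nat.le_mul_of_pos_right _ (by positivity))
    have : M * S.length ≤ 2 * n := by omega
    exact_mod_cast this
  have herr : 2 * ((Q : ℝ) * S.length) ≤ (s₀ - t) / 2 * n := by
    have := mul_le_mul_of_nonneg_right hC.err (Nat.cast_nonneg (α := ℝ) S.length)
    have := mul_le_mul_of_nonneg_left hlength hst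
    linarith
  have hslope : (t + s₀) / 2 * n ≤ laneSlope Q S.length S.width S.slope * n := by
    gcongr
    have : 0 ≤ 16 * ε / 2 ^ (k + 1) := by positivity
    exact (le_add_of_nonneg_right this).trans (hI.next hC).steep
  linarith

-- If thin tubes are crossed with large enough probability at one scale, then by Borel–Cantelli the
-- chains of all large scales are crossed, and they bound the upper edge from below.
lemma ae_edgeLowerBound (hC : ScaleConst t s₀ ε Q M) (hI : ScaleInv p t s₀ ε M 0 S) (hp0 : 0 < p)
    (hp1 : p < 1) : ∀ᵐ U ∂law, ∃ K, EdgeLowerBound (openSites p U) t K := by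
  filter_upwards [hI.ae_eventually_chainCrossed hC 0
    fun k => -(Q * (scale Q M S k).length : ℕ), ae_hasEdge hp0 hp1] with U hU hedge
  obtain ⟨k₀, hk₀⟩ := eventually_atTop.1 hU
  have hlarge : ∀ n, (scale Q M S (k₀ + 1)).length ≤ n →
      t * n ≤ edge (openSites p U) 0 0 n := by
    intro n hn
    obtain ⟨j, hj, hjn, hnj⟩ := exists_le_le_succ_of_forall_le (hI.le_length_scale hC) hn
    obtain ⟨k, rfl⟩ : ∃ k, j = k + 1 := ⟨j - 1, by omega⟩
    exact (hI.iterate hC k).mul_le_edge_of_chainCrossed hC hedge (hk₀ k (by omega)) hjn hnj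
  obtain ⟨K, hK⟩ := (isBoundedUnder_of_eventually_le (a := 0)
    (f := atTop) (u := fun n : ℕ => t * n - edge (openSites p U) 0 0 n) (by
      filter_upwards [eventually_ge_atTop (scale Q M S (k₀ + 1)).length] with n hn
      exact sub_nonpos.2 (hlarge n hn))).bddAbove_range
  refine ⟨⌈K⌉₊, fun n => ?_⟩
  have := hK (mem_range_self n)
  have := Nat.le_ceil K
  linarith

end ScaleInv

end

/-! ### Thin tubes along the mean slope are crossed -/

section

variable {p : ℝ}

lemma measurableSet_edgeUpperBound (p r : ℝ) (K : ℕ) (x y : ℤ) :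
    MeasurableSet {U | EdgeUpperBound (openSites p U) r K x y} :=
  measurableSet_setOfPred.2 <| Measurable.forall fun n => measurableSet_setOfPred.1 <|
    measurableSet_le (measurable_edge_openSites_real p x y n) measurable_const

lemma law_not_edgeUpperBound (hp0 : 0 < p) (hp1 : p < 1) (r : ℝ) (K : ℕ) (x y : ℤ) :
    law {U | ¬ EdgeUpperBound (openSites p U) r K x y} =
      law {U | ¬ EdgeUpperBound (openSites p U) r K 0 0} := by
  rw [← law_reindex (Equiv.addRight ((x, y) : ℤ × ℤ))
    {U | ¬ EdgeUpperBound (openSites p U) r K 0 0}]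
  refine measure_congr ?_
  filter_upwards [ae_hasEdge hp0 hp1] with U hU
  refine propext (not_congr (forall_congr' fun n => ?_))
  have htranslate : edge (openSites p (reindex (Equiv.addRight ((x, y) : ℤ × ℤ)) U)) 0 0 n =
      edge (openSites p U) x y n - y := by
    rw [openSites_reindex]
    simpa using hU.edge_translate (a := 0) (b := 0) (n := n) (x, y)
  rw [htranslate]
  push_cast
  constructor <;> intro _ <;> linarith

lemma exists_law_not_edgeUpperBound_lt (hp0 : 0 < p) (hp1 : p < 1) {m : ℕ} (hm : 0 < m) {r : ℝ}
    (hr0 : 0 ≤ r) (hr : meanEdge p m < r * m) {δ : ENNReal} (hδ : 0 < δ) :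
    ∃ K : ℕ, ∀ x y : ℤ, law {U | ¬ EdgeUpperBound (openSites p U) r K x y} < δ := by
  set S : ℕ → Set Sample := fun K => {U | ¬ EdgeUpperBound (openSites p U) r K 0 0}
  have hanti : Antitone S := by
    intro K K' hK U hU hbound
    refine hU fun n => (hbound n).trans ?_
    gcongr
  have hnull : law (⋂ K, S K) = 0 := by
    refine measure_mono_null ?_ (ae_iff.1 (ae_edgeUpperBound hp0 hp1 hm hr0 hr))
    rintro U hU ⟨K, hK⟩
    exact mem_iInter.1 hU K hK
  have hmeas (K : ℕ) : NullMeasurableSet (S K) law :=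
    (measurableSet_edgeUpperBound p r K 0 0).compl.nullMeasurableSet
  have hlim := tendsto_measure_iInter_atTop hmeas hanti ⟨0, measure_ne_top _ _⟩
  rw [hnull] at hlim
  obtain ⟨K, hK⟩ := (hlim.eventually (gt_mem_nhds hδ)).exists
  exact ⟨K, fun x y => (law_not_edgeUpperBound hp0 hp1 r K x y).trans_lt hK⟩

lemma integrable_blockEdge (hp0 : 0 < p) (hp1 : p < 1) (m : ℕ) (a b : ℤ) (j : ℕ) :
    Integrable (fun U => (blockEdge (openSites p U) m a b j : ℝ)) law := by
  have hsum : Integrable (fun U => ∑ i ∈ Finset.range j, blockIncr p m a b i U + b) law :=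
    (integrable_finsetSum _ fun i _ => integrable_blockIncr hp0 hp1 m a b i).add
      (integrable_const _)
  simpa only [sum_blockIncr, sub_add_cancel] using hsum

lemma integral_blockEdge (hp0 : 0 < p) (hp1 : p < 1) (m : ℕ) (a b : ℤ) (j : ℕ) :
    ∫ U, (blockEdge (openSites p U) m a b j : ℝ) ∂law = j * meanEdge p m + b := by
  have hsum : ∫ U, ∑ i ∈ Finset.range j, blockIncr p m a b i U ∂law = j * meanEdge p m := by
    rw [integral_finsetSum _ fun i _ => integrable_blockIncr hp0 hp1 m a b i]
    simp only [integral_blockIncr hp0 hp1, Finset.sum_const, Finset.card_range, nsmul_eq_mul]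
  simp only [sum_blockIncr] at hsum
  rw [integral_sub (integrable_blockEdge hp0 hp1 m a b j) (integrable_const _)] at hsum
  simp only [integral_const, probReal_univ, one_smul] at hsum
  linarith

lemma eventually_law_blockEdge_lt (hp0 : 0 < p) (hp1 : p < 1) {m : ℕ} {r : ℝ}
    (hr : r < meanEdge p m) {δ : ENNReal} (hδ : 0 < δ) :
    ∀ᶠ j : ℕ in atTop, law {U | (blockEdge (openSites p U) m 0 0 j : ℝ) < r * j} < δ := by
  have hmeas (j : ℕ) : AEStronglyMeasurable
      (fun U => ((blockEdge (openSites p U) m 0 0 j : ℝ) - (0 : ℤ)) / j) law :=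
    (((integrable_blockEdge hp0 hp1 m 0 0 j).sub (integrable_const _)).div_const _).1
  have hlim := tendstoInMeasure_iff_dist.1
    (tendstoInMeasure_of_tendsto_ae hmeas (ae_tendsto_blockEdge_div hp0 hp1 m 0 0)) _
    (sub_pos.2 hr)
  filter_upwards [hlim.eventually (gt_mem_nhds hδ), eventually_gt_atTop 0] with j hj hj0
  refine (measure_mono fun U hU => ?_).trans_lt hj
  rw [mem_ofPred_eq] at hU
  have hdiv : ((blockEdge (openSites p U) m 0 0 j : ℝ) - (0 : ℤ)) / j < r := by
    rwa [div_lt_iff₀ (Nat.cast_pos.2 hj0), Int.cast_zero, sub_zero]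
  rw [mem_ofPred_eq, dist_comm, Real.dist_eq]
  exact (sub_le_sub_left hdiv.le _).trans (le_abs_self _)

lemma law_le_blockEdge_sub_edge (hp0 : 0 < p) (hp1 : p < 1) (m j : ℕ) {c : ℝ} (hc : 0 < c) :
    law {U | c ≤ (blockEdge (openSites p U) m 0 0 j : ℝ) - edge (openSites p U) 0 0 (m * j)} ≤
      ENNReal.ofReal ((j * meanEdge p m - meanEdge p (m * j)) / c) := by
  have hblock := integrable_blockEdge hp0 hp1 m 0 0 j
  have hedge := integrable_edge hp0 hp1 (m * j)
  have hnonneg : 0 ≤ᵐ[law] fun U =>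
      (blockEdge (openSites p U) m 0 0 j : ℝ) - edge (openSites p U) 0 0 (m * j) := by
    filter_upwards [ae_hasEdge hp0 hp1] with U hU
    exact sub_nonneg.2 (Int.cast_le.2 (hU.edge_le_blockEdge m 0 0 j))
  have hmarkov := mul_meas_ge_le_integral_of_nonneg hnonneg (hblock.sub hedge) c
  rw [integral_sub hblock hedge, integral_blockEdge hp0 hp1, Int.cast_zero, add_zero,
    mul_comm, ← le_div_iff₀ hc] at hmarkov
  exact ENNReal.le_ofReal_iff_toReal_le (measure_ne_top _ _) (measureReal_nonneg.trans hmarkov)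
    |>.2 hmarkov

-- The restarted edge dominates the edge and has nearly the same mean when `m` is large, so by
-- Markov's inequality the two are close; the restarted edge obeys the law of large numbers.
lemma exists_eventually_law_edge_lt (hp0 : 0 < p) (hp1 : p < 1) {a : ℝ}
    (ha : ∀ n : ℕ, a * n ≤ meanEdge p n)
    (hlim : ∀ ε > 0, ∃ m : ℕ, 0 < m ∧ meanEdge p m < (a + ε) * m) {ε δ : ℝ} (hε : 0 < ε)
    (hδ : 0 < δ) :
    ∃ m : ℕ, 0 < m ∧ ∀ᶠ j : ℕ in atTop,
      law {U | (edge (openSites p U) 0 0 (m * j) : ℝ) < (a - ε) * (m * j : ℕ)} <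
        ENNReal.ofReal δ := by
  obtain ⟨m, hm, hmean⟩ := hlim (ε * δ / 4) (by positivity)
  have : (0 : ℝ) < m := Nat.cast_pos.2 hm
  have hslope : (a - ε / 2) * m < meanEdge p m := lt_of_lt_of_le (by gcongr; linarith) (ha m)
  refine ⟨m, hm, ?_⟩
  filter_upwards [eventually_law_blockEdge_lt hp0 hp1 hslope (ENNReal.ofReal_pos.2 (half_pos hδ)),
    eventually_gt_atTop 0] with j hblock hj
  have hj0 : (0 : ℝ) < j := Nat.cast_pos.2 hj
  have hmarkov := law_le_blockEdge_sub_edge hp0 hp1 m j (c := ε / 2 * (m * j)) (by positivity)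
  have hratio : (j * meanEdge p m - meanEdge p (m * j)) / (ε / 2 * (m * j)) ≤ δ / 2 := by
    rw [div_le_iff₀ (by positivity)]
    have hmeanj := mul_le_mul_of_nonneg_left hmean.le hj0.le
    have hmj := ha (m * j)
    push_cast at hmj
    linarith
  have hsub : {U | (edge (openSites p U) 0 0 (m * j) : ℝ) < (a - ε) * (m * j : ℕ)} ⊆
      {U | (blockEdge (openSites p U) m 0 0 j : ℝ) < (a - ε / 2) * m * j} ∪
        {U | ε / 2 * (m * j) ≤
          (blockEdge (openSites p U) m 0 0 j : ℝ) - edge (openSites p U) 0 0 (m * j)} := by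
    intro U hU
    rw [mem_ofPred_eq] at hU
    rcases lt_or_ge (blockEdge (openSites p U) m 0 0 j : ℝ) ((a - ε / 2) * m * j) with hlt | hge
    · exact .inl hlt
    · right
      rw [mem_ofPred_eq]
      push_cast at hU
      linarith
  calc law _ ≤ _ := (measure_mono hsub).trans (measure_union_le _ _)
    _ < ENNReal.ofReal (δ / 2) + ENNReal.ofReal (δ / 2) :=
      ENNReal.add_lt_add_of_lt_of_le ((hmarkov.trans_lt ENNReal.ofReal_lt_top).ne) hblock
        (hmarkov.trans (ENNReal.ofReal_le_ofReal hratio))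
    _ = ENNReal.ofReal δ := by
      rw [← ENNReal.ofReal_add (half_pos hδ).le (half_pos hδ).le, add_halves]

end

section

variable {O : Set (ℤ × ℤ)} {a ε H : ℝ} {K : ℕ}

lemma HasEdge.le_of_reach_top (hO : HasEdge O) (ha : 0 ≤ a) (hε : 0 ≤ ε) {n N : ℕ}
    (hH : 2 * ε * N + (a + ε) + K + 1 ≤ H) (hbound : EdgeUpperBound O (a + ε) K n ⌊a * n - H⌋)
    {y top : ℤ} (htop : (a - ε) * N ≤ top) (hreach : Reach O ((n : ℤ), y) ((N : ℤ), top)) :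
    a * n - H ≤ y := by
  by_contra! hlt
  have hrise := hO.reach_le_of_edgeUpperBound (by linarith) hbound (Int.le_floor.2 hlt.le) hreach
  have hfloor := Int.floor_le (a * n - H)
  have hεn : 0 ≤ ε * n := by positivity
  push_cast at hrise
  linarith

-- The path to the upper edge of column `J * D` stays in a thin tube: it cannot rise too fast from
-- its start, and at each checkpoint column `j * D` it cannot be so low that the remaining rise
-- would be too fast.
lemma HasEdge.crossed_of_edgeUpperBound (hO : HasEdge O) (ha : 0 ≤ a) (hε : 0 ≤ ε) {J D h : ℕ}
    (hD : 0 < D) (hH : 2 * ε * (J * D : ℕ) + (a + ε) + K + 1 ≤ H) (hh : a * D + H ≤ h)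
    (htop : (a - ε) * (J * D : ℕ) ≤ edge O 0 0 (J * D)) (hstart : EdgeUpperBound O (a + ε) K 0 0)
    (hcheck : ∀ j ≤ J, EdgeUpperBound O (a + ε) K (j * D : ℕ) ⌊a * (j * D : ℕ) - H⌋) :
    Crossed O 0 0 (J * D) h a := by
  obtain ⟨e, he, hr⟩ := exists_reach_of_mem_entries (hO.edge_mem (a := 0) (b := 0) (n := J * D))
  have he : e ≤ 0 := he
  rw [zero_add] at hr
  have htube (q : ℤ × ℤ) (hstartq : Reach O (0, e) q)
      (hqtop : Reach O q ((J * D : ℕ), edge O 0 0 (J * D))) : q ∈ tube 0 0 (J * D) h a := by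
    obtain ⟨x, y⟩ := q
    obtain ⟨c, rfl : x = c⟩ := Int.eq_ofNat_of_zero_le hstartq.fst_le
    have hcN : c ≤ J * D := Int.ofNat_le.1 hqtop.fst_le
    have hcN' : (c : ℝ) ≤ (J * D : ℕ) := Nat.cast_le.2 hcN
    have hlower : a * c - h ≤ y := by
      set j := c / D
      have hjD : j * D ≤ c := Nat.div_mul_le_self c D
      obtain ⟨⟨x', y'⟩, rfl : x' = _, -, hgq⟩ := hstartq.exists_fst_eq
        (c := ((j * D : ℕ) : ℤ)) (Int.natCast_nonneg _) (Int.ofNat_le.2 hjD)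
      have hlow := hO.le_of_reach_top ha hε hH
        (hcheck j (Nat.le_of_mul_le_mul_right (hjD.trans hcN) hD)) htop (hgq.trans hqtop)
      have hy : (y' : ℝ) ≤ y := Int.cast_le.2 hgq.snd_le
      have hc : (c : ℝ) ≤ (j * D : ℕ) + D := by
        exact_mod_cast (Nat.lt_div_mul_add hD (a := c)).le
      have := mul_le_mul_of_nonneg_left hc ha
      linarith
    have hupper : (y : ℝ) ≤ a * c + h := by
      have hrise := hO.reach_le_of_edgeUpperBound (by linarith) hstart he hstartq
      have := mul_le_mul_of_nonneg_left hcN' hε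
      have : 0 ≤ a * (D : ℝ) := by positivity
      have : 0 ≤ ε * c := by positivity
      push_cast at hrise
      linarith
    refine mem_tube.2 ⟨hstartq.fst_le, ?_, ?_, ?_⟩
    · simpa using hqtop.fst_le
    · simpa using hlower
    · simpa using hupper
  refine ⟨(0, e), ((J * D : ℕ), edge O 0 0 (J * D)), rfl, (zero_add _).symm, htube _ (.refl _) hr,
    htube _ hr (.refl _), hr.inter htube⟩

end

section

variable {p a : ℝ}

lemma failProb_le_law_edge_lt_add (hp0 : 0 < p) (hp1 : p < 1) (ha : 0 ≤ a) {ε H : ℝ} (hε : 0 ≤ ε)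
    {J D h K : ℕ} (hD : 0 < D) (hH : 2 * ε * (J * D : ℕ) + (a + ε) + K + 1 ≤ H)
    (hh : a * D + H ≤ h) {γ : ENNReal}
    (hK : ∀ x y : ℤ, law {U | ¬ EdgeUpperBound (openSites p U) (a + ε) K x y} ≤ γ) :
    failProb p (J * D) h a ≤
      law {U | (edge (openSites p U) 0 0 (J * D) : ℝ) < (a - ε) * (J * D : ℕ)} +
        (J + 2 : ℕ) * γ := by
  set low := {U | (edge (openSites p U) 0 0 (J * D) : ℝ) < (a - ε) * (J * D : ℕ)}
  set start := {U | ¬ EdgeUpperBound (openSites p U) (a + ε) K 0 0}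
  set check : ℕ → Set Sample := fun j =>
    {U | ¬ EdgeUpperBound (openSites p U) (a + ε) K (j * D : ℕ) ⌊a * (j * D : ℕ) - H⌋}
  have hsub : failProb p (J * D) h a ≤
      law (low ∪ (start ∪ ⋃ j ∈ Finset.range (J + 1), check j)) := by
    refine measure_mono_ae ?_
    filter_upwards [ae_hasEdge hp0 hp1] with U hU hcross
    by_contra hgood
    have hgood : U ∉ low ∪ (start ∪ ⋃ j ∈ Finset.range (J + 1), check j) := hgood
    simp only [mem_union, mem_iUnion, Finset.mem_range, not_or, not_exists] at hgood
    obtain ⟨hlow, hstart, hcheck⟩ := hgood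
    exact hcross (hU.crossed_of_edgeUpperBound ha hε hD hH hh (not_lt.1 hlow) (not_not.1 hstart)
      fun j hj => not_not.1 (hcheck j (Nat.lt_succ_of_le hj)))
  have hcheck : law (⋃ j ∈ Finset.range (J + 1), check j) ≤ (J + 1 : ℕ) * γ := by
    refine (measure_biUnion_finset_le _ _).trans ?_
    refine (Finset.sum_le_card_nsmul _ _ _ fun j _ => hK _ _).trans_eq ?_
    rw [Finset.card_range, nsmul_eq_mul]
  calc failProb p (J * D) h a
      ≤ law low + (law start + law (⋃ j ∈ Finset.range (J + 1), check j)) :=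
        hsub.trans <| (measure_union_le _ _).trans (by gcongr; exact measure_union_le _ _)
    _ ≤ law low + (γ + (J + 1 : ℕ) * γ) := by gcongr; exact hK 0 0
    _ = law low + (J + 2 : ℕ) * γ := by push_cast; ring

lemma eventually_natCeil_le {η C J : ℝ} (hη : 0 < η) (ha : 0 ≤ a) (hC : 0 ≤ C) (hJ1 : 1 ≤ J)
    (hJ : 4 * a / η ≤ J) :
    ∀ᶠ D : ℕ in atTop, (⌈a * D + (η / 4 * (J * D) + C)⌉₊ : ℝ) ≤ η * (J * D) := by
  filter_upwards [(tendsto_natCast_atTop_atTop (R := ℝ)).eventually_ge_atTop (2 * (C + 1) / η)]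
    with D hD
  rw [div_le_iff₀ hη] at hD hJ
  have hceil := Nat.ceil_lt_add_one (by positivity : 0 ≤ a * D + (η / 4 * (J * D) + C))
  have haD := mul_le_mul_of_nonneg_right hJ D.cast_nonneg
  have hηD := mul_le_mul_of_nonneg_left (le_mul_of_one_le_left D.cast_nonneg hJ1) hη.le
  linarith

lemma exists_failProb_le (hp0 : 0 < p) (hp1 : p < 1) (ha0 : 0 ≤ a)
    (ha : ∀ n : ℕ, a * n ≤ meanEdge p n)
    (hlim : ∀ ε > 0, ∃ m : ℕ, 0 < m ∧ meanEdge p m < (a + ε) * m) {η δ : ℝ} (hη : 0 < η)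
    (hδ : 0 < δ) :
    ∃ L h : ℕ, 1 ≤ h ∧ (h : ℝ) ≤ η * L ∧ failProb p L h a < ENNReal.ofReal δ := by
  set ε := η / 8 with hε
  have hε0 : 0 < ε := by positivity
  obtain ⟨J, hJ⟩ := exists_nat_ge (max (4 * a / η) 1)
  obtain ⟨hJa, hJ1⟩ := max_le_iff.1 hJ
  have hJ0 : 0 < J := by exact_mod_cast one_pos.trans_le hJ1
  set γ := ENNReal.ofReal (δ / (2 * (J + 2)))
  obtain ⟨m₀, hm₀, hmean⟩ := hlim ε hε0
  obtain ⟨K, hK⟩ := exists_law_not_edgeUpperBound_lt hp0 hp1 hm₀ (by linarith : 0 ≤ a + ε) hmean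
    (δ := γ) (ENNReal.ofReal_pos.2 (by positivity))
  obtain ⟨m, hm, hlow⟩ := exists_eventually_law_edge_lt hp0 hp1 ha hlim hε0 (half_pos hδ)
  set C : ℝ := a + ε + K + 1 with hC
  have hceil := eventually_natCeil_le hη ha0 (by positivity : 0 ≤ C) hJ1 hJa
  obtain ⟨d, hd0, hdlow, hdceil⟩ := ((eventually_gt_atTop 0).and
    (((tendsto_id.const_mul_atTop' hJ0).eventually hlow).and
      ((tendsto_id.const_mul_atTop' hm).eventually hceil))).exists
  simp only [id_eq] at hdlow hdceil
  set D := m * d with hD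
  set h := ⌈a * D + (η / 4 * (J * D) + C)⌉₊
  have hdlow : law {U | (edge (openSites p U) 0 0 (J * D) : ℝ) < (a - ε) * (J * D : ℕ)} <
      ENNReal.ofReal (δ / 2) := by rwa [hD, mul_left_comm]
  refine ⟨J * D, h, Nat.one_le_ceil_iff.2 (by positivity), by exact_mod_cast hdceil, ?_⟩
  refine (failProb_le_law_edge_lt_add hp0 hp1 ha0 hε0.le (Nat.mul_pos hm hd0)
    (H := η / 4 * (J * D) + C) ?_ (Nat.le_ceil _) fun x y => (hK x y).le).trans_lt ?_
  · rw [hε, hC, hD]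
    push_cast
    linarith
  have hunion : ((J + 2 : ℕ) : ENNReal) * γ = ENNReal.ofReal (δ / 2) := by
    rw [← ENNReal.ofReal_natCast, ← ENNReal.ofReal_mul (by positivity)]
    congr 1
    push_cast
    field_simp
  rw [hunion, ← add_halves δ, ENNReal.ofReal_add (half_pos hδ).le (half_pos hδ).le, add_halves δ]
  exact ENNReal.add_lt_add_right ENNReal.ofReal_ne_top hdlow

end

/-! ### Infinite clusters -/

lemma infinite_preimage_equiv {α β : Type*} (e : α ≃ β) {s : Set β} :
    (e ⁻¹' s).Infinite ↔ s.Infinite := by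
  rw [← e.image_symm_eq_preimage, infinite_image_iff e.symm.injective.injOn]

section

variable {O : Set (ℤ × ℤ)}

/-- The sites that can be reached from `x`. -/
def reachSet (O : Set (ℤ × ℤ)) (x : ℤ × ℤ) : Set (ℤ × ℤ) := {y | Reach O x y}

lemma reachSet_transpose (x : ℤ × ℤ) :
    reachSet (transpose O) x = Prod.swap ⁻¹' reachSet O x.swap :=
  Set.ext fun _ => reach_transpose

lemma infinite_reachSet_transpose {x : ℤ × ℤ} :
    (reachSet (transpose O) x).Infinite ↔ (reachSet O x.swap).Infinite := by
  rw [reachSet_transpose]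
  exact infinite_preimage_equiv (Equiv.prodComm ℤ ℤ)

lemma infinite_reachSet_translate (z : ℤ × ℤ) {x : ℤ × ℤ} :
    (reachSet ((fun w => w + z) ⁻¹' O) x).Infinite ↔ (reachSet O (x + z)).Infinite := by
  rw [show reachSet ((fun w => w + z) ⁻¹' O) x = Equiv.addRight z ⁻¹' reachSet O (x + z) from
    Set.ext fun _ => reach_translate z]
  exact infinite_preimage_equiv _

lemma HasEdge.exists_reach_last (hO : HasEdge O) {m n : ℕ} (hmn : m ≤ n) :
    ∃ g j : ℤ, g ≤ max (edge O 0 0 m) (edge O 0 0 (m + 1)) ∧ Reach O (m, g) (n, j) ∧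
      ((n : ℤ), j) ∈ O ∧ edge O 0 0 (n + 1) ≤ j + 1 := by
  obtain ⟨e, he, j, hreach, hj, hedge⟩ :=
    exists_last_of_mem_entries_succ (hO.edge_mem (a := 0) (b := 0) (n := n + 1))
  rw [zero_add] at hreach hj
  obtain ⟨⟨_, g⟩, rfl, hg, hgj⟩ :=
    hreach.exists_fst_eq (c := m) (Int.natCast_nonneg m) (Int.ofNat_le.2 hmn)
  exact ⟨g, j, hO.reach_le he hg (zero_add _).symm, hgj, hj, by omega⟩

lemma HasEdge.exists_reach_of_le_edge_transpose (hO : HasEdge (transpose O)) {m n k : ℕ}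
    (hmn : m ≤ n) (hnk : (n : ℤ) ≤ edge (transpose O) 0 0 k) :
    ∃ g v : ℤ, 0 ≤ g ∧ Reach O (m, g) (n, v) ∧ v ≤ k := by
  obtain ⟨e, he, hreach⟩ :=
    exists_reach_of_mem_entries (hO.edge_mem (a := 0) (b := 0) (n := k))
  have he : e ≤ 0 := he
  rw [zero_add] at hreach
  have hreach : Reach O (e, 0) (edge (transpose O) 0 0 k, k) := reach_transpose.1 hreach
  obtain ⟨⟨_, v⟩, rfl, hv, hvk⟩ :=
    hreach.exists_fst_eq (c := n) (he.trans (Int.natCast_nonneg n)) hnk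
  obtain ⟨⟨_, g⟩, rfl, hg, hgv⟩ :=
    hv.exists_fst_eq (c := m) (he.trans (Int.natCast_nonneg m)) (Int.ofNat_le.2 hmn)
  exact ⟨g, v, hg.snd_le, hgv, hvk.snd_le⟩

lemma EdgeLowerBound.exists_le_edge {t : ℝ} {K : ℕ} (h : EdgeLowerBound O t K) (ht : 1 ≤ t)
    (n : ℕ) : ∃ k : ℕ, (n : ℤ) ≤ edge O 0 0 k ∧ (k : ℝ) ≤ t⁻¹ * n + (K + 1) := by
  have ht0 : 0 < t := one_pos.trans_le ht
  have hceil := Nat.le_ceil ((n + K) / t)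
  have hceil' := Nat.ceil_lt_add_one (by positivity : 0 ≤ (n + K) / t)
  refine ⟨⌈(n + K) / t⌉₊, ?_, ?_⟩
  · rw [div_le_iff₀ ht0] at hceil
    have hn : (n : ℝ) ≤ edge O 0 0 ⌈(n + K) / t⌉₊ := by linarith [h ⌈(n + K) / t⌉₊]
    exact_mod_cast hn
  · have hsplit : (n + K) / t = t⁻¹ * n + K / t := by rw [add_div, div_eq_inv_mul]
    have hK : K / t ≤ K := div_le_self K.cast_nonneg ht
    linarith

lemma HasEdge.exists_forall_reach_le_edge (hO : HasEdge (transpose O)) {t : ℝ} (ht : 1 < t)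
    {J K : ℕ} (hJ : EdgeLowerBound O t J) (hK : EdgeLowerBound (transpose O) t K) :
    ∃ m : ℕ, ∀ n : ℕ, m ≤ n →
      ∃ g v : ℤ, 0 ≤ g ∧ Reach O (m, g) (n, v) ∧ v ≤ edge O 0 0 n := by
  have hgap : 0 < t - t⁻¹ := sub_pos.2 ((inv_lt_one_of_one_lt₀ ht).trans ht)
  obtain ⟨m, hm⟩ := exists_nat_ge ((J + K + 1) / (t - t⁻¹))
  rw [div_le_iff₀ hgap] at hm
  refine ⟨m, fun n hmn => ?_⟩
  obtain ⟨k, hnk, hk⟩ := hK.exists_le_edge ht.le n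
  obtain ⟨g, v, hg, hgv, hvk⟩ := hO.exists_reach_of_le_edge_transpose hmn hnk
  refine ⟨g, v, hg, hgv, hvk.trans ?_⟩
  have hmn' := mul_le_mul_of_nonneg_right (Nat.cast_le.2 hmn : (m : ℝ) ≤ n) hgap.le
  have hkedge : (k : ℝ) ≤ edge O 0 0 n := by linarith [hJ n]
  exact_mod_cast hkedge

-- A path that starts in the window of column `m` is continued to the next column along the given
-- upper path if it lies below its end, and along the given lower path if it lies above: planarity
-- makes the paths cross.
lemma exists_reach_of_crossing {m : ℕ} {hi : ℤ} (hhi : 0 ≤ hi)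
    (hstep : ∀ n : ℕ, m ≤ n → ∃ g j g' v : ℤ,
      (g ≤ hi ∧ Reach O (m, g) (n, j) ∧ ((n : ℤ), j) ∈ O) ∧
      (0 ≤ g' ∧ Reach O (m, g') ((n + 1 : ℕ), v)) ∧ v ≤ j + 1) {n : ℕ} (hmn : m ≤ n) :
    ∃ f ∈ Icc 0 hi, ∃ c, Reach O (m, f) (n, c) := by
  induction n, hmn using Nat.le_induction with
  | base => exact ⟨0, ⟨le_rfl, hhi⟩, 0, .refl _⟩
  | succ n hmn ih =>
    obtain ⟨f, hf, c, hfc⟩ := ih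
    obtain ⟨g, j, g', v, ⟨hg, hgj, hj⟩, ⟨hg', hgv⟩, hvj⟩ := hstep n hmn
    have hright : Reach O (n, j) ((n + 1 : ℕ), j) := Step.reach ⟨hj, by simp⟩
    rcases le_or_gt 0 g with hg0 | hg0
    · exact ⟨g, ⟨hg0, hg⟩, j, hgj.trans hright⟩
    rcases le_or_gt c j with hcj | hjc
    · exact ⟨f, hf, j, (hgj.cross_right hfc rfl rfl (hg0.le.trans hf.1) hcj).trans hright⟩
    rcases le_or_gt g' hi with hg'hi | hhig'
    · exact ⟨g', ⟨hg', hg'hi⟩, v, hgv⟩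
    · obtain ⟨⟨_, w⟩, rfl, hgw, hwv⟩ :=
        hgv.exists_fst_eq (c := n) (Int.ofNat_le.2 hmn) (Int.ofNat_le.2 n.le_succ)
      have hwv_le : w ≤ v := hwv.snd_le
      have hwc : w ≤ c := by omega
      exact ⟨f, hf, v, (hfc.cross_left hgw rfl rfl (hf.2.trans hhig'.le) hwc).trans hwv⟩

lemma exists_infinite_reachSet_of_forall_reach {m : ℕ} {S : Set ℤ} (hS : S.Finite)
    (h : ∀ n : ℕ, m ≤ n → ∃ f ∈ S, ∃ c : ℤ, Reach O (m, f) (n, c)) :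
    ∃ x, (reachSet O x).Infinite := by
  by_contra! hfin
  have hunion : (⋃ f ∈ S, reachSet O (m, f)).Finite :=
    hS.biUnion fun f _ => hfin _
  obtain ⟨B, hB⟩ := (hunion.image Prod.fst).bddAbove
  obtain ⟨f, hf, c, hfc⟩ := h (max m (B.toNat + 1)) (le_max_left _ _)
  have hle := hB ⟨_, mem_biUnion (t := fun f => reachSet O ((m : ℤ), f)) hf hfc, rfl⟩
  have := Int.self_le_toNat B
  omega

lemma HasEdge.exists_infinite_reachSet (hO : HasEdge O) (hO' : HasEdge (transpose O)) {t : ℝ}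
    (ht : 1 < t) {J K : ℕ} (hJ : EdgeLowerBound O t J) (hK : EdgeLowerBound (transpose O) t K) :
    ∃ x, (reachSet O x).Infinite := by
  obtain ⟨m, hlower⟩ := hO'.exists_forall_reach_le_edge ht hJ hK
  refine exists_infinite_reachSet_of_forall_reach (m := m) (finite_Icc _ _) fun n hmn =>
    exists_reach_of_crossing (hi := max 0 (max (edge O 0 0 m) (edge O 0 0 (m + 1))))
      (le_max_left _ _) (fun n hmn => ?_) hmn
  obtain ⟨g, j, hg, hgj, hj, hedge⟩ := hO.exists_reach_last hmn
  obtain ⟨g', v, hg', hgv, hv⟩ := hlower (n + 1) (hmn.trans n.le_succ)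
  exact ⟨g, j, g', v, ⟨le_max_of_le_right hg, hgj, hj⟩, ⟨hg', hgv⟩, hv.trans hedge⟩

lemma HasEdge.exists_mem_reachSet_column (hO : HasEdge O)
    (hinf : (reachSet O (0, 0)).Infinite) (n : ℕ) :
    ∃ y : ℤ, ((n : ℤ), y) ∈ reachSet O (0, 0) := by
  by_contra! hcol
  have hcolumns : (⋃ k ∈ Finset.range n, (fun y : ℤ => ((k : ℤ), y)) ''
      Icc 0 (max (edge O 0 0 k) (edge O 0 0 (k + 1)))).Finite :=
    (Finset.range n).finite_toSet.biUnion fun k _ => (finite_Icc _ _).image _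
  refine hinf (hcolumns.subset ?_)
  rintro ⟨a, b⟩ hab
  obtain ⟨k, rfl : a = k⟩ := Int.eq_ofNat_of_zero_le (Reach.fst_le hab)
  have hkn : k < n := by
    by_contra! hnk
    obtain ⟨⟨_, y⟩, rfl, hy, -⟩ :=
      Reach.exists_fst_eq hab (c := n) (Int.natCast_nonneg n) (Int.ofNat_le.2 hnk)
    exact hcol y hy
  exact mem_biUnion (x := k) (Finset.mem_range.2 hkn)
    ⟨b, ⟨Reach.snd_le hab, hO.reach_le le_rfl hab (zero_add _).symm⟩, rfl⟩

lemma HasEdge.exists_mem_reachSet_edge_le (hO : HasEdge O)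
    (hinf : (reachSet O (0, 0)).Infinite) (n : ℕ) :
    ∃ y : ℤ, ((n : ℤ), y) ∈ reachSet O (0, 0) ∧ edge O 0 0 n ≤ y := by
  obtain ⟨c, hc⟩ := hO.exists_mem_reachSet_column hinf n
  rcases le_total (edge O 0 0 n) c with hle | hle
  · exact ⟨c, hc, hle⟩
  · obtain ⟨e, he, hreach⟩ :=
      exists_reach_of_mem_entries (hO.edge_mem (a := 0) (b := 0) (n := n))
    rw [zero_add] at hreach
    exact ⟨_, hreach.cross_right hc rfl rfl he hle, le_rfl⟩

lemma HasEdge.finite_reachSet (hO : HasEdge O) (hO' : HasEdge (transpose O)) {r : ℝ} (hr0 : 0 ≤ r)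
    (hr1 : r < 1) {J K : ℕ} (hJ : EdgeUpperBound O r J 0 0)
    (hK : EdgeUpperBound (transpose O) r K 0 0) : (reachSet O (0, 0)).Finite := by
  by_contra hinf
  obtain ⟨n, hn⟩ := exists_nat_gt ((r + J + (r + K)) / (1 - r))
  rw [div_lt_iff₀ (sub_pos.2 hr1)] at hn
  obtain ⟨y, hy⟩ := hO.exists_mem_reachSet_column hinf n
  have hyn := hO.reach_le_of_edgeUpperBound hr0 hJ le_rfl hy
  have hny := hO'.reach_le_of_edgeUpperBound hr0 hK le_rfl (Reach.transpose hy)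
  have hy0 : (0 : ℝ) ≤ y := Int.cast_nonneg (Reach.snd_le hy)
  have := mul_nonneg hy0 (sub_nonneg.2 hr1.le)
  simp only [Int.cast_natCast, Int.cast_zero, sub_zero, zero_add] at hyn hny
  nlinarith

end

section

variable {p p' t : ℝ} {U : Sample}

/-- The reflection that turns the steps of the model into right, up and diagonal. -/
def mirror : ℤ × ℤ ≃ ℤ × ℤ := (Equiv.neg ℤ).prodCongr (Equiv.refl ℤ)

@[simp] lemma mirror_apply (x : ℤ × ℤ) : mirror x = (-x.1, x.2) := rfl

lemma mirror_mirror (x : ℤ × ℤ) : mirror (mirror x) = x := by simp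

lemma sub_mem_env_iff (x y : ℤ × ℤ) :
    y - x ∈ env p U x ↔ Step (openSites p (reindex mirror U)) (mirror x) (mirror y) := by
  rw [openSites_reindex, Step, mem_preimage, mirror_mirror]
  refine and_congr_right fun _ => ?_
  simp only [steps, mem_insert_iff, mem_singleton_iff, Prod.ext_iff, Prod.fst_sub, Prod.snd_sub,
    mirror_apply]
  omega

lemma originCluster_eq (p : ℝ) (U : Sample) :
    originCluster p U = mirror ⁻¹' reachSet (openSites p (reindex mirror U)) (0, 0) := by
  ext y
  constructor
  · exact fun h => Relation.ReflTransGen.lift mirror (fun _ _ => (sub_mem_env_iff _ _).1) _ _ h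
  · intro h
    have hconn : Connects (env p U) (mirror (0, 0)) (mirror (mirror y)) := by
      refine Relation.ReflTransGen.lift mirror (fun a b hab => ?_) _ _ h
      refine (sub_mem_env_iff _ _).2 ?_
      rwa [mirror_mirror, mirror_mirror]
    rwa [mirror_mirror] at hconn

lemma theta_eq (p : ℝ) : theta p = law {U | (reachSet (openSites p U) (0, 0)).Infinite} := by
  rw [← law_reindex mirror]
  simp only [theta, originCluster_eq, infinite_preimage_equiv]
  rfl

lemma theta_eq_zero_iff :
    theta p = 0 ↔ ∀ᵐ U ∂law, ¬ (reachSet (openSites p U) (0, 0)).Infinite := by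
  simp only [theta_eq, ae_iff, not_not]

lemma theta_mono (h : p ≤ p') : theta p ≤ theta p' := by
  rw [theta_eq, theta_eq]
  exact measure_mono fun U hU => hU.mono fun x hx => Reach.mono (openSites_mono h U) hx

lemma ae_transpose {P : Set (ℤ × ℤ) → Prop} (h : ∀ᵐ U ∂law, P (openSites p U)) :
    ∀ᵐ U ∂law, P (transpose (openSites p U)) := by
  filter_upwards [ae_reindex (Equiv.prodComm ℤ ℤ) h] with U hU
  rwa [openSites_reindex] at hU

lemma ae_not_infinite_reachSet (h : theta p = 0) (x : ℤ × ℤ) :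
    ∀ᵐ U ∂law, ¬ (reachSet (openSites p U) x).Infinite := by
  filter_upwards [ae_reindex (Equiv.addRight x) (theta_eq_zero_iff.1 h)] with U hU hinf
  rw [openSites_reindex] at hU
  refine hU ((infinite_reachSet_translate x).2 ?_)
  rwa [Prod.mk_zero_zero, zero_add]

lemma theta_pos_of_ae_edgeLowerBound (hp0 : 0 < p) (hp1 : p < 1) (ht : 1 < t)
    (h : ∀ᵐ U ∂law, ∃ K, EdgeLowerBound (openSites p U) t K) : 0 < theta p := by
  by_contra! hzero
  have hfalse : ∀ᵐ _ ∂law, False := by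
    filter_upwards [ae_all_iff.2 (ae_not_infinite_reachSet (nonpos_iff_eq_zero.1 hzero)),
      ae_hasEdge hp0 hp1, ae_transpose (ae_hasEdge hp0 hp1), h,
      ae_transpose (P := fun O => ∃ K, EdgeLowerBound O t K) h]
      with U hfin hO hO' ⟨J, hJ⟩ ⟨K, hK⟩
    obtain ⟨x, hx⟩ := hO.exists_infinite_reachSet hO' ht hJ hK
    exact hfin x hx
  exact hfalse.exists.elim fun _ => id

lemma theta_eq_zero_of_ae_edgeUpperBound (hp0 : 0 < p) (hp1 : p < 1) {r : ℝ} (hr0 : 0 ≤ r)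
    (hr1 : r < 1) (h : ∀ᵐ U ∂law, ∃ K, EdgeUpperBound (openSites p U) r K 0 0) : theta p = 0 := by
  rw [theta_eq_zero_iff]
  filter_upwards [ae_hasEdge hp0 hp1, ae_transpose (ae_hasEdge hp0 hp1), h,
    ae_transpose (P := fun O => ∃ K, EdgeUpperBound O r K 0 0) h] with U hO hO' ⟨J, hJ⟩ ⟨K, hK⟩
  exact not_infinite.2 (hO.finite_reachSet hO' hr0 hr1 hJ hK)

end

/-! ### The speed of the upper edge -/

/-- The asymptotic mean speed of the upper edge, as the infimum of the mean speeds over finite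
times. It is only used where the latter are bounded below: otherwise the infimum is the junk value
`0`. -/
noncomputable def speed (p : ℝ) : ℝ := ⨅ n : ℕ, meanEdge p (n + 1) / (n + 1 : ℕ)

section

variable {p s t : ℝ}

lemma le_speed (hs : ∀ n : ℕ, s * n ≤ meanEdge p n) : s ≤ speed p :=
  le_ciInf fun n => (le_div_iff₀ (by positivity)).2 (hs (n + 1))

lemma speed_mul_le (hs : ∀ n : ℕ, s * n ≤ meanEdge p n) (n : ℕ) : speed p * n ≤ meanEdge p n := by
  cases n with
  | zero => simpa using hs 0
  | succ n =>
    rw [← le_div_iff₀ (by positivity)]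
    refine ciInf_le ⟨s, ?_⟩ n
    rintro _ ⟨n, rfl⟩
    exact (le_div_iff₀ (by positivity)).2 (hs (n + 1))

lemma exists_meanEdge_lt (h : speed p < s) : ∃ m : ℕ, 0 < m ∧ meanEdge p m < s * m := by
  obtain ⟨n, hn⟩ := exists_lt_of_ciInf_lt h
  exact ⟨n + 1, n.succ_pos, (div_lt_iff₀ (by positivity)).1 hn⟩

-- The bound on the failure probability is an open condition on the parameter, so the multi-scale
-- iteration also starts at slightly smaller parameters.
lemma ScaleConst.exists_forall_ae_edgeLowerBound {ε : ℝ} {Q M L h : ℕ} (hC : ScaleConst t s ε Q M)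
    (hp0 : 0 < p) (hh : 1 ≤ h) (hthin : (h : ℝ) ≤ ε * L)
    (hfail : failProb p L h s < ENNReal.ofReal (1 / (64 * M ^ 2))) :
    ∃ p₀, 0 < p₀ ∧ p₀ < p ∧ ∀ p', p₀ ≤ p' → p' < 1 →
      ∀ᵐ U ∂law, ∃ K, EdgeLowerBound (openSites p' U) t K := by
  obtain ⟨q, hqp, hfail_q⟩ := exists_lt_failProb_lt hfail
  refine ⟨max q (p / 2), lt_max_of_lt_right (half_pos hp0), max_lt hqp (half_lt_self hp0),
    fun p' hp' hp'1 => ?_⟩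
  obtain ⟨hq, hhalf⟩ := max_le_iff.1 hp'
  have hscale : ScaleInv p' t s ε M 0 ⟨L, h, s⟩ :=
    { pos := hh
      thin := by rwa [pow_zero, mul_one]
      steep := by linarith [hC.loss]
      le := le_rfl
      fail := by
        rw [pow_zero, mul_one]
        exact (failProb_anti hq).trans hfail_q.le }
  exact hscale.ae_edgeLowerBound hC ((half_pos hp0).trans_le hhalf) hp'1

lemma exists_forall_ae_edgeLowerBound (hp0 : 0 < p) (hp1 : p < 1) (ht : 1 < t) (hts : t < s)
    (hs : ∀ n : ℕ, s * n ≤ meanEdge p n) :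
    ∃ p₀, 0 < p₀ ∧ p₀ < p ∧ ∀ p', p₀ ≤ p' → p' < 1 →
      ∀ᵐ U ∂law, ∃ K, EdgeLowerBound (openSites p' U) t K := by
  have htspeed : t < speed p := hts.trans_le (le_speed hs)
  obtain ⟨ε, Q, M, hC⟩ := exists_scaleConst ht htspeed
  have hM := hC.M_pos
  obtain ⟨L, h, hh, hthin, hfail⟩ := exists_failProb_le hp0 hp1 (by linarith) (speed_mul_le hs)
    (fun ε hε => exists_meanEdge_lt (lt_add_of_pos_right _ hε)) hC.pos
    (δ := 1 / (64 * M ^ 2)) (by positivity)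
  exact hC.exists_forall_ae_edgeLowerBound hp0 hh hthin hfail

lemma le_meanEdge_of_theta_pos (hp0 : 0 < p) (hp1 : p < 1) (hθ : 0 < theta p) (n : ℕ) :
    (n : ℝ) ≤ meanEdge p n := by
  rcases n.eq_zero_or_pos with rfl | hn
  · simp [meanEdge]
  by_contra! hlt
  have hn0 : (0 : ℝ) < n := Nat.cast_pos.2 hn
  obtain ⟨r, hr, hr1⟩ := exists_between (max_lt one_pos ((div_lt_one hn0).2 hlt))
  obtain ⟨hr0, hnr⟩ := max_lt_iff.1 hr
  exact hθ.ne' (theta_eq_zero_of_ae_edgeUpperBound hp0 hp1 hr0.le hr1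
    (ae_edgeUpperBound hp0 hp1 hn hr0.le ((div_lt_iff₀ hn0).1 hnr)))

end

/-! ### The critical value -/

section

variable {p : ℝ}

lemma crossed_univ (L : ℕ) : Crossed univ 0 0 L 1 2 := by
  have hmem : ∀ k : ℕ, k ≤ L → ∀ i : ℕ, i ≤ 1 → ((k : ℤ), (2 * k + i : ℤ)) ∈ tube 0 0 L 1 2 := by
    intro k hk i hi
    refine mem_tube.2 ⟨Int.natCast_nonneg k, by simpa using hk, ?_, ?_⟩ <;> push_cast
    · linarith
    · have hi' : (i : ℝ) ≤ 1 := mod_cast hi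
      linarith
  have hreach : ∀ k : ℕ, k ≤ L →
      Reach (univ ∩ tube 0 0 L 1 2) ((0 : ℕ), 2 * (0 : ℕ) + (0 : ℕ)) (k, 2 * k + (0 : ℕ)) := by
    intro k hk
    induction k with
    | zero => exact .refl _
    | succ k ih =>
      have hk' : k ≤ L := k.le_succ.trans hk
      have hup : Step (univ ∩ tube 0 0 L 1 2) (k, 2 * k + (0 : ℕ)) (k, 2 * k + (1 : ℕ)) :=
        ⟨⟨mem_univ _, hmem k hk' 0 zero_le_one⟩, by simp⟩
      have hdiag : Step (univ ∩ tube 0 0 L 1 2) (k, 2 * k + (1 : ℕ))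
          ((k + 1 : ℕ), 2 * (k + 1 : ℕ) + (0 : ℕ)) :=
        ⟨⟨mem_univ _, hmem k hk' 1 le_rfl⟩, Or.inr (Or.inr (Prod.ext (by simp) (by simp; ring)))⟩
      exact (ih hk').trans (hup.reach.trans hdiag.reach)
  exact ⟨_, _, rfl, (zero_add _).symm, hmem 0 L.zero_le 0 zero_le_one, hmem L le_rfl 0 zero_le_one,
    hreach L le_rfl⟩

lemma failProb_one (L : ℕ) : failProb 1 L 1 2 = 0 := by
  have hcrossed : ∀ᵐ U ∂law, Crossed (openSites 1 U) 0 0 L 1 2 := by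
    filter_upwards [ae_ne 1] with U hU
    rw [show openSites 1 U = univ from eq_univ_of_forall fun x => (U x).2.2.lt_of_ne (hU x)]
    exact crossed_univ L
  exact hcrossed

lemma exists_theta_pos : ∃ p : ℝ, 0 < p ∧ p < 1 ∧ 0 < theta p := by
  obtain ⟨ε, Q, M, hC⟩ := exists_scaleConst (t := 3 / 2) (s₀ := 2) (by norm_num) (by norm_num)
  have hM := hC.M_pos
  obtain ⟨L, hL⟩ := exists_nat_ge (1 / ε)
  rw [div_le_iff₀' hC.pos] at hL
  obtain ⟨p, hp0, hp1, hae⟩ := hC.exists_forall_ae_edgeLowerBound (p := 1) (L := L) one_pos le_rfl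
    (by rwa [Nat.cast_one]) (by rw [failProb_one L, ENNReal.ofReal_pos]; positivity)
  exact ⟨p, hp0, hp1, theta_pos_of_ae_edgeLowerBound hp0 hp1 hC.one_lt (hae p le_rfl hp1)⟩

lemma pc_le (hp0 : 0 ≤ p) (hp1 : p ≤ 1) (hθ : 0 < theta p) : pc ≤ p :=
  csInf_le ⟨0, fun _ hq => hq.1.1⟩ ⟨⟨hp0, hp1⟩, hθ⟩

lemma pc_lt_one : pc < 1 := by
  obtain ⟨p, hp0, hp1, hθ⟩ := exists_theta_pos
  exact (pc_le hp0.le hp1.le hθ).trans_lt hp1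

lemma theta_pos_of_pc_lt (hpc : pc < p) : 0 < theta p := by
  obtain ⟨q, hq0, hq1, hq⟩ := exists_theta_pos
  have hne : {p : ℝ | p ∈ Icc (0 : ℝ) 1 ∧ 0 < theta p}.Nonempty := ⟨q, ⟨hq0.le, hq1.le⟩, hq⟩
  obtain ⟨q, ⟨-, hq⟩, hqp⟩ := exists_lt_of_csInf_lt hne hpc
  exact hq.trans_le (theta_mono hqp.le)

lemma half_le_of_theta_pos (hθ : 0 < theta p) : 1 / 2 ≤ p := by
  by_contra! hlt
  obtain ⟨q, hq, hq2⟩ := exists_between (max_lt hlt (by norm_num : (0 : ℝ) < 1 / 2))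
  obtain ⟨hpq, hq0⟩ := max_lt_iff.1 hq
  have hq1 : q < 1 := by linarith
  have hmean := (le_meanEdge_of_theta_pos hq0 hq1 (hθ.trans_le (theta_mono hpq.le)) 1).trans
    (meanEdge_one_le hq0 hq1)
  rw [Nat.cast_one, le_div_iff₀ (sub_pos.2 hq1)] at hmean
  linarith

lemma pc_pos : 0 < pc := by
  obtain ⟨q, hq0, hq1, hq⟩ := exists_theta_pos
  exact one_half_pos.trans_le
    (le_csInf ⟨q, ⟨hq0.le, hq1.le⟩, hq⟩ fun _ hp => half_le_of_theta_pos hp.2)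

end

/-! ### Properties of the speed -/

section

variable {p p' r t b : ℝ}

lemma le_meanEdge_of_pc_lt (hpc : pc < p) (hp1 : p < 1) (n : ℕ) : 1 * (n : ℝ) ≤ meanEdge p n := by
  rw [one_mul]
  exact le_meanEdge_of_theta_pos (pc_pos.trans hpc) hp1 (theta_pos_of_pc_lt hpc) n

lemma speed_add_le (hpc : pc < p) (hpp' : p ≤ p') (hp'1 : p' < 1) :
    speed p + (p' - p) ≤ speed p' := by
  refine le_speed fun n => ?_
  have hspeed := speed_mul_le (le_meanEdge_of_pc_lt hpc (hpp'.trans_lt hp'1)) n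
  have hgain := meanEdge_add_mul_le (pc_pos.trans hpc) hpp' hp'1 n
  linarith

lemma one_lt_speed (hpc : pc < p) (hp1 : p < 1) : 1 < speed p := by
  obtain ⟨q, hq, hqp⟩ := exists_between hpc
  have hspeed_q : 1 ≤ speed q := le_speed (le_meanEdge_of_pc_lt hq (hqp.trans hp1))
  linarith [speed_add_le hq hqp.le hp1]

lemma ae_edgeUpperBound_of_speed_lt (hp0 : 0 < p) (hp1 : p < 1) (hr0 : 0 ≤ r) (hr : speed p < r) :
    ∀ᵐ U ∂law, ∃ K, EdgeUpperBound (openSites p U) r K 0 0 := by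
  obtain ⟨m, hm, hlt⟩ := exists_meanEdge_lt hr
  exact ae_edgeUpperBound hp0 hp1 hm hr0 hlt

lemma ae_edgeLowerBound_of_lt_speed (hpc : pc < p) (hp1 : p < 1) (ht : 1 < t)
    (hts : t < speed p) : ∀ᵐ U ∂law, ∃ K, EdgeLowerBound (openSites p U) t K := by
  obtain ⟨p₀, -, hp, hae⟩ := exists_forall_ae_edgeLowerBound (pc_pos.trans hpc) hp1 ht hts
    (speed_mul_le (le_meanEdge_of_pc_lt hpc hp1))
  exact hae p hp.le hp1

lemma le_speed_of_ae_edgeLowerBound (hp0 : 0 < p) (hp1 : p < 1) (ht : 0 < t)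
    (h : ∀ᵐ U ∂law, ∃ K, EdgeLowerBound (openSites p U) t K) : t ≤ speed p := by
  by_contra! hlt
  obtain ⟨r, hr, hrt⟩ := exists_between (max_lt ht hlt)
  obtain ⟨hr0, hspeed⟩ := max_lt_iff.1 hr
  obtain ⟨U, ⟨J, hJ⟩, K, hK⟩ :=
    (h.and (ae_edgeUpperBound_of_speed_lt hp0 hp1 hr0.le hspeed)).exists
  obtain ⟨n, hn⟩ := exists_nat_gt ((J + K : ℝ) / (t - r))
  rw [div_lt_iff₀ (sub_pos.2 hrt)] at hn
  have hupper := hK n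
  rw [Int.cast_zero] at hupper
  linarith [hJ n]

lemma eventually_speed_lt (hpc : pc ≤ p) (hp1 : p < 1) {m : ℕ}
    (hb : meanEdge p m < b * m) : ∀ᶠ q in 𝓝[>] p, speed q < b := by
  filter_upwards [(tendsto_meanEdge_nhdsGT (pc_pos.trans_le hpc) hp1 m).eventually_lt_const hb,
    Ioo_mem_nhdsGT hp1] with q hq hpq
  have hspeed := speed_mul_le (le_meanEdge_of_pc_lt (hpc.trans_lt hpq.1) hpq.2) m
  exact lt_of_mul_lt_mul_right (hspeed.trans_lt hq) m.cast_nonneg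

lemma eventually_lt_speed (hpc : pc < p) (hp1 : p < 1) (hb : b < speed p) :
    ∀ᶠ q in 𝓝 p, b < speed q := by
  obtain ⟨t, ht, hts⟩ := exists_between (max_lt (one_lt_speed hpc hp1) hb)
  obtain ⟨ht1, hbt⟩ := max_lt_iff.1 ht
  obtain ⟨p₀, hp₀, hp, hae⟩ := exists_forall_ae_edgeLowerBound (pc_pos.trans hpc) hp1 ht1 hts
    (speed_mul_le (le_meanEdge_of_pc_lt hpc hp1))
  filter_upwards [Ioo_mem_nhds hp hp1] with q hq
  exact hbt.trans_le (le_speed_of_ae_edgeLowerBound (hp₀.trans hq.1) hq.2 (one_pos.trans ht1)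
    (hae q hq.1.le hq.2))

lemma continuousAt_speed (hpc : pc < p) (hp1 : p < 1) : ContinuousAt speed p := by
  refine tendsto_order.2 ⟨fun b hb => eventually_lt_speed hpc hp1 hb, fun b hb => ?_⟩
  rw [← nhdsLE_sup_nhdsGT, eventually_sup]
  constructor
  · filter_upwards [Ioc_mem_nhdsLE hpc] with q hq
    linarith [speed_add_le hq.1 hq.2 hp1, hq.2]
  · obtain ⟨m, -, hlt⟩ := exists_meanEdge_lt hb
    exact eventually_speed_lt hpc.le hp1 hlt

-- Otherwise the edge would be faster than `1` slightly below the critical value as well.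
lemma exists_meanEdge_pc_lt (hb : 1 < b) : ∃ m : ℕ, meanEdge pc m < b * m := by
  by_contra! hle
  obtain ⟨t, ht, htb⟩ := exists_between hb
  obtain ⟨p, hp0, hp, hae⟩ := exists_forall_ae_edgeLowerBound pc_pos pc_lt_one ht htb hle
  have hp1 := hp.trans pc_lt_one
  exact hp.not_ge
    (pc_le hp0.le hp1.le (theta_pos_of_ae_edgeLowerBound hp0 hp1 ht (hae p le_rfl hp1)))

lemma tendsto_speed_pc : Tendsto speed (𝓝[>] pc) (𝓝 1) := by
  refine tendsto_order.2 ⟨fun b hb => ?_, fun b hb => ?_⟩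
  · filter_upwards [Ioo_mem_nhdsGT pc_lt_one] with q hq
    exact hb.trans (one_lt_speed hq.1 hq.2)
  · obtain ⟨m, hlt⟩ := exists_meanEdge_pc_lt hb
    exact eventually_speed_lt le_rfl pc_lt_one hlt

end

/-! ### The boundary slope -/

section

variable {O S : Set (ℤ × ℤ)} {n K : ℕ} {a b r t : ℝ}

lemma upper_mirror_le (h : ∀ y : ℤ, ((n : ℤ), y) ∈ S → (y : ℝ) ≤ b) :
    upper (mirror ⁻¹' S) n ≤ (b : EReal) :=
  iSup₂_le fun y hy => EReal.coe_le_coe_iff.2 (h y (by simpa using hy))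

lemma le_upper_mirror {y : ℤ} (hy : ((n : ℤ), y) ∈ S) (h : b ≤ y) :
    (b : EReal) ≤ upper (mirror ⁻¹' S) n :=
  le_iSup₂_of_le y (by simpa using hy) (EReal.coe_le_coe_iff.2 h)

lemma lower_mirror_le {y : ℤ} (hy : ((n : ℤ), y) ∈ S) (h : (y : ℝ) ≤ b) :
    lower (mirror ⁻¹' S) n ≤ (b : EReal) :=
  iInf₂_le_of_le y (by simpa using hy) (EReal.coe_le_coe_iff.2 h)

lemma le_lower_mirror (h : ∀ y : ℤ, ((n : ℤ), y) ∈ S → b ≤ y) :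
    (b : EReal) ≤ lower (mirror ⁻¹' S) n :=
  le_iInf₂ fun y hy => EReal.coe_le_coe_iff.2 (h y (by simpa using hy))

lemma HasEdge.upper_le (hO : HasEdge O) (hr : 0 ≤ r) (hK : EdgeUpperBound O r K 0 0) (n : ℕ) :
    upper (mirror ⁻¹' reachSet O (0, 0)) n ≤ ((r * n + (r + K) : ℝ) : EReal) := by
  refine upper_mirror_le fun y hy => ?_
  have hle := hO.reach_le_of_edgeUpperBound hr hK le_rfl hy
  simp only [Int.cast_zero, Int.cast_natCast, zero_add, sub_zero] at hle
  linarith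

lemma HasEdge.le_upper (hO : HasEdge O) (hinf : (reachSet O (0, 0)).Infinite)
    (hK : EdgeLowerBound O t K) (n : ℕ) :
    ((t * n - K : ℝ) : EReal) ≤ upper (mirror ⁻¹' reachSet O (0, 0)) n := by
  obtain ⟨y, hy, hle⟩ := hO.exists_mem_reachSet_edge_le hinf n
  exact le_upper_mirror hy ((hK n).trans (Int.cast_le.2 hle))

lemma HasEdge.lower_le (hO : HasEdge (transpose O)) (hinf : (reachSet O (0, 0)).Infinite)
    (ht : 1 ≤ t) (hK : EdgeLowerBound (transpose O) t K) (n : ℕ) :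
    lower (mirror ⁻¹' reachSet O (0, 0)) n ≤ ((t⁻¹ * n + (K + 1) : ℝ) : EReal) := by
  obtain ⟨k, hnk, hk⟩ := hK.exists_le_edge ht n
  obtain ⟨x, hx, hkx⟩ := hO.exists_mem_reachSet_edge_le (infinite_reachSet_transpose.2 hinf) k
  have hreach : Reach O (0, 0) (x, k) := reach_transpose.1 hx
  obtain ⟨⟨_, y⟩, rfl, hy, hyk⟩ :=
    hreach.exists_fst_eq (c := n) (Int.natCast_nonneg n) (hnk.trans hkx)
  have hyk' : (y : ℝ) ≤ k := by exact_mod_cast hyk.snd_le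
  exact lower_mirror_le hy (hyk'.trans hk)

lemma HasEdge.le_lower (hO : HasEdge (transpose O)) (hr : 1 ≤ r)
    (hK : EdgeUpperBound (transpose O) r K 0 0) (n : ℕ) :
    ((r⁻¹ * n - (K + 1) : ℝ) : EReal) ≤ lower (mirror ⁻¹' reachSet O (0, 0)) n := by
  have hr0 : 0 < r := one_pos.trans_le hr
  refine le_lower_mirror fun y hy => ?_
  have hle := hO.reach_le_of_edgeUpperBound hr0.le hK le_rfl (Reach.transpose hy)
  simp only [Int.cast_zero, Int.cast_natCast, zero_add, sub_zero] at hle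
  have hKr : (K : ℝ) ≤ r * K := le_mul_of_one_le_left K.cast_nonneg hr
  rw [sub_le_iff_le_add, inv_mul_le_iff₀ hr0]
  linarith

/-- The upper edge of the sites reachable from the vertical half-line below the origin grows
linearly with speed `a`, up to an arbitrarily small change of slope. -/
structure HasSpeed (O : Set (ℤ × ℤ)) (a : ℝ) : Prop where
  hasEdge : HasEdge O
  upperBound : ∀ r > a, ∃ K, EdgeUpperBound O r K 0 0
  lowerBound : ∀ t < a, ∃ K, EdgeLowerBound O t K

lemma HasSpeed.tendsto_upper (h : HasSpeed O a) (ha : 0 ≤ a)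
    (hinf : (reachSet O (0, 0)).Infinite) :
    Tendsto (fun n : ℕ => upper (mirror ⁻¹' reachSet O (0, 0)) n / ((-(n : ℝ) : ℝ) : EReal)) atTop
      (𝓝 ((-a : ℝ) : EReal)) := by
  refine tendsto_ereal_div_neg_of_linear_bounds (fun r hr => ?_) fun t ht => ?_
  · obtain ⟨K, hK⟩ := h.upperBound r hr
    exact ⟨r + K, h.hasEdge.upper_le (ha.trans hr.le) hK⟩
  · obtain ⟨K, hK⟩ := h.lowerBound t ht
    exact ⟨K, h.hasEdge.le_upper hinf hK⟩

lemma HasSpeed.tendsto_lower (h : HasSpeed (transpose O) a) (ha : 1 < a)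
    (hinf : (reachSet O (0, 0)).Infinite) :
    Tendsto (fun n : ℕ => lower (mirror ⁻¹' reachSet O (0, 0)) n / ((-(n : ℝ) : ℝ) : EReal)) atTop
      (𝓝 ((-a⁻¹ : ℝ) : EReal)) := by
  have ha0 : 0 < a := one_pos.trans ha
  refine tendsto_ereal_div_neg_of_linear_bounds (fun b hb => ?_) fun b hb => ?_
  · obtain ⟨c, hac, hc⟩ := exists_between (lt_min hb (inv_lt_one_of_one_lt₀ ha))
    obtain ⟨hcb, hc1⟩ := lt_min_iff.1 hc
    have hc0 : 0 < c := (inv_pos.2 ha0).trans hac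
    obtain ⟨K, hK⟩ := h.lowerBound c⁻¹ (inv_lt_of_inv_lt₀ ha0 hac)
    refine ⟨K + 1, fun n => (h.hasEdge.lower_le hinf ((one_le_inv₀ hc0).2 hc1.le) hK n).trans ?_⟩
    rw [inv_inv, EReal.coe_le_coe_iff]
    gcongr
  · obtain ⟨c, hc, hca⟩ := exists_between (max_lt hb (inv_pos.2 ha0))
    obtain ⟨hbc, hc0⟩ := max_lt_iff.1 hc
    have hc1 : c ≤ 1 := hca.le.trans (inv_lt_one_of_one_lt₀ ha).le
    obtain ⟨K, hK⟩ := h.upperBound c⁻¹ ((lt_inv_comm₀ ha0 hc0).2 hca)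
    refine ⟨K + 1, fun n => le_trans ?_ (h.hasEdge.le_lower ((one_le_inv₀ hc0).2 hc1) hK n)⟩
    rw [inv_inv, EReal.coe_le_coe_iff]
    gcongr

end

section

variable {p : ℝ}

lemma ae_hasSpeed (hpc : pc < p) (hp1 : p < 1) :
    ∀ᵐ U ∂law, HasSpeed (openSites p U) (speed p) := by
  have hp0 := pc_pos.trans hpc
  have hs := one_lt_speed hpc hp1
  have hupper : ∀ᵐ U ∂law, ∀ r : ℚ, speed p < r → ∃ K, EdgeUpperBound (openSites p U) r K 0 0 :=
    ae_all_iff.2 fun r => eventually_imp_distrib_left.2 fun hr =>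
      ae_edgeUpperBound_of_speed_lt hp0 hp1 (by linarith) hr
  have hlower : ∀ᵐ U ∂law, ∀ t : ℚ, 1 < (t : ℝ) → t < speed p →
      ∃ K, EdgeLowerBound (openSites p U) t K :=
    ae_all_iff.2 fun t => eventually_imp_distrib_left.2 fun ht =>
      eventually_imp_distrib_left.2 fun hts => ae_edgeLowerBound_of_lt_speed hpc hp1 ht hts
  filter_upwards [ae_hasEdge hp0 hp1, hupper, hlower] with U hO hupper hlower
  refine ⟨hO, fun r hr => ?_, fun t ht => ?_⟩
  · obtain ⟨q, hq, hqr⟩ := exists_rat_btwn hr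
    obtain ⟨K, hK⟩ := hupper q hq
    refine ⟨K, fun n => (hK n).trans ?_⟩
    gcongr
  · obtain ⟨q, hq, hqs⟩ := exists_rat_btwn (max_lt hs ht)
    obtain ⟨hq1, htq⟩ := max_lt_iff.1 hq
    obtain ⟨K, hK⟩ := hlower q hq1 hqs
    refine ⟨K, fun n => le_trans ?_ (hK n)⟩
    gcongr

lemma isBoundarySlope_neg_speed (hpc : pc < p) (hp1 : p < 1) : IsBoundarySlope p (-speed p) := by
  have hs := one_lt_speed hpc hp1
  have hspeed := ae_hasSpeed hpc hp1
  filter_upwards [ae_reindex mirror hspeed,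
    ae_reindex mirror (ae_transpose (P := fun O => HasSpeed O (speed p)) hspeed)] with U hU hU'
  rw [originCluster_eq, infinite_preimage_equiv, one_div, inv_neg]
  exact fun hinf => ⟨hU.tendsto_upper (one_pos.trans hs).le hinf, hU'.tendsto_lower hs hinf⟩

lemma IsBoundarySlope.unique {r r' : ℝ} (h : IsBoundarySlope p r) (hθ : 0 < theta p)
    (h' : IsBoundarySlope p r') : r = r' := by
  have hfreq : ∃ᵐ U ∂law, (originCluster p U).Infinite := frequently_ae_iff.2 hθ.ne'
  obtain ⟨U, hinf, hU, hU'⟩ := (hfreq.and_eventually (h.and h')).exists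
  exact EReal.coe_injective (tendsto_nhds_unique (hU hinf).1 (hU' hinf).1)

end

end OTSP

theorem lemma2 :
    OTSP.pc < 1 ∧
    ∃ ρ : ℝ → ℝ,
      (∀ p ∈ Ioo OTSP.pc 1, ∀ r : ℝ, OTSP.IsBoundarySlope p r ↔ r = ρ p) ∧
      ContinuousOn ρ (Ioo OTSP.pc 1) ∧
      StrictAntiOn ρ (Ioo OTSP.pc 1) ∧
      Tendsto ρ (𝓝[>] OTSP.pc) (𝓝 (-1)) := by
  refine ⟨OTSP.pc_lt_one, fun p => -OTSP.speed p, fun p hp r => ⟨fun h => ?_, ?_⟩,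
    fun p hp => ?_, fun p hp q hq hpq => ?_, OTSP.tendsto_speed_pc.neg⟩
  · exact h.unique (OTSP.theta_pos_of_pc_lt hp.1) (OTSP.isBoundarySlope_neg_speed hp.1 hp.2)
  · rintro rfl
    exact OTSP.isBoundarySlope_neg_speed hp.1 hp.2
  · exact (OTSP.continuousAt_speed hp.1 hp.2).neg.continuousWithinAt
  · have := OTSP.speed_add_le hp.1 hpq.le hq.2
    simp only [neg_lt_neg_iff]
    linarith
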